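/- **Setting.** Let $G$ be a finite-dimensional real Lie group with semisimple Lie algebra $\mathfrak g$ and Killing form $\kappa$, let $\gamma\in\mathbb R\setminus\{0\}$, and let $R:\mathfrak g\to\mathfrak g$ be linear, skew-symmetric for $\kappa$, with $$[RX,RY]-R\bigl([RX,Y]+[X,RY]\bigr)=-c^2[X,Y]\qquad(X,Y\in\mathfrak g),$$ where $c=1$ (split case) or $c=i$ (non-split case). Put $R^\pm=R\pm c\,\mathrm{Id}$. The kernel of an endomorphism $T$ is $T_{12}=\sum_a T(b_a)\otimes b^a$ for $\kappa$-dual bases $(b_a),(b^a)$ of $\mathfrak g$; thus $R^\pm_{12}=R_{12}\pm c\,C_{12}$ with $C_{12}=\sum_a b_a\otimes b^a$. Equip $G$ with the Sklyanin bracket $\{x_1,x_2\}_G=\gamma[R_{12},x_1x_2]$. Let $G^*$ be the connected, simply connected Lie group with Lie algebra $\mathfrak g^*$, with bracket $[d_ef,d_eh]_*=d_e\{f,h\}_G$, and let $\pi:\mathfrak g\to\mathfrak g^*$, $\pi(X)=\kappa(X,\cdot)$. Let $M$ be a finite-dimensional Hausdorff Poisson manifold with Poisson tensor $P$, and let $\rho:M\times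 G\to M$ be a smooth right action that is a Poisson map. For $\epsilon\in\mathfrak g$ let $\delta_\epsilon f(m)=\frac{d}{dt}\big|_{t=0}f(\rho(m,\exp(t\epsilon)))$. Let $\Gamma:M\to G^*$ be a smooth non-abelian moment map, that is, $$\delta_\epsilon f=-\langle\epsilon,\Gamma^{-1}\{\Gamma,f\}\rangle\qquad\text{for all }\epsilon\in\mathfrak g,\ f\in C^\infty(M).$$ For maps $A,B$ from $M$ to Lie groups, $\{A,f\}(m)=(dA_m\otimes d_mf)(P_m)$ and $\{A_1,B_2\}(m)=(dA_m\otimes dB_m)(P_m)\in T_{A(m)}\otimes T_{B(m)}$ (tensor product over $\mathbb C$ for maps to a complex Lie group), and products of tangent vectors or tensors with group elements denote left and right translations, so that $[r_{12},A_1B_2]=r_{12}A_1B_2-A_1B_2\,r_{12}$. A map $N_{12}$ from $M$ to a finite-dimensional vector space is central if it is smooth and its components Poisson commute with all smooth functions on $M$. **Split case ($c=1$).** Let $(\Gamma^+,\Gamma^-):M\to G\times G$ be the composite of $\Gamma$ with the Lie group homomorphism $G^*\to G\times G$ whose differential is $\Delta\circ\pi^{-1}$, $\Delta X=\gamma(R^+X,R^-X)$.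 Then: 1. $(\Gamma^+,\Gamma^-)$ takes values in $G_{DR}$, the connected Lie subgroup of $G\times G$ with Lie algebra $\mathfrak g_{DR}=\{(R^+X,R^-X):X\in\mathfrak g\}$. 2. There is a central skew-symmetric $N_{12}:M\to\mathfrak g\otimes\mathfrak g$ such that, with $N^{\eta\varepsilon}_{12}=(\gamma R^\eta\otimes\gamma R^\varepsilon)(N_{12})$ for $\eta,\varepsilon\in\{+,-\}$, $$\{\Gamma^\pm_1,\Gamma^\pm_2\}=\gamma[R_{12},\Gamma^\pm_1\Gamma^\pm_2]+N^{\pm\pm}_{12}\Gamma^\pm_1\Gamma^\pm_2,\qquad\{\Gamma^\pm_1,\Gamma^\mp_2\}=\gamma[R^\pm_{12},\Gamma^\pm_1\Gamma^\mp_2]+N^{\pm\mp}_{12}\Gamma^\pm_1\Gamma^\mp_2 .$$ 3. For all $\epsilon\in\mathfrak g$ and $f\in C^\infty(M)$, $$\delta_\epsilon f=-\frac1{2\gamma}\,\kappa\Bigl(\epsilon,(\Gamma^+)^{-1}\{\Gamma^+,f\}-(\Gamma^-)^{-1}\{\Gamma^-,f\}\Bigr).$$ **Non-split case ($c=i$).**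 Let $G^{\mathbb C}$ be a complex Lie group with Lie algebra $\mathfrak g^{\mathbb C}=\mathbb C\otimes\mathfrak g$, and let $\Gamma^\pm:M\to G^{\mathbb C}$ be the composites of $\Gamma$ with the (real) Lie group homomorphisms $G^*\to G^{\mathbb C}$ whose differentials are $\gamma R^\pm\circ\pi^{-1}$. Then: 1. $\Gamma^\pm$ takes values in $G_\pm$, the connected real Lie subgroup of $G^{\mathbb C}$ with Lie algebra $\mathfrak g_\pm=\{R^\pm X:X\in\mathfrak g\}$. 2. There is a central skew-symmetric $N_{12}:M\to\mathfrak g\otimes\mathfrak g$ for which the brackets displayed above hold, now in tensor products over $\mathbb C$, again with $N^{\eta\varepsilon}_{12}=(\gamma R^\eta\otimes\gamma R^\varepsilon)(N_{12})\in\mathfrak g^{\mathbb C}\otimes_{\mathbb C}\mathfrak g^{\mathbb C}$. 3. For all $\epsilon\in\mathfrak g$ and $f\in C^\infty(M)$, with $\kappa$ extended complex bilinearly to $\mathfrak g^{\mathbb C}$, $$\delta_\epsilon f=\mp\frac1\gamma\,\mathrm{Im}\,\kappa\Bigl(\epsilon,(\Gamma^\pm)^{-1}\{\Gamma^\pm,f\}\Bigr)=-\frac1{2i\gamma}\,\kappa\Bigl(\epsilon,(\Gamma^+)^{-1}\{\Gamma^+,f\}-(\Gamma^-)^{-1}\{\Gamma^-,f\}\Bigr).$$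 -/

import Mathlib

open scoped Manifold ContDiff TensorProduct

universe uF uG

noncomputable section

namespace PoissonLie

/-! ### Auxiliary instances -/

/-- A smooth real Lie group has the regularity required for its Lie algebra. -/
instance instLieGroupMinSmoothness {E H G : Type*} [NormedAddCommGroup E] [NormedSpace ℝ E]
    [TopologicalSpace H] {I : ModelWithCorners ℝ E H} [TopologicalSpace G] [ChartedSpace H G]
    [Group G] [LieGroup I ∞ G] : LieGroup I (minSmoothness ℝ 3) G :=
  LieGroup.of_le (n := ∞) (by
    rw [minSmoothness_of_isRCLikeNormedField]
    exact WithTop.coe_le_coe.2 le_top)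

instance instFiniteDimensionalTangentSpace {E H M : Type*} [NormedAddCommGroup E]
    [NormedSpace ℝ E] [FiniteDimensional ℝ E] [TopologicalSpace H] (I : ModelWithCorners ℝ E H)
    [TopologicalSpace M] [ChartedSpace H M] (m : M) : FiniteDimensional ℝ (TangentSpace I m) :=
  inferInstanceAs (FiniteDimensional ℝ E)

/-! ### Poisson manifolds -/

section Poisson

variable {E H M : Type*} [NormedAddCommGroup E] [NormedSpace ℝ E] [TopologicalSpace H]
  {I : ModelWithCorners ℝ E H} [TopologicalSpace M] [ChartedSpace H M]
  {E₁ H₁ N₁ : Type*} [NormedAddCommGroup E₁] [NormedSpace ℝ E₁] [TopologicalSpace H₁]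
  {J₁ : ModelWithCorners ℝ E₁ H₁} [TopologicalSpace N₁] [ChartedSpace H₁ N₁]
  {E₂ H₂ N₂ : Type*} [NormedAddCommGroup E₂] [NormedSpace ℝ E₂] [TopologicalSpace H₂]
  {J₂ : ModelWithCorners ℝ E₂ H₂} [TopologicalSpace N₂] [ChartedSpace H₂ N₂]

/-- Contravariant two-tensor fields; they are made skew-symmetric in `IsPoisson`. -/
abbrev TensorField (I : ModelWithCorners ℝ E H) (M : Type*) [TopologicalSpace M]
    [ChartedSpace H M] : Type _ :=
  ∀ m : M, TangentSpace I m ⊗[ℝ] TangentSpace I m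

/-- Smooth real functions. -/
def IsSmooth (I : ModelWithCorners ℝ E H) (f : M → ℝ) : Prop := ContMDiff I 𝓘(ℝ, ℝ) ∞ f

/-- The differential `d_m f` as a linear form on `T_m M`. -/
def diff (I : ModelWithCorners ℝ E H) (f : M → ℝ) (m : M) : TangentSpace I m →ₗ[ℝ] ℝ :=
  (mfderiv I 𝓘(ℝ, ℝ) f m).toLinearMap

/-- The Poisson bracket `{f, h}` of two functions. -/
def pb (P : TensorField I M) (f h : M → ℝ) : M → ℝ := fun m =>
  TensorProduct.lid ℝ ℝ (TensorProduct.map (diff I f m) (diff I h m) (P m))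

/-- `{F, f}` at `m`, a tangent vector at `F m`, for a manifold-valued map `F`
and a function `f`. -/
def pbMap (J₁ : ModelWithCorners ℝ E₁ H₁) (P : TensorField I M) (F : M → N₁) (f : M → ℝ) (m : M) :
    TangentSpace J₁ (F m) :=
  TensorProduct.rid ℝ _
    (TensorProduct.map (mfderiv I J₁ F m).toLinearMap (diff I f m) (P m))

/-- `{F₁, K₂}` at `m`, an element of `T_{F m} ⊗ T_{K m}`, for manifold-valued maps `F`, `K`:
the subscripts refer to the tensor factors. -/
def pbTensor (J₁ : ModelWithCorners ℝ E₁ H₁) (J₂ : ModelWithCorners ℝ E₂ H₂)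
    (P : TensorField I M) (F : M → N₁) (K : M → N₂) (m : M) :
    TangentSpace J₁ (F m) ⊗[ℝ] TangentSpace J₂ (K m) :=
  TensorProduct.map (mfderiv I J₁ F m).toLinearMap (mfderiv I J₂ K m).toLinearMap (P m)

/-- `P` is a Poisson tensor: it is skew-symmetric and its bracket turns smooth functions into
smooth functions and satisfies the Jacobi identity. -/
structure IsPoisson (P : TensorField I M) : Prop where
  skew : ∀ m, TensorProduct.comm ℝ _ _ (P m) = -P m
  smooth : ∀ f h : M → ℝ, IsSmooth I f → IsSmooth I h → IsSmooth I (pb P f h)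
  jacobi : ∀ f h k : M → ℝ, IsSmooth I f → IsSmooth I h → IsSmooth I k →
    pb P f (pb P h k) + pb P h (pb P k f) + pb P k (pb P f h) = 0

/-- The direct product of two tensor fields. -/
def TensorField.prod (P₁ : TensorField J₁ N₁) (P₂ : TensorField J₂ N₂) :
    TensorField (J₁.prod J₂) (N₁ × N₂) := fun p =>
  pbTensor (J₁.prod J₂) (J₁.prod J₂) P₁ (fun x => (x, p.2)) (fun x => (x, p.2)) p.1 +
  pbTensor (J₁.prod J₂) (J₁.prod J₂) P₂ (fun y => (p.1, y)) (fun y => (p.1, y)) p.2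

/-- `F` sends the tensor field `P` to the tensor field `Q`. -/
def IsPoissonMap (P : TensorField J₁ N₁) (Q : TensorField J₂ N₂) (F : N₁ → N₂) : Prop :=
  ∀ x, pbTensor J₂ J₂ P F F x = Q (F x)

/-- `N` is a smooth map to a (finite-dimensional) vector space whose components Poisson commute
with all smooth functions. -/
def IsCentral {V : Type*} [AddCommGroup V] [Module ℝ V] (P : TensorField I M) (N : M → V) : Prop :=
  ∀ l : V →ₗ[ℝ] ℝ, IsSmooth I (fun m => l (N m)) ∧
    ∀ f : M → ℝ, IsSmooth I f → pb P (fun m => l (N m)) f = 0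

end Poisson

/-! ### Translations in Lie groups and integral subgroups -/

section Group

variable {𝕜 : Type*} [NontriviallyNormedField 𝕜] {E H G : Type*} [NormedAddCommGroup E]
  [NormedSpace 𝕜 E] [TopologicalSpace H] {I : ModelWithCorners 𝕜 E H} [TopologicalSpace G]
  [ChartedSpace H G] [Group G]

/-- `X ↦ g X`, from the Lie algebra to `T_g G`. -/
def transL (I : ModelWithCorners 𝕜 E H) (g : G) :
    GroupLieAlgebra I G →ₗ[𝕜] TangentSpace I g :=
  (mfderiv I I (fun h : G => g * h) 1).toLinearMap

/-- `X ↦ X g`, from the Lie algebra to `T_g G`. -/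
def transR (I : ModelWithCorners 𝕜 E H) (g : G) :
    GroupLieAlgebra I G →ₗ[𝕜] TangentSpace I g :=
  (mfderiv I I (fun h : G => h * g) 1).toLinearMap

/-- `v ↦ g⁻¹ v`, from `T_g G` to the Lie algebra. -/
def transLInv (I : ModelWithCorners 𝕜 E H) (g : G) :
    TangentSpace I g →ₗ[𝕜] GroupLieAlgebra I G :=
  (mfderiv I I (fun h : G => g⁻¹ * h) g).toLinearMap

end Group

/-- The connected Lie subgroup of a real Lie group that corresponds to a Lie subalgebra `𝔥`:
it is generated by the endpoints of smooth curves from `1` whose velocity lies in the left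
translates of `𝔥`. -/
def integralSubgroup {E H G : Type*} [NormedAddCommGroup E] [NormedSpace ℝ E]
    [TopologicalSpace H] (I : ModelWithCorners ℝ E H) [TopologicalSpace G] [ChartedSpace H G]
    [Group G] (𝔥 : Set (GroupLieAlgebra I G)) : Subgroup G :=
  Subgroup.closure {x | ∃ a : ℝ → G, ContMDiff 𝓘(ℝ, ℝ) I ∞ a ∧ a 0 = 1 ∧ a 1 = x ∧
    ∀ t : ℝ, ∃ X ∈ 𝔥, mfderiv 𝓘(ℝ, ℝ) I a t (1 : ℝ) = transL I (a t) X}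

/-! ### R-matrices -/

section RMatrix

variable {𝔤 : Type*} [LieRing 𝔤] [LieAlgebra ℝ 𝔤]

/-- The modified classical Yang-Baxter equation, where `s` is `c ^ 2`: the equation is split for
`s = 1` and non-split for `s = -1`. -/
def IsMCYBE (R : 𝔤 →ₗ[ℝ] 𝔤) (s : ℝ) : Prop :=
  ∀ X Y : 𝔤, ⁅R X, R Y⁆ - R (⁅R X, Y⁆ + ⁅X, R Y⁆) = -(s • ⁅X, Y⁆)

/-- Skew-symmetry with respect to the Killing form. -/
def IsSkew (R : 𝔤 →ₗ[ℝ] 𝔤) : Prop :=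
  ∀ X Y : 𝔤, killingForm ℝ 𝔤 (R X) Y = -killingForm ℝ 𝔤 X (R Y)

/-- The kernel `T₁₂ = ∑ T(bᵢ) ⊗ bⁱ` of an endomorphism `T` with respect to the Killing form,
where `bⁱ` is the basis dual to `bᵢ` for the Killing form. -/
def kernel [FiniteDimensional ℝ 𝔤] [LieAlgebra.IsKilling ℝ 𝔤] (T : 𝔤 →ₗ[ℝ] 𝔤) : 𝔤 ⊗[ℝ] 𝔤 :=
  ∑ i, T (Module.finBasis ℝ 𝔤 i) ⊗ₜ[ℝ]
    LinearMap.BilinForm.dualBasis (killingForm ℝ 𝔤)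
      (LieAlgebra.IsKilling.killingForm_nondegenerate ℝ 𝔤) (Module.finBasis ℝ 𝔤) i

/-- `R^±` in the split case: `R + η Id` with `η = ±1`. -/
def splitR (R : 𝔤 →ₗ[ℝ] 𝔤) (η : ℝ) : 𝔤 →ₗ[ℝ] 𝔤 := R + η • LinearMap.id

/-- The inclusion of `𝔤` into its complexification. -/
def incl : 𝔤 →ₗ[ℝ] ℂ ⊗[ℝ] 𝔤 := TensorProduct.mk ℝ ℂ 𝔤 1

/-- `R^±` in the non-split case: `R + η i Id` with `η = ±1`. -/
def nonSplitR (R : 𝔤 →ₗ[ℝ] 𝔤) (η : ℝ) : 𝔤 →ₗ[ℝ] ℂ ⊗[ℝ] 𝔤 :=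
  incl ∘ₗ R + TensorProduct.mk ℝ ℂ 𝔤 (η * Complex.I)

end RMatrix

/-- For real linear maps `f`, `g` to complex vector spaces, the real linear map
`v ⊗ v' ↦ f v ⊗ g v'` to the tensor product over `ℂ`. -/
def mapC {V V' W W' : Type*} [AddCommGroup V] [Module ℝ V] [AddCommGroup V'] [Module ℝ V']
    [AddCommGroup W] [Module ℝ W] [Module ℂ W] [IsScalarTower ℝ ℂ W]
    [AddCommGroup W'] [Module ℝ W'] [Module ℂ W'] [IsScalarTower ℝ ℂ W']
    (f : V →ₗ[ℝ] W) (g : V' →ₗ[ℝ] W') : V ⊗[ℝ] V' →ₗ[ℝ] W ⊗[ℂ] W' :=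
  TensorProduct.lift (LinearMap.mk₂ ℝ (fun v v' => f v ⊗ₜ[ℂ] g v')
    (by intros; simp [TensorProduct.add_tmul])
    (by
      intro c v v'
      rw [map_smul, ← TensorProduct.smul_tmul'])
    (by intros; simp [TensorProduct.tmul_add])
    (by
      intro c v v'
      rw [map_smul, ← algebraMap_smul ℂ c (g v'), TensorProduct.tmul_smul, algebraMap_smul]))

/-- The kernel `R^±₁₂ = R₁₂ + η i C₁₂` of `R + η i Id` in `𝔤ᶜ ⊗ 𝔤ᶜ`, where `C₁₂` is the quadratic
Casimir tensor, that is, the kernel of the identity. -/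
def nonSplitKernel {𝔤 : Type*} [LieRing 𝔤] [LieAlgebra ℝ 𝔤] [FiniteDimensional ℝ 𝔤]
    [LieAlgebra.IsKilling ℝ 𝔤] (R : 𝔤 →ₗ[ℝ] 𝔤) (η : ℝ) : (ℂ ⊗[ℝ] 𝔤) ⊗[ℂ] (ℂ ⊗[ℝ] 𝔤) :=
  mapC incl incl (kernel R) + (η * Complex.I) • mapC incl incl (kernel LinearMap.id)

/-! ### Poisson-Lie groups, actions and moment maps -/

section Action

variable {E G : Type*} [NormedAddCommGroup E] [NormedSpace ℝ E] [FiniteDimensional ℝ E]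
  [TopologicalSpace G] [ChartedSpace E G] [Group G] [LieGroup 𝓘(ℝ, E) ∞ G]
  {F Gs : Type*} [NormedAddCommGroup F] [NormedSpace ℝ F] [FiniteDimensional ℝ F]
  [TopologicalSpace Gs] [ChartedSpace F Gs] [Group Gs] [LieGroup 𝓘(ℝ, F) ∞ Gs]
  {V M : Type*} [NormedAddCommGroup V] [NormedSpace ℝ V]
  [TopologicalSpace M] [ChartedSpace V M]

/-- The Sklyanin bracket `{x₁, x₂} = γ [R₁₂, x₁ x₂]` on `G`. -/
def sklyanin [LieAlgebra.IsKilling ℝ (GroupLieAlgebra 𝓘(ℝ, E) G)] (γ : ℝ)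
    (R : GroupLieAlgebra 𝓘(ℝ, E) G →ₗ[ℝ] GroupLieAlgebra 𝓘(ℝ, E) G) :
    TensorField 𝓘(ℝ, E) G := fun x =>
  γ • (TensorProduct.map (transR 𝓘(ℝ, E) x) (transR 𝓘(ℝ, E) x) (kernel R) -
    TensorProduct.map (transL 𝓘(ℝ, E) x) (transL 𝓘(ℝ, E) x) (kernel R))

/-- `τ` identifies the Lie algebra of `Gs` with the dual `𝔤*` of the Lie algebra of `G`, equipped
with the linearised bracket `[d_e f, d_e h]_* = d_e {f, h}`. -/
def IsDualBracket (P : TensorField 𝓘(ℝ, E) G)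
    (τ : GroupLieAlgebra 𝓘(ℝ, F) Gs ≃ₗ[ℝ] Module.Dual ℝ (GroupLieAlgebra 𝓘(ℝ, E) G)) : Prop :=
  ∀ f h : G → ℝ, IsSmooth 𝓘(ℝ, E) f → IsSmooth 𝓘(ℝ, E) h →
    ∀ X Y : GroupLieAlgebra 𝓘(ℝ, F) Gs, τ X = diff 𝓘(ℝ, E) f 1 → τ Y = diff 𝓘(ℝ, E) h 1 →
      τ ⁅X, Y⁆ = diff 𝓘(ℝ, E) (pb P f h) 1

/-- A smooth right action of `G` on `M` that is a Poisson map `M × G → M`. -/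
structure IsPoissonLieAction (PM : TensorField 𝓘(ℝ, V) M) (PG : TensorField 𝓘(ℝ, E) G)
    (ρ : M → G → M) : Prop where
  map_one : ∀ m, ρ m 1 = m
  map_mul : ∀ m g h, ρ m (g * h) = ρ (ρ m g) h
  smooth : ContMDiff (𝓘(ℝ, V).prod 𝓘(ℝ, E)) 𝓘(ℝ, V) ∞ (fun p : M × G => ρ p.1 p.2)
  poisson : IsPoissonMap (PM.prod PG) PM (fun p : M × G => ρ p.1 p.2)

/-- The infinitesimal action: `δ_ε f (m)` is the derivative at `g = 1` of `f (ρ m g)` in the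
direction `ε`. -/
def infAction (ρ : M → G → M) (ε : GroupLieAlgebra 𝓘(ℝ, E) G) (f : M → ℝ) (m : M) : ℝ :=
  diff 𝓘(ℝ, E) (fun g : G => f (ρ m g)) 1 ε

/-- `Γ` is a non-abelian moment map: `δ_ε f = - ⟨ε, Γ⁻¹ {Γ, f}⟩`. -/
structure IsMomentMap (PM : TensorField 𝓘(ℝ, V) M) (ρ : M → G → M)
    (τ : GroupLieAlgebra 𝓘(ℝ, F) Gs ≃ₗ[ℝ] Module.Dual ℝ (GroupLieAlgebra 𝓘(ℝ, E) G))
    (Γ : M → Gs) : Prop where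
  smooth : ContMDiff 𝓘(ℝ, V) 𝓘(ℝ, F) ∞ Γ
  action : ∀ (ε : GroupLieAlgebra 𝓘(ℝ, E) G) (f : M → ℝ), IsSmooth 𝓘(ℝ, V) f → ∀ m,
    infAction ρ ε f m =
      -(τ (transLInv 𝓘(ℝ, F) (Γ m) (pbMap 𝓘(ℝ, F) PM Γ f m)) ε)

/-! ### Semenov-Tian-Shansky brackets -/

/-- `{A₁, B₂} = γ [r₁₂, A₁ B₂] + N₁₂ A₁ B₂` for maps `A`, `B` to a real Lie group. -/
def IsSTS (PM : TensorField 𝓘(ℝ, V) M) (A B : M → G) (γ : ℝ)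
    (r : GroupLieAlgebra 𝓘(ℝ, E) G ⊗[ℝ] GroupLieAlgebra 𝓘(ℝ, E) G)
    (N : M → GroupLieAlgebra 𝓘(ℝ, E) G ⊗[ℝ] GroupLieAlgebra 𝓘(ℝ, E) G) : Prop :=
  ∀ m, pbTensor 𝓘(ℝ, E) 𝓘(ℝ, E) PM A B m =
    γ • (TensorProduct.map (transR 𝓘(ℝ, E) (A m)) (transR 𝓘(ℝ, E) (B m)) r -
      TensorProduct.map (transL 𝓘(ℝ, E) (A m)) (transL 𝓘(ℝ, E) (B m)) r) +
    TensorProduct.map (transR 𝓘(ℝ, E) (A m)) (transR 𝓘(ℝ, E) (B m)) (N m)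

section Complex

variable {Fc Gc : Type*} [NormedAddCommGroup Fc] [NormedSpace ℂ Fc] [FiniteDimensional ℂ Fc]
  [TopologicalSpace Gc] [ChartedSpace Fc Gc] [Group Gc] [LieGroup 𝓘(ℂ, Fc) ω Gc]

/-- The real differential of a map from a real manifold to a complex one, with values in the
complex tangent space. -/
def diffC (A : M → Gc) (m : M) : TangentSpace 𝓘(ℝ, V) m →ₗ[ℝ] TangentSpace 𝓘(ℂ, Fc) (A m) where
  toFun v := (mfderiv 𝓘(ℝ, V) 𝓘(ℝ, Fc) A m v : Fc)
  map_add' v w := (mfderiv 𝓘(ℝ, V) 𝓘(ℝ, Fc) A m).map_add v w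
  map_smul' t v := (mfderiv 𝓘(ℝ, V) 𝓘(ℝ, Fc) A m).map_smul t v

/-- `{A, f}` at `m`, a complex tangent vector at `A m`. -/
def pbMapC (PM : TensorField 𝓘(ℝ, V) M) (A : M → Gc) (f : M → ℝ) (m : M) :
    TangentSpace 𝓘(ℂ, Fc) (A m) :=
  TensorProduct.rid ℝ _ (TensorProduct.map (diffC A m) (diff 𝓘(ℝ, V) f m) (PM m))

/-- `{A₁, B₂}` at `m` in the tensor product over `ℂ` of the complex tangent spaces, that is, the
bracket extended complex bilinearly to the complex-valued components of `A` and `B`. -/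
def pbTensorC (PM : TensorField 𝓘(ℝ, V) M) (A B : M → Gc) (m : M) :
    TangentSpace 𝓘(ℂ, Fc) (A m) ⊗[ℂ] TangentSpace 𝓘(ℂ, Fc) (B m) :=
  mapC (diffC A m) (diffC B m) (PM m)

/-- `{A₁, B₂} = γ [r₁₂, A₁ B₂] + N₁₂ A₁ B₂` for maps `A`, `B` to a complex Lie group whose Lie
algebra is identified by `ψ` with the complexification `𝔤ᶜ`, where `r, N ∈ 𝔤ᶜ ⊗ 𝔤ᶜ`. -/
def IsSTSC {𝔤 : Type*} [LieRing 𝔤] [LieAlgebra ℝ 𝔤] (PM : TensorField 𝓘(ℝ, V) M)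
    (ψ : GroupLieAlgebra 𝓘(ℂ, Fc) Gc ≃ₗ⁅ℂ⁆ ℂ ⊗[ℝ] 𝔤) (A B : M → Gc) (γ : ℝ)
    (r : (ℂ ⊗[ℝ] 𝔤) ⊗[ℂ] (ℂ ⊗[ℝ] 𝔤)) (N : M → (ℂ ⊗[ℝ] 𝔤) ⊗[ℂ] (ℂ ⊗[ℝ] 𝔤)) : Prop :=
  ∀ m,
    let right := TensorProduct.map
      (transR 𝓘(ℂ, Fc) (A m) ∘ₗ (ψ.symm : ℂ ⊗[ℝ] 𝔤 →ₗ[ℂ] GroupLieAlgebra 𝓘(ℂ, Fc) Gc))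
      (transR 𝓘(ℂ, Fc) (B m) ∘ₗ (ψ.symm : ℂ ⊗[ℝ] 𝔤 →ₗ[ℂ] GroupLieAlgebra 𝓘(ℂ, Fc) Gc))
    let left := TensorProduct.map
      (transL 𝓘(ℂ, Fc) (A m) ∘ₗ (ψ.symm : ℂ ⊗[ℝ] 𝔤 →ₗ[ℂ] GroupLieAlgebra 𝓘(ℂ, Fc) Gc))
      (transL 𝓘(ℂ, Fc) (B m) ∘ₗ (ψ.symm : ℂ ⊗[ℝ] 𝔤 →ₗ[ℂ] GroupLieAlgebra 𝓘(ℂ, Fc) Gc))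
    pbTensorC PM A B m = (γ : ℂ) • (right r - left r) + right (N m)

/-! ### The realisations of the dual group in the doubles -/

/-- `D : G* → Gᶜ` is the Lie group homomorphism with differential `γ R^± ∘ π⁻¹`, where `η = ±1`
and `π : 𝔤 → 𝔤*` is given by the Killing form. -/
structure IsNonSplitRealisation (γ : ℝ)
    (R : GroupLieAlgebra 𝓘(ℝ, E) G →ₗ[ℝ] GroupLieAlgebra 𝓘(ℝ, E) G) (η : ℝ)
    (τ : GroupLieAlgebra 𝓘(ℝ, F) Gs ≃ₗ[ℝ] Module.Dual ℝ (GroupLieAlgebra 𝓘(ℝ, E) G))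
    (ψ : GroupLieAlgebra 𝓘(ℂ, Fc) Gc ≃ₗ⁅ℂ⁆ ℂ ⊗[ℝ] GroupLieAlgebra 𝓘(ℝ, E) G)
    (D : Gs →* Gc) : Prop where
  smooth : ContMDiff 𝓘(ℝ, F) 𝓘(ℝ, Fc) ∞ D
  differential : ∀ X : GroupLieAlgebra 𝓘(ℝ, E) G,
    ψ (diffC D 1 (τ.symm (killingForm ℝ (GroupLieAlgebra 𝓘(ℝ, E) G) X)) : Fc) =
      γ • nonSplitR R η X

/-- The subgroup `G_±` of `Gᶜ` with Lie algebra `𝔤_± = {R^± X}`, where `η = ±1`. -/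
def subgroupPM (R : GroupLieAlgebra 𝓘(ℝ, E) G →ₗ[ℝ] GroupLieAlgebra 𝓘(ℝ, E) G) (η : ℝ)
    (ψ : GroupLieAlgebra 𝓘(ℂ, Fc) Gc ≃ₗ⁅ℂ⁆ ℂ ⊗[ℝ] GroupLieAlgebra 𝓘(ℝ, E) G) : Subgroup Gc :=
  integralSubgroup 𝓘(ℝ, Fc) {v | ∃ X, ψ (v : Fc) = nonSplitR R η X}

end Complex

/-- `D : G* → G × G` is the Lie group homomorphism with differential `Δ ∘ π⁻¹`, where
`Δ X = γ (R⁺ X, R⁻ X)` and `π : 𝔤 → 𝔤*` is given by the Killing form. -/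
structure IsSplitRealisation (γ : ℝ)
    (R : GroupLieAlgebra 𝓘(ℝ, E) G →ₗ[ℝ] GroupLieAlgebra 𝓘(ℝ, E) G)
    (τ : GroupLieAlgebra 𝓘(ℝ, F) Gs ≃ₗ[ℝ] Module.Dual ℝ (GroupLieAlgebra 𝓘(ℝ, E) G))
    (D : Gs →* G × G) : Prop where
  smooth : ContMDiff 𝓘(ℝ, F) (𝓘(ℝ, E).prod 𝓘(ℝ, E)) ∞ D
  differential : ∀ X : GroupLieAlgebra 𝓘(ℝ, E) G,
    (mfderiv 𝓘(ℝ, F) (𝓘(ℝ, E).prod 𝓘(ℝ, E)) D 1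
      (τ.symm (killingForm ℝ (GroupLieAlgebra 𝓘(ℝ, E) G) X)) : E × E) =
      (γ • splitR R 1 X, γ • splitR R (-1) X)

/-- The subgroup `G_DR` of `G × G` with Lie algebra `𝔤_DR = {(R⁺ X, R⁻ X)}`. -/
def subgroupDR (R : GroupLieAlgebra 𝓘(ℝ, E) G →ₗ[ℝ] GroupLieAlgebra 𝓘(ℝ, E) G) :
    Subgroup (G × G) :=
  integralSubgroup (𝓘(ℝ, E).prod 𝓘(ℝ, E))
    {v | ∃ X, (v : E × E) = (splitR R 1 X, splitR R (-1) X)}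

end Action

end PoissonLie

end

/-!
Write `L = Γ₁⁻¹ Γ₂⁻¹ {Γ₁, Γ₂}` (`logTensor`) and `a_f = Γ⁻¹ {Γ, f}` (`logBracket`); these functions
on `M` take values in `𝔤* ⊗ 𝔤*` and in `𝔤*`, the Lie algebra of `G*`. The moment map condition reads
`δ_ε f = -⟨ε, a_f⟩`. Everything rests on one first-order differential equation that is solved both
by `L` along `M` and by an explicit coboundary along `G*`.

On `M`: the Jacobi identity for `φ ∘ Γ`, `f` and `h`, with `φ` a function on `G*`, is the
Maurer-Cartan equation for `f ↦ a_f` (`logBracket_pb`). Since `ε ↦ δ_ε` represents the Lie algebra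
`𝔤`, this equation, applied to `f` and to functions of `Γ`, yields
`{L, f} = -C(a_f) - (ad ⊗ 1 + 1 ⊗ ad)(a_f) L`, where `C : 𝔤* → 𝔤* ⊗ 𝔤*` is the transpose of the
bracket of `𝔤` (`hasDer_logTensor`). Equivalently,
`{(Ad_Γ ⊗ Ad_Γ) L, f} = -(Ad_Γ ⊗ Ad_Γ) C(a_f)`.

On `G*`: the homomorphisms `D^η` with differential `γ R^η ∘ π⁻¹` define representations of `G*`. The
modified Yang-Baxter equation and the invariance of the Casimir tensor say that
`(ad_{R^η X} ⊗ 1 + 1 ⊗ ad_{R^ε X}) r` is, up to sign, the image under `R^η ⊗ R^ε` of the kernel of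
`ad_X`, for `r = R₁₂ + (η - ε) (c / 2) C₁₂` (`ad₂_kernel_of_mcybe`). Hence, when `𝔤*` is identified
with `𝔤` by `π`, the function `γ (r - (Ad ⊗ Ad) r)`, taken along `D^η` and `D^ε`, has the
left-invariant derivatives `-(γ R^η ⊗ γ R^ε) (Ad ⊗ Ad) C` (`hasDer_coboundary`). The combination of
the maps `R^η ⊗ R^ε` with the weights `η ε` is the multiplication by `(2 c) ^ 2`, because
`R⁺ - R⁻ = 2 c`. So the four coboundaries are the images of a single primitive `Q` on `G*` of
`-(Ad ⊗ Ad) C`; primitives are unique because `G*` is connected (`exists_primitive`).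

Consequently `(Ad_Γ ⊗ Ad_Γ) L - Q ∘ Γ` Poisson commutes with all functions. It is the tensor `N₁₂`
(`exists_central`), and its images under `γ R^η ⊗ γ R^ε` give the asserted bracket relations after
right translation. The formulas for `δ_ε` only use that `R⁺ - R⁻ = 2 c` and, for the imaginary
parts, that `R` is real. That `D` takes values in the integral subgroup of its infinitesimal image
is seen by joining nearby points of `G*` by curves and using connectedness
(`hom_mem_integralSubgroup`).

Both cases are instances of `exists_central`: over `ℝ` with the maps `R^± : 𝔤 → 𝔤`, and over `ℂ`
with the maps `R^± : 𝔤 → 𝔤ᶜ`. In the second case the complex Lie group is regarded as a real one,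
which changes neither translations nor Lie brackets.
-/

set_option linter.unusedSectionVars false

noncomputable section

namespace PoissonLie

/-! ### Smooth functions and their differentials -/

section Functions

variable {E H M : Type*} [NormedAddCommGroup E] [NormedSpace ℝ E] [TopologicalSpace H]
  {I : ModelWithCorners ℝ E H} [TopologicalSpace M] [ChartedSpace H M]

lemma IsSmooth.mdifferentiableAt {f : M → ℝ} (hf : IsSmooth I f) (m : M) :
    MDifferentiableAt I 𝓘(ℝ, ℝ) f m :=
  ContMDiffAt.mdifferentiableAt (hf m) (by simp)

lemma isSmooth_const (c : ℝ) : IsSmooth I (fun _ : M => c) := contMDiff_const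

lemma IsSmooth.add {f h : M → ℝ} (hf : IsSmooth I f) (hh : IsSmooth I h) :
    IsSmooth I (fun m => f m + h m) := ContMDiff.add hf hh

lemma IsSmooth.mul {f h : M → ℝ} (hf : IsSmooth I f) (hh : IsSmooth I h) :
    IsSmooth I (fun m => f m * h m) := ContMDiff.mul hf hh

lemma diff_const (c : ℝ) (m : M) : diff I (fun _ : M => c) m = 0 := by
  ext v
  exact congrArg (fun T : E →L[ℝ] ℝ => T v)
    (mfderiv_const (I := I) (I' := 𝓘(ℝ, ℝ)) (x := m) (c := c))

lemma diff_add {f h : M → ℝ} (hf : IsSmooth I f) (hh : IsSmooth I h) (m : M) :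
    diff I (fun m => f m + h m) m = diff I f m + diff I h m := by
  ext v
  exact congrArg (fun T => T v) (mfderiv_add (hf.mdifferentiableAt m) (hh.mdifferentiableAt m))

lemma diff_mul {f h : M → ℝ} (hf : IsSmooth I f) (hh : IsSmooth I h) (m : M) :
    diff I (fun m => f m * h m) m = f m • diff I h m + h m • diff I f m := by
  ext v
  exact congrArg (fun T => T v)
    ((hf.mdifferentiableAt m).hasMFDerivAt.mul (hh.mdifferentiableAt m).hasMFDerivAt).mfderiv

lemma diff_congr {f h : M → ℝ} {m : M} (hfh : f =ᶠ[nhds m] h) : diff I f m = diff I h m := by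
  ext v
  exact congrArg (fun T => (T : E →L[ℝ] ℝ) v) hfh.mfderiv_eq

variable {E' H' N : Type*} [NormedAddCommGroup E'] [NormedSpace ℝ E'] [TopologicalSpace H']
  {J : ModelWithCorners ℝ E' H'} [TopologicalSpace N] [ChartedSpace H' N]

lemma diff_comp {f : N → ℝ} {F : M → N} (m : M) (hf : MDifferentiableAt J 𝓘(ℝ, ℝ) f (F m))
    (hF : MDifferentiableAt I J F m) :
    diff I (fun x => f (F x)) m = diff J f (F m) ∘ₗ (mfderiv I J F m).toLinearMap := by
  ext v
  exact congrArg (fun T => T v) (mfderiv_comp (I' := J) m hf hF)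

end Functions

section Bump

variable {E M : Type*} [NormedAddCommGroup E] [NormedSpace ℝ E] [FiniteDimensional ℝ E]
  [TopologicalSpace M] [T2Space M] [ChartedSpace E M] [IsManifold 𝓘(ℝ, E) ∞ M]

/-- Every covector of a finite-dimensional Hausdorff manifold is the differential of a global
smooth function. -/
lemma exists_isSmooth_diff_eq (m : M) (l : TangentSpace 𝓘(ℝ, E) m →ₗ[ℝ] ℝ) :
    ∃ f : M → ℝ, IsSmooth 𝓘(ℝ, E) f ∧ diff 𝓘(ℝ, E) f m = l := by
  obtain ⟨χ⟩ : Nonempty (SmoothBumpFunction 𝓘(ℝ, E) m) := inferInstance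
  let l' : E →L[ℝ] ℝ := LinearMap.toContinuousLinearMap (l : E →ₗ[ℝ] ℝ)
  refine ⟨fun x => χ x • l' (extChartAt 𝓘(ℝ, E) m x), ?_, ?_⟩
  · apply χ.contMDiff_smul
    exact l'.contMDiff.comp_contMDiffOn contMDiffOn_extChartAt
  · have h1 : (fun x => χ x • l' (extChartAt 𝓘(ℝ, E) m x)) =ᶠ[nhds m]
        fun x => l' (extChartAt 𝓘(ℝ, E) m x) := by
      filter_upwards [χ.eventuallyEq_one] with x hx
      simp [hx]
    rw [diff_congr h1]
    ext v
    have h2 : MDifferentiableAt 𝓘(ℝ, E) 𝓘(ℝ, E) (extChartAt 𝓘(ℝ, E) m) m :=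
      mdifferentiableAt_extChartAt (mem_chart_source _ _)
    have h3 := mfderiv_comp (I' := 𝓘(ℝ, E)) m (g := l')
      (l'.differentiableAt.mdifferentiableAt) h2
    have h5 : diff 𝓘(ℝ, E) (fun x => l' (extChartAt 𝓘(ℝ, E) m x)) m v =
      mfderiv 𝓘(ℝ, E) 𝓘(ℝ, ℝ) (l' ∘ extChartAt 𝓘(ℝ, E) m) m v := rfl
    rw [h5, h3, mfderiv_extChartAt_self, mfderiv_eq_fderiv, l'.fderiv]
    rfl

end Bump

section Param

variable {E G : Type*} [NormedAddCommGroup E] [NormedSpace ℝ E]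
  [TopologicalSpace G] [ChartedSpace E G] [IsManifold 𝓘(ℝ, E) ∞ G]
  {E' H' N : Type*} [NormedAddCommGroup E'] [NormedSpace ℝ E'] [TopologicalSpace H']
  {J : ModelWithCorners ℝ E' H'} [TopologicalSpace N] [ChartedSpace H' N] [IsManifold J ∞ N]

/-- A partial derivative of a smooth function on a product of manifolds is smooth in the
parameter. -/
lemma isSmooth_diff_param (F : N → G → ℝ)
    (hF : ContMDiff (J.prod 𝓘(ℝ, E)) 𝓘(ℝ, ℝ) ∞ (Function.uncurry F)) (g : G)
    (v : TangentSpace 𝓘(ℝ, E) g) : IsSmooth J (fun n => diff 𝓘(ℝ, E) (F n) g v) := by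
  intro n
  have h := ContMDiffAt.mfderiv_apply (I := 𝓘(ℝ, E)) (I' := 𝓘(ℝ, ℝ)) (J := J) (J' := J) (m := ∞)
    (n := ∞) (x₀ := n) F (fun _ => g) id (fun _ => (v : E)) hF.contMDiffAt contMDiffAt_const
    contMDiffAt_id contMDiffAt_const (by simp)
  have h' := fun x => inTangentCoordinates_eq (I := 𝓘(ℝ, E)) (I' := 𝓘(ℝ, ℝ)) (fun _ : N => g)
    (fun x => F x g) (fun x => (mfderiv 𝓘(ℝ, E) 𝓘(ℝ, ℝ) (F x) g : E →L[ℝ] ℝ)) (x₀ := n) (x := x)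
    (mem_chart_source _ _) (Set.mem_univ _)
  refine h.congr_of_eventuallyEq (Filter.Eventually.of_forall fun x => ?_)
  refine Eq.trans ?_ (congrArg (fun T : E →L[ℝ] ℝ => T v) (h' x)).symm
  have h1 := (tangentBundleCore 𝓘(ℝ, E) G).coordChange_self (achart E g) g (mem_chart_source _ _) v
  rw [tangentBundleCore_coordChange_model_space]
  exact congrArg (fun u => (mfderiv 𝓘(ℝ, E) 𝓘(ℝ, ℝ) (F x) g : E →L[ℝ] ℝ) u) h1.symm

end Param

section Bracket

lemma two_le_infty : (2 : ℕ∞ω) ≤ ∞ := WithTop.coe_le_coe.2 le_top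

open VectorField

variable {E M : Type*} [NormedAddCommGroup E] [NormedSpace ℝ E]
  [TopologicalSpace M] [ChartedSpace E M] [IsManifold 𝓘(ℝ, E) ∞ M]

/-- Differentiating `f` along the vector field `V` can be done in a chart. -/
lemma fderiv_comp_extChartAt_symm (x₀ : M) {f : M → ℝ} {y : E}
    (hy : y ∈ (extChartAt 𝓘(ℝ, E) x₀).target)
    (hf : MDifferentiableAt 𝓘(ℝ, E) 𝓘(ℝ, ℝ) f ((extChartAt 𝓘(ℝ, E) x₀).symm y))
    (V : ∀ x : M, TangentSpace 𝓘(ℝ, E) x) :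
    fderiv ℝ (f ∘ (extChartAt 𝓘(ℝ, E) x₀).symm) y
      (mpullbackWithin 𝓘(ℝ, E) 𝓘(ℝ, E) (extChartAt 𝓘(ℝ, E) x₀).symm V
        (Set.range 𝓘(ℝ, E)) y) =
      diff 𝓘(ℝ, E) f ((extChartAt 𝓘(ℝ, E) x₀).symm y)
        (V ((extChartAt 𝓘(ℝ, E) x₀).symm y)) := by
  have : IsManifold 𝓘(ℝ, E) 1 M := IsManifold.of_le (n := ∞) (by simp)
  have hr : Set.range 𝓘(ℝ, E) = Set.univ := by simp
  have hi := isInvertible_mfderivWithin_extChartAt_symm (I := 𝓘(ℝ, E)) hy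
  have hs := mdifferentiableWithinAt_of_isInvertible_mfderivWithin hi
  rw [mpullbackWithin_apply]
  rw [hr] at hi hs ⊢
  rw [mfderivWithin_univ] at hi ⊢
  rw [mdifferentiableWithinAt_univ] at hs
  have hc := mfderiv_comp (I' := 𝓘(ℝ, E)) y hf hs
  obtain ⟨e, he⟩ := hi
  have h1 : (mfderiv 𝓘(ℝ, E) 𝓘(ℝ, E) (extChartAt 𝓘(ℝ, E) x₀).symm y).inverse
    (V ((extChartAt 𝓘(ℝ, E) x₀).symm y)) = e.symm (V ((extChartAt 𝓘(ℝ, E) x₀).symm y)) := by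
    rw [← he, ContinuousLinearMap.inverse_equiv]; rfl
  rw [h1, ← mfderiv_eq_fderiv]
  refine (congrArg (fun T : E →L[ℝ] ℝ => T (e.symm (V _))) hc).trans ?_
  refine congrArg (mfderiv 𝓘(ℝ, E) 𝓘(ℝ, ℝ) f ((extChartAt 𝓘(ℝ, E) x₀).symm y)) ?_
  rw [← he]
  exact e.apply_symm_apply _

/-- At the centre of a chart the differential is the derivative in that chart. -/
lemma diff_eq_fderiv {x₀ : M} {f : M → ℝ}
    (hf : MDifferentiableAt 𝓘(ℝ, E) 𝓘(ℝ, ℝ) f x₀) (v : TangentSpace 𝓘(ℝ, E) x₀) :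
    diff 𝓘(ℝ, E) f x₀ v =
      fderiv ℝ (f ∘ (extChartAt 𝓘(ℝ, E) x₀).symm) (extChartAt 𝓘(ℝ, E) x₀ x₀) v := by
  have h := hf.mfderiv
  rw [Set.range_eq_univ.2 (by exact fun x => ⟨x, rfl⟩), fderivWithin_univ] at h
  exact congrArg (fun T : E →L[ℝ] ℝ => T v) h

/-- The Lie bracket of vector fields is the commutator of the corresponding derivations. -/
lemma diff_mlieBracket [CompleteSpace E] (x₀ : M) {f : M → ℝ} (hf : IsSmooth 𝓘(ℝ, E) f)
    {V W : ∀ x : M, TangentSpace 𝓘(ℝ, E) x}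
    (hV : MDifferentiableAt 𝓘(ℝ, E) 𝓘(ℝ, E).tangent
      (fun x => (V x : TangentBundle 𝓘(ℝ, E) M)) x₀)
    (hW : MDifferentiableAt 𝓘(ℝ, E) 𝓘(ℝ, E).tangent
      (fun x => (W x : TangentBundle 𝓘(ℝ, E) M)) x₀)
    (hfV : MDifferentiableAt 𝓘(ℝ, E) 𝓘(ℝ, ℝ) (fun x => diff 𝓘(ℝ, E) f x (V x)) x₀)
    (hfW : MDifferentiableAt 𝓘(ℝ, E) 𝓘(ℝ, ℝ) (fun x => diff 𝓘(ℝ, E) f x (W x)) x₀) :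
    diff 𝓘(ℝ, E) f x₀ (mlieBracket 𝓘(ℝ, E) V W x₀) =
      diff 𝓘(ℝ, E) (fun x => diff 𝓘(ℝ, E) f x (W x)) x₀ (V x₀) -
        diff 𝓘(ℝ, E) (fun x => diff 𝓘(ℝ, E) f x (V x)) x₀ (W x₀) := by
  have : IsManifold 𝓘(ℝ, E) 1 M := IsManifold.of_le (n := ∞) (by simp)
  have : IsManifold 𝓘(ℝ, E) 2 M := IsManifold.of_le (n := ∞) two_le_infty
  set e := extChartAt 𝓘(ℝ, E) x₀ with he
  have hr : Set.range 𝓘(ℝ, E) = Set.univ := by simp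
  have ht : e x₀ ∈ e.target := mem_extChartAt_target x₀
  have hx : e.symm (e x₀) = x₀ := extChartAt_to_inv x₀
  have htn : ∀ᶠ y in nhds (e x₀), y ∈ e.target := extChartAt_target_mem_nhds x₀
  let V' : E → E := mpullbackWithin 𝓘(ℝ, E) 𝓘(ℝ, E) e.symm V (Set.range 𝓘(ℝ, E))
  let W' : E → E := mpullbackWithin 𝓘(ℝ, E) 𝓘(ℝ, E) e.symm W (Set.range 𝓘(ℝ, E))
  have dV : DifferentiableAt ℝ V' (e x₀) := by
    have h1 := hV.mdifferentiableWithinAt (s := Set.univ)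
      |>.differentiableWithinAt_mpullbackWithin_vectorField
    rw [Set.preimage_univ, Set.univ_inter] at h1
    exact h1.differentiableAt (by rw [hr]; exact Filter.univ_mem)
  have dW : DifferentiableAt ℝ W' (e x₀) := by
    have h1 := hW.mdifferentiableWithinAt (s := Set.univ)
      |>.differentiableWithinAt_mpullbackWithin_vectorField
    rw [Set.preimage_univ, Set.univ_inter] at h1
    exact h1.differentiableAt (by rw [hr]; exact Filter.univ_mem)
  have hf' : ContDiffAt ℝ ∞ (f ∘ e.symm) (e x₀) := by
    have h1 : ContMDiffAt 𝓘(ℝ, E) 𝓘(ℝ, ℝ) ∞ (f ∘ e.symm) (e x₀) :=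
      ContMDiffAt.comp _ (hf _) ((contMDiffOn_extChartAt_symm x₀).contMDiffAt htn)
    exact h1.contDiffAt
  have hb : mlieBracket 𝓘(ℝ, E) V W x₀ = lieBracket ℝ (E := E) V' W' (e x₀) := by
    have h1 : mlieBracket 𝓘(ℝ, E) V W x₀ = (mfderiv 𝓘(ℝ, E) 𝓘(ℝ, E) e x₀).inverse
      (lieBracketWithin ℝ (E := E) V' W' ((e.symm ⁻¹' Set.univ) ∩ Set.range 𝓘(ℝ, E)) (e x₀)) := rfl
    rw [h1, he, mfderiv_extChartAt_self, hr, Set.preimage_univ, Set.univ_inter,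
      lieBracketWithin_univ]
    exact congrArg (fun T : E →L[ℝ] E => T (lieBracket ℝ (E := E) V' W' (e x₀)))
      ContinuousLinearMap.inverse_id
  have hd := fun v => diff_eq_fderiv (hf.mdifferentiableAt x₀) v
  have hfx := fun y => hf.mdifferentiableAt (e.symm y)
  have hVg : ∀ g : M → ℝ, MDifferentiableAt 𝓘(ℝ, E) 𝓘(ℝ, ℝ) g x₀ →
      ∀ Z : ∀ x : M, TangentSpace 𝓘(ℝ, E) x,
      fderiv ℝ (g ∘ e.symm) (e x₀) (mpullbackWithin 𝓘(ℝ, E) 𝓘(ℝ, E) e.symm Z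
        (Set.range 𝓘(ℝ, E)) (e x₀)) = diff 𝓘(ℝ, E) g x₀ (Z x₀) := by
    intro g hg Z
    refine (fderiv_comp_extChartAt_symm x₀ ht (by rwa [← he, hx]) Z).trans ?_
    exact congrArg (fun x => diff 𝓘(ℝ, E) g x (Z x)) hx
  have hg : ∀ Z : ∀ x : M, TangentSpace 𝓘(ℝ, E) x,
      (fun y => fderiv ℝ (f ∘ e.symm) y (mpullbackWithin 𝓘(ℝ, E) 𝓘(ℝ, E) e.symm Z
        (Set.range 𝓘(ℝ, E)) y)) =ᶠ[nhds (e x₀)]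
      (fun x => diff 𝓘(ℝ, E) f x (Z x)) ∘ e.symm := by
    intro Z
    filter_upwards [htn] with y hy
    exact fderiv_comp_extChartAt_symm x₀ hy (hfx y) Z
  rw [hb]
  refine (hd _).trans ?_
  refine (fderiv_apply_lieBracket hf'
    (by rw [minSmoothness_of_isRCLikeNormedField]; exact two_le_infty) dW dV).trans ?_
  rw [(hg W).fderiv_eq, (hg V).fderiv_eq]
  exact congrArg₂ (· - ·) (hVg _ hfW V) (hVg _ hfV W)

end Bracket

section MixedPartials

variable {E₁ N₁ E₂ N₂ : Type*} [NormedAddCommGroup E₁] [NormedSpace ℝ E₁]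
  [TopologicalSpace N₁] [ChartedSpace E₁ N₁] [IsManifold 𝓘(ℝ, E₁) ∞ N₁]
  [NormedAddCommGroup E₂] [NormedSpace ℝ E₂]
  [TopologicalSpace N₂] [ChartedSpace E₂ N₂] [IsManifold 𝓘(ℝ, E₂) ∞ N₂]

/-- Mixed partial derivatives on a product of manifolds commute. -/
lemma diff_diff_comm (F : N₁ → N₂ → ℝ)
    (hF : ContMDiff (𝓘(ℝ, E₁).prod 𝓘(ℝ, E₂)) 𝓘(ℝ, ℝ) ∞ (Function.uncurry F))
    (a : N₁) (b : N₂) (v : TangentSpace 𝓘(ℝ, E₁) a) (w : TangentSpace 𝓘(ℝ, E₂) b) :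
    diff 𝓘(ℝ, E₂) (fun y => diff 𝓘(ℝ, E₁) (fun x => F x y) a v) b w =
      diff 𝓘(ℝ, E₁) (fun x => diff 𝓘(ℝ, E₂) (F x) b w) a v := by
  set e := extChartAt 𝓘(ℝ, E₁) a with he
  set e' := extChartAt 𝓘(ℝ, E₂) b with he'
  have htn : ∀ᶠ y in nhds (e a), y ∈ e.target := extChartAt_target_mem_nhds a
  have htn' : ∀ᶠ y in nhds (e' b), y ∈ e'.target := extChartAt_target_mem_nhds b
  let K : E₁ × E₂ → ℝ := fun p => F (e.symm p.1) (e'.symm p.2)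
  have hx : e.symm (e a) = a := extChartAt_to_inv a
  have hx' : e'.symm (e' b) = b := extChartAt_to_inv b
  have hK : ContDiffAt ℝ ∞ K (e a, e' b) := by
    have h1 : ContMDiffAt 𝓘(ℝ, E₁) 𝓘(ℝ, E₁) ∞ e.symm (e a) :=
      (contMDiffOn_extChartAt_symm a).contMDiffAt htn
    have h2 : ContMDiffAt 𝓘(ℝ, E₂) 𝓘(ℝ, E₂) ∞ e'.symm (e' b) :=
      (contMDiffOn_extChartAt_symm b).contMDiffAt htn'
    have h3 : ContMDiffAt 𝓘(ℝ, E₁ × E₂) (𝓘(ℝ, E₁).prod 𝓘(ℝ, E₂)) ∞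
        (fun p : E₁ × E₂ => (e.symm p.1, e'.symm p.2)) (e a, e' b) := by
      refine ContMDiffAt.prodMk ?_ ?_
      · exact ContMDiffAt.comp (e a, e' b) h1 contDiffAt_fst.contMDiffAt
      · exact ContMDiffAt.comp (e a, e' b) h2 contDiffAt_snd.contMDiffAt
    exact (ContMDiffAt.comp (e a, e' b) hF.contMDiffAt h3).contDiffAt
  have hKd : ∀ᶠ p in nhds (e a, e' b), DifferentiableAt ℝ K p := by
    filter_upwards [(hK.of_le two_le_infty).eventually (by simp)] with p hp
    exact hp.differentiableAt (by simp)
  have hd2 : DifferentiableAt ℝ (fderiv ℝ K) (e a, e' b) :=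
    (hK.fderiv_right (m := ∞) (by simp)).differentiableAt (by simp)
  have hF₁ : ∀ y, IsSmooth 𝓘(ℝ, E₁) (fun x => F x y) := fun y =>
    hF.comp (contMDiff_id.prodMk contMDiff_const)
  have hF₂ : ∀ x, IsSmooth 𝓘(ℝ, E₂) (F x) := fun x =>
    hF.comp (contMDiff_const.prodMk contMDiff_id)
  have hs₁ : IsSmooth 𝓘(ℝ, E₁) (fun x => diff 𝓘(ℝ, E₂) (F x) b w) := isSmooth_diff_param F hF b w
  have hs₂ : IsSmooth 𝓘(ℝ, E₂) (fun y => diff 𝓘(ℝ, E₁) (fun x => F x y) a v) :=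
    isSmooth_diff_param (fun y x => F x y)
      (hF.comp (contMDiff_snd.prodMk contMDiff_fst)) a v
  rw [diff_eq_fderiv (hs₁.mdifferentiableAt a), diff_eq_fderiv (hs₂.mdifferentiableAt b)]
  have h1 : (fun y => diff 𝓘(ℝ, E₁) (fun x => F x y) a v) ∘ e'.symm =ᶠ[nhds (e' b)]
      fun y => fderiv ℝ K (e a, y) (v, 0) := by
    have hc : Filter.Tendsto (fun y : E₂ => (e a, y)) (nhds (e' b)) (nhds (e a, e' b)) :=
      (Continuous.prodMk_right (e a)).tendsto _
    filter_upwards [hc.eventually hKd] with y hy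
    refine (diff_eq_fderiv ((hF₁ _).mdifferentiableAt a) v).trans ?_
    have h2 : (fun x => F x (e'.symm y)) ∘ e.symm = K ∘ fun x => (x, y) := rfl
    have h3 : HasFDerivAt (fun x : E₁ => (x, y)) (ContinuousLinearMap.inl ℝ E₁ E₂) (e a) :=
      hasFDerivAt_prodMk_left _ _
    rw [h2, (hy.hasFDerivAt.comp (e a) h3).fderiv]
    rfl
  have h1' : (fun x => diff 𝓘(ℝ, E₂) (F x) b w) ∘ e.symm =ᶠ[nhds (e a)]
      fun x => fderiv ℝ K (x, e' b) (0, w) := by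
    have hc : Filter.Tendsto (fun x : E₁ => (x, e' b)) (nhds (e a)) (nhds (e a, e' b)) :=
      (Continuous.prodMk_left (e' b)).tendsto _
    filter_upwards [hc.eventually hKd] with x hy
    refine (diff_eq_fderiv ((hF₂ _).mdifferentiableAt b) w).trans ?_
    have h2 : F (e.symm x) ∘ e'.symm = K ∘ fun y => (x, y) := rfl
    have h3 : HasFDerivAt (fun y : E₂ => (x, y)) (ContinuousLinearMap.inr ℝ E₁ E₂) (e' b) :=
      hasFDerivAt_prodMk_right _ _
    rw [h2, (hy.hasFDerivAt.comp (e' b) h3).fderiv]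
    rfl
  rw [h1.fderiv_eq, h1'.fderiv_eq]
  have h4 : HasFDerivAt (fun y : E₂ => fderiv ℝ K (e a, y))
      ((fderiv ℝ (fderiv ℝ K) (e a, e' b)).comp (ContinuousLinearMap.inr ℝ E₁ E₂)) (e' b) :=
    hd2.hasFDerivAt.comp (e' b) (hasFDerivAt_prodMk_right _ _)
  have h4' : HasFDerivAt (fun x : E₁ => fderiv ℝ K (x, e' b))
      ((fderiv ℝ (fderiv ℝ K) (e a, e' b)).comp (ContinuousLinearMap.inl ℝ E₁ E₂)) (e a) :=
    hd2.hasFDerivAt.comp (e a) (hasFDerivAt_prodMk_left _ _)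
  rw [(h4.clm_apply (hasFDerivAt_const ((v, 0) : E₁ × E₂) _)).fderiv,
    (h4'.clm_apply (hasFDerivAt_const ((0, w) : E₁ × E₂) _)).fderiv]
  have hsym : IsSymmSndFDerivAt ℝ K (e a, e' b) :=
    hK.isSymmSndFDerivAt (by rw [minSmoothness_of_isRCLikeNormedField]; exact two_le_infty)
  simp only [ContinuousLinearMap.comp_zero, zero_add]
  exact hsym.eq (0, w) (v, 0)

end MixedPartials

section Constant

variable {E N : Type*} [NormedAddCommGroup E] [NormedSpace ℝ E]
  [TopologicalSpace N] [ChartedSpace E N] [IsManifold 𝓘(ℝ, E) ∞ N] [PreconnectedSpace N]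

/-- On a connected manifold a function with vanishing differential is constant. -/
lemma eq_of_diff_eq_zero {f : N → ℝ} (hf : IsSmooth 𝓘(ℝ, E) f)
    (h0 : ∀ x, diff 𝓘(ℝ, E) f x = 0) (x y : N) : f x = f y := by
  refine IsLocallyConstant.apply_eq_of_preconnectedSpace ?_ x y
  rw [IsLocallyConstant.iff_eventually_eq]
  intro x
  set e := extChartAt 𝓘(ℝ, E) x with he
  have htn : e.target ∈ nhds (e x) := extChartAt_target_mem_nhds x
  obtain ⟨r, hr, hball⟩ := Metric.mem_nhds_iff.1 htn
  have hmd : ∀ z ∈ e.target, MDifferentiableAt 𝓘(ℝ, E) 𝓘(ℝ, E) e.symm z := fun z hz =>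
    ((contMDiffOn_extChartAt_symm (I := 𝓘(ℝ, E)) (n := ∞) x).contMDiffAt
      ((isOpen_extChartAt_target x).mem_nhds hz)).mdifferentiableAt (by simp)
  have hfd : ∀ z ∈ Metric.ball (e x) r, fderiv ℝ (f ∘ e.symm) z = 0 := by
    intro z hz
    rw [← mfderiv_eq_fderiv]
    refine (mfderiv_comp (I' := 𝓘(ℝ, E)) z (hf.mdifferentiableAt _) (hmd z (hball hz))).trans ?_
    ext v
    exact congrArg (fun T => T (mfderiv 𝓘(ℝ, E) 𝓘(ℝ, E) e.symm z v)) (h0 (e.symm z))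
  have hdiff : DifferentiableOn ℝ (f ∘ e.symm) (Metric.ball (e x) r) := by
    intro z hz
    have := MDifferentiableAt.comp (I' := 𝓘(ℝ, E)) z (hf.mdifferentiableAt _) (hmd z (hball hz))
    exact this.differentiableAt.differentiableWithinAt
  have hpre : e ⁻¹' Metric.ball (e x) r ∈ nhds x :=
    (continuousAt_extChartAt x).preimage_mem_nhds (Metric.ball_mem_nhds _ hr)
  filter_upwards [hpre, extChartAt_source_mem_nhds (I := 𝓘(ℝ, E)) x] with y hy hys
  have h := Metric.isOpen_ball.is_const_of_fderiv_eq_zero (convex_ball _ _).isPreconnected hdiff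
    (fun z hz => hfd z hz) hy (Metric.mem_ball_self hr)
  simpa only [Function.comp_apply, e.left_inv hys, e.left_inv (mem_extChartAt_source x)] using h

end Constant

/-! ### Translations and the adjoint representation -/

section Translations

variable {𝕜 : Type*} [NontriviallyNormedField 𝕜] {E H G : Type*} [NormedAddCommGroup E]
  [NormedSpace 𝕜 E] [TopologicalSpace H] {I : ModelWithCorners 𝕜 E H} [TopologicalSpace G]
  [ChartedSpace H G] [Group G]

/-- `v ↦ v g⁻¹`, from `T_g G` to the Lie algebra. -/
def transRInv (I : ModelWithCorners 𝕜 E H) (g : G) :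
    TangentSpace I g →ₗ[𝕜] GroupLieAlgebra I G where
  toFun v := (mfderiv I I (fun h : G => h * g⁻¹) g v : E)
  map_add' v w := (mfderiv I I (fun h : G => h * g⁻¹) g).map_add v w
  map_smul' c v := (mfderiv I I (fun h : G => h * g⁻¹) g).map_smul c v

/-- The adjoint representation `X ↦ g X g⁻¹`. -/
def Ad (I : ModelWithCorners 𝕜 E H) (g : G) : GroupLieAlgebra I G →ₗ[𝕜] GroupLieAlgebra I G :=
  transRInv I g ∘ₗ transL I g

variable [LieGroup I 1 G]

lemma mdifferentiableAt_mul_left (a g : G) : MDifferentiableAt I I (fun h : G => a * h) g :=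
  (contMDiff_mul_left (I := I) (n := 1)).mdifferentiableAt (by simp)

lemma mdifferentiableAt_mul_right (a g : G) : MDifferentiableAt I I (fun h : G => h * a) g :=
  (contMDiff_mul_right (I := I) (n := 1)).mdifferentiableAt (by simp)

lemma transLInv_transL (g : G) (X : GroupLieAlgebra I G) : transLInv I g (transL I g X) = X := by
  have h := mfderiv_comp (I := I) (I' := I) (I'' := I) (1 : G) (g := fun h => g⁻¹ * h)
    (f := fun h => g * h) (mdifferentiableAt_mul_left _ _) (mdifferentiableAt_mul_left _ _)
  have h1 : ((fun h => g⁻¹ * h) ∘ fun h => g * h) = (id : G → G) := by ext; simp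
  rw [h1, mfderiv_id] at h
  -- the chain rule produces the base point `g * 1`, which is only propositionally equal to `g`
  have h2 : ∀ x : G, x = g → (mfderiv I I (fun h : G => g⁻¹ * h) x : E →L[𝕜] E) =
    (mfderiv I I (fun h : G => g⁻¹ * h) g : E →L[𝕜] E) := by rintro x rfl; rfl
  refine (congrArg (fun T : E →L[𝕜] E => T (transL I g X)) (h2 _ (mul_one g)).symm).trans ?_
  exact (congrArg (fun T : E →L[𝕜] E => T X) h).symm

lemma transL_transLInv (g : G) (v : TangentSpace I g) : transL I g (transLInv I g v) = v := by
  have h := mfderiv_comp (I := I) (I' := I) (I'' := I) (g : G) (g := fun h => g * h)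
    (f := fun h => g⁻¹ * h) (mdifferentiableAt_mul_left _ _) (mdifferentiableAt_mul_left _ _)
  have h1 : ((fun h => g * h) ∘ fun h => g⁻¹ * h) = (id : G → G) := by ext; simp
  rw [h1, mfderiv_id] at h
  have h2 : ∀ x : G, x = 1 → (mfderiv I I (fun h : G => g * h) x : E →L[𝕜] E) =
    (mfderiv I I (fun h : G => g * h) 1 : E →L[𝕜] E) := by rintro x rfl; rfl
  refine (congrArg (fun T : E →L[𝕜] E => T (transLInv I g v))
    (h2 _ (inv_mul_cancel g)).symm).trans ?_
  exact (congrArg (fun T : E →L[𝕜] E => T v) h).symm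

lemma transRInv_transR (g : G) (X : GroupLieAlgebra I G) : transRInv I g (transR I g X) = X := by
  have h := mfderiv_comp (I := I) (I' := I) (I'' := I) (1 : G) (g := fun h => h * g⁻¹)
    (f := fun h => h * g) (mdifferentiableAt_mul_right _ _) (mdifferentiableAt_mul_right _ _)
  have h1 : ((fun h => h * g⁻¹) ∘ fun h => h * g) = (id : G → G) := by ext; simp
  rw [h1, mfderiv_id] at h
  have h2 : ∀ x : G, x = g → (mfderiv I I (fun h : G => h * g⁻¹) x : E →L[𝕜] E) =
    (mfderiv I I (fun h : G => h * g⁻¹) g : E →L[𝕜] E) := by rintro x rfl; rfl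
  refine (congrArg (fun T : E →L[𝕜] E => T (transR I g X)) (h2 _ (one_mul g)).symm).trans ?_
  exact (congrArg (fun T : E →L[𝕜] E => T X) h).symm

lemma transR_transRInv (g : G) (v : TangentSpace I g) : transR I g (transRInv I g v) = v := by
  have h := mfderiv_comp (I := I) (I' := I) (I'' := I) (g : G) (g := fun h => h * g)
    (f := fun h => h * g⁻¹) (mdifferentiableAt_mul_right _ _) (mdifferentiableAt_mul_right _ _)
  have h1 : ((fun h => h * g) ∘ fun h => h * g⁻¹) = (id : G → G) := by ext; simp
  rw [h1, mfderiv_id] at h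
  have h2 : ∀ x : G, x = 1 → (mfderiv I I (fun h : G => h * g) x : E →L[𝕜] E) =
    (mfderiv I I (fun h : G => h * g) 1 : E →L[𝕜] E) := by rintro x rfl; rfl
  refine (congrArg (fun T : E →L[𝕜] E => T (transRInv I g v))
    (h2 _ (mul_inv_cancel g)).symm).trans ?_
  exact (congrArg (fun T : E →L[𝕜] E => T v) h).symm

lemma transR_Ad (g : G) (X : GroupLieAlgebra I G) : transR I g (Ad I g X) = transL I g X :=
  transR_transRInv g _

lemma Ad_one (X : GroupLieAlgebra I G) : Ad I 1 X = X := by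
  have h : transL I (1 : G) X = transR I 1 X := by
    have h1 : (fun h : G => 1 * h) = fun h => h * 1 := by ext; simp
    exact congrArg (fun f : G → G => (mfderiv I I f 1 : E →L[𝕜] E) X) h1
  exact (congrArg (transRInv I (1 : G)) h).trans (transRInv_transR 1 X)

end Translations

/-! ### Homomorphisms -/

section Hom

variable {𝕜 : Type*} [NontriviallyNormedField 𝕜]
  {E H G : Type*} [NormedAddCommGroup E] [NormedSpace 𝕜 E] [TopologicalSpace H]
  {I : ModelWithCorners 𝕜 E H} [TopologicalSpace G] [ChartedSpace H G] [Group G] [LieGroup I 1 G]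
  {E' H' G' : Type*} [NormedAddCommGroup E'] [NormedSpace 𝕜 E'] [TopologicalSpace H']
  {I' : ModelWithCorners 𝕜 E' H'} [TopologicalSpace G'] [ChartedSpace H' G'] [Group G']
  [LieGroup I' 1 G']

/-- The differential at `1` of a group homomorphism, as a map of Lie algebras. -/
def homDiff (I : ModelWithCorners 𝕜 E H) (I' : ModelWithCorners 𝕜 E' H') (D : G →* G') :
    GroupLieAlgebra I G →ₗ[𝕜] GroupLieAlgebra I' G' where
  toFun v := (mfderiv I I' D 1 v : E')
  map_add' v w := (mfderiv I I' D 1).map_add v w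
  map_smul' c v := (mfderiv I I' D 1).map_smul c v

/-- Homomorphisms intertwine left translations. -/
lemma mfderiv_hom_transL {D : G →* G'} (hD : MDifferentiable I I' D) (g : G)
    (X : GroupLieAlgebra I G) :
    mfderiv I I' D g (transL I g X) = transL I' (D g) (homDiff I I' D X) := by
  have h := mfderiv_comp (I := I) (I' := I) (I'' := I') (1 : G) (g := D)
    (f := fun h => g * h) (hD _) (mdifferentiableAt_mul_left _ _)
  have h' := mfderiv_comp (I := I) (I' := I') (I'' := I') (1 : G) (g := fun h => D g * h)
    (f := D) (mdifferentiableAt_mul_left _ _) (hD _)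
  have h1 : (D ∘ fun h => g * h) = ((fun h => D g * h) ∘ D) := by ext; simp
  rw [h1] at h
  have h2 : ∀ x : G, x = g → (mfderiv I I' D x : E →L[𝕜] E') =
    (mfderiv I I' D g : E →L[𝕜] E') := by rintro x rfl; rfl
  have h3 : ∀ x : G', x = 1 → (mfderiv I' I' (fun h => D g * h) x : E' →L[𝕜] E') =
    (mfderiv I' I' (fun h => D g * h) 1 : E' →L[𝕜] E') := by rintro x rfl; rfl
  refine (congrArg (fun T : E →L[𝕜] E' => T (transL I g X)) (h2 _ (mul_one g)).symm).trans ?_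
  refine (congrArg (fun T : E →L[𝕜] E' => T X) (h.symm.trans h')).trans ?_
  exact (congrArg (fun T : E' →L[𝕜] E' => T (homDiff I I' D X)) (h3 _ (map_one D)))

/-- Homomorphisms intertwine right translations. -/
lemma mfderiv_hom_transR {D : G →* G'} (hD : MDifferentiable I I' D) (g : G)
    (X : GroupLieAlgebra I G) :
    mfderiv I I' D g (transR I g X) = transR I' (D g) (homDiff I I' D X) := by
  have h := mfderiv_comp (I := I) (I' := I) (I'' := I') (1 : G) (g := D)
    (f := fun h => h * g) (hD _) (mdifferentiableAt_mul_right _ _)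
  have h' := mfderiv_comp (I := I) (I' := I') (I'' := I') (1 : G) (g := fun h => h * D g)
    (f := D) (mdifferentiableAt_mul_right _ _) (hD _)
  have h1 : (D ∘ fun h => h * g) = ((fun h => h * D g) ∘ D) := by ext; simp
  rw [h1] at h
  have h2 : ∀ x : G, x = g → (mfderiv I I' D x : E →L[𝕜] E') =
    (mfderiv I I' D g : E →L[𝕜] E') := by rintro x rfl; rfl
  have h3 : ∀ x : G', x = 1 → (mfderiv I' I' (fun h => h * D g) x : E' →L[𝕜] E') =
    (mfderiv I' I' (fun h => h * D g) 1 : E' →L[𝕜] E') := by rintro x rfl; rfl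
  refine (congrArg (fun T : E →L[𝕜] E' => T (transR I g X)) (h2 _ (one_mul g)).symm).trans ?_
  refine (congrArg (fun T : E →L[𝕜] E' => T X) (h.symm.trans h')).trans ?_
  exact (congrArg (fun T : E' →L[𝕜] E' => T (homDiff I I' D X)) (h3 _ (map_one D)))

lemma homDiff_Ad {D : G →* G'} (hD : MDifferentiable I I' D) (g : G) (X : GroupLieAlgebra I G) :
    homDiff I I' D (Ad I g X) = Ad I' (D g) (homDiff I I' D X) := by
  have h := mfderiv_hom_transR hD g (Ad I g X)
  rw [transR_Ad, mfderiv_hom_transL hD] at h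
  exact (transRInv_transR _ _).symm.trans (congrArg (transRInv I' (D g)) h.symm)

end Hom

/-! ### Left-invariant derivations -/

section Derivations

variable {E G : Type*} [NormedAddCommGroup E] [NormedSpace ℝ E]
  [TopologicalSpace G] [ChartedSpace E G] [Group G] [LieGroup 𝓘(ℝ, E) ∞ G]

/-- The left-invariant derivation `X ↦ d/dt φ(g exp tX)` of functions on a Lie group. -/
def lder (X : GroupLieAlgebra 𝓘(ℝ, E) G) (φ : G → ℝ) (g : G) : ℝ :=
  diff 𝓘(ℝ, E) (fun h => φ (g * h)) 1 X

/-- The right-invariant derivation `X ↦ d/dt φ(exp tX g)` of functions on a Lie group. -/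
def rder (X : GroupLieAlgebra 𝓘(ℝ, E) G) (φ : G → ℝ) (g : G) : ℝ :=
  diff 𝓘(ℝ, E) (fun h => φ (h * g)) 1 X

lemma lder_eq_diff_transL {φ : G → ℝ} (hφ : IsSmooth 𝓘(ℝ, E) φ) (X : GroupLieAlgebra 𝓘(ℝ, E) G)
    (g : G) : lder X φ g = diff 𝓘(ℝ, E) φ g (transL 𝓘(ℝ, E) g X) := by
  have h := diff_comp (I := 𝓘(ℝ, E)) (1 : G) (F := fun h => g * h) (hφ.mdifferentiableAt (g * 1))
    (mdifferentiableAt_mul_left g 1)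
  have h2 : ∀ x : G, x = g → (diff 𝓘(ℝ, E) φ x : E →ₗ[ℝ] ℝ) =
    (diff 𝓘(ℝ, E) φ g : E →ₗ[ℝ] ℝ) := by rintro x rfl; rfl
  exact (congrArg (fun T : E →ₗ[ℝ] ℝ => T X) h).trans
    (congrArg (fun T : E →ₗ[ℝ] ℝ => T (transL 𝓘(ℝ, E) g X)) (h2 _ (mul_one g)))

lemma rder_eq_diff_transR {φ : G → ℝ} (hφ : IsSmooth 𝓘(ℝ, E) φ) (X : GroupLieAlgebra 𝓘(ℝ, E) G)
    (g : G) : rder X φ g = diff 𝓘(ℝ, E) φ g (transR 𝓘(ℝ, E) g X) := by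
  have h := diff_comp (I := 𝓘(ℝ, E)) (1 : G) (F := fun h => h * g) (hφ.mdifferentiableAt (1 * g))
    (mdifferentiableAt_mul_right g 1)
  have h2 : ∀ x : G, x = g → (diff 𝓘(ℝ, E) φ x : E →ₗ[ℝ] ℝ) =
    (diff 𝓘(ℝ, E) φ g : E →ₗ[ℝ] ℝ) := by rintro x rfl; rfl
  exact (congrArg (fun T : E →ₗ[ℝ] ℝ => T X) h).trans
    (congrArg (fun T : E →ₗ[ℝ] ℝ => T (transR 𝓘(ℝ, E) g X)) (h2 _ (one_mul g)))

lemma lder_eq_rder_Ad {φ : G → ℝ} (hφ : IsSmooth 𝓘(ℝ, E) φ) (X : GroupLieAlgebra 𝓘(ℝ, E) G)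
    (g : G) : lder X φ g = rder (Ad 𝓘(ℝ, E) g X) φ g := by
  rw [lder_eq_diff_transL hφ, rder_eq_diff_transR hφ, transR_Ad]

lemma isSmooth_lder {φ : G → ℝ} (hφ : IsSmooth 𝓘(ℝ, E) φ) (X : GroupLieAlgebra 𝓘(ℝ, E) G) :
    IsSmooth 𝓘(ℝ, E) (lder X φ) := by
  exact isSmooth_diff_param (fun g h => φ (g * h)) (hφ.comp (contMDiff_mul 𝓘(ℝ, E) ∞)) 1 X

lemma isSmooth_rder {φ : G → ℝ} (hφ : IsSmooth 𝓘(ℝ, E) φ) (X : GroupLieAlgebra 𝓘(ℝ, E) G) :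
    IsSmooth 𝓘(ℝ, E) (rder X φ) :=
  isSmooth_diff_param (fun g h => φ (h * g))
    (hφ.comp ((contMDiff_mul 𝓘(ℝ, E) ∞).comp (contMDiff_snd.prodMk contMDiff_fst))) 1 X

/-- The commutator of left-invariant derivations is given by the Lie bracket. -/
lemma lder_comm [CompleteSpace E] {φ : G → ℝ} (hφ : IsSmooth 𝓘(ℝ, E) φ)
    (X Y : GroupLieAlgebra 𝓘(ℝ, E) G) (g : G) :
    lder X (lder Y φ) g - lder Y (lder X φ) g = lder ⁅X, Y⁆ φ g := by
  -- translation reduces the identity to the point `1`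
  let ψ : G → ℝ := fun h => φ (g * h)
  have hψ : IsSmooth 𝓘(ℝ, E) ψ := hφ.comp contMDiff_mul_left
  have h1 : ∀ Z : GroupLieAlgebra 𝓘(ℝ, E) G, (fun h => lder Z φ (g * h)) =
      fun h => diff 𝓘(ℝ, E) ψ h (mulInvariantVectorField Z h) := by
    intro Z; ext h
    refine Eq.trans ?_ (lder_eq_diff_transL hψ Z h)
    simp only [lder, ψ, mul_assoc]
  have h2 : ∀ Z : GroupLieAlgebra 𝓘(ℝ, E) G, (mulInvariantVectorField Z (1 : G) : E) = Z := by
    intro Z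
    have h1 : (fun h : G => 1 * h) = id := by ext; simp
    refine (congrArg (fun f : G → G => (mfderiv 𝓘(ℝ, E) 𝓘(ℝ, E) f 1 : E →L[ℝ] E) Z) h1).trans ?_
    exact congrArg (fun T : E →L[ℝ] E => T Z) mfderiv_id
  have hs : ∀ Z : GroupLieAlgebra 𝓘(ℝ, E) G, MDifferentiableAt 𝓘(ℝ, E) 𝓘(ℝ, ℝ)
      (fun h => diff 𝓘(ℝ, E) ψ h (mulInvariantVectorField Z h)) 1 := by
    intro Z
    rw [← h1]
    exact IsSmooth.mdifferentiableAt ((isSmooth_lder hφ Z).comp contMDiff_mul_left) 1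
  have h := diff_mlieBracket (1 : G) hψ (mdifferentiableAt_mulInvariantVectorField X)
    (mdifferentiableAt_mulInvariantVectorField Y) (hs X) (hs Y)
  rw [← h1, ← h1] at h
  simp only [lder] at h ⊢
  refine Eq.trans ?_ h.symm
  exact congrArg₂ (· - ·) (congrArg (diff 𝓘(ℝ, E) (fun h => lder Y φ (g * h)) 1) (h2 X).symm)
    (congrArg (diff 𝓘(ℝ, E) (fun h => lder X φ (g * h)) 1) (h2 Y).symm)

/-- Left and right translations commute. -/
lemma lder_rder_comm {φ : G → ℝ} (hφ : IsSmooth 𝓘(ℝ, E) φ) (X Y : GroupLieAlgebra 𝓘(ℝ, E) G)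
    (g : G) : lder X (rder Y φ) g = rder Y (lder X φ) g := by
  have h := diff_diff_comm (fun h k : G => φ (h * (g * k))) (E₁ := E) (E₂ := E)
    (hφ.comp ((contMDiff_mul 𝓘(ℝ, E) ∞).comp
      (contMDiff_fst.prodMk (contMDiff_mul_left.comp contMDiff_snd)))) 1 1 Y X
  simp only [lder, rder]
  refine h.trans ?_
  simp only [mul_assoc]

end Derivations

/-! ### Derivations acting on vector-valued functions -/

section HasDer

variable {X : Type*}

/-- `d` is a derivation on the algebra of functions cut out by `S`. -/
structure IsDerivationOn (S : (X → ℝ) → Prop) (d : (X → ℝ) → X → ℝ) : Prop where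
  mem_const : ∀ c : ℝ, S fun _ => c
  mem_add : ∀ {f h}, S f → S h → S fun x => f x + h x
  mem_mul : ∀ {f h}, S f → S h → S fun x => f x * h x
  der_const : ∀ c : ℝ, (d fun _ => c) = 0
  der_add : ∀ {f h}, S f → S h → ∀ x, d (fun x => f x + h x) x = d f x + d h x
  der_mul : ∀ {f h}, S f → S h → ∀ x, d (fun x => f x * h x) x = d f x * h x + f x * d h x

/-- The vector-valued function `F` has components in `S`, and the derivation `d` maps it to `F'`. -/
def HasDer {W : Type*} [AddCommGroup W] [Module ℝ W] (S : (X → ℝ) → Prop)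
    (d : (X → ℝ) → X → ℝ) (F F' : X → W) : Prop :=
  ∀ l : W →ₗ[ℝ] ℝ, S (fun x => l (F x)) ∧ ∀ x, d (fun x => l (F x)) x = l (F' x)

variable {S : (X → ℝ) → Prop} {d : (X → ℝ) → X → ℝ}
  {W W₁ W₂ : Type*} [AddCommGroup W] [Module ℝ W] [AddCommGroup W₁] [Module ℝ W₁]
  [AddCommGroup W₂] [Module ℝ W₂]

lemma HasDer.linear {F F' : X → W} (h : HasDer S d F F') (T : W →ₗ[ℝ] W₁) :
    HasDer S d (fun x => T (F x)) (fun x => T (F' x)) := fun l => h (l ∘ₗ T)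

lemma hasDer_real {f f' : X → ℝ} (hd : IsDerivationOn S d) (hf : S f) (hf' : ∀ x, d f x = f' x) :
    HasDer S d f f' := by
  intro l
  have hl : ∀ t, l t = l 1 * t := fun t => by
    rw [mul_comm, ← smul_eq_mul, ← map_smul, smul_eq_mul, mul_one]
  simp only [hl (f _)]
  refine ⟨hd.mem_mul (hd.mem_const _) hf, fun x => ?_⟩
  rw [hd.der_mul (hd.mem_const _) hf, hd.der_const, hf', hl (f' x)]
  simp

namespace IsDerivationOn

variable (hd : IsDerivationOn S d)
include hd

lemma hasDer_const (w : W) : HasDer S d (fun _ : X => w) (fun _ => 0) := fun l =>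
  ⟨hd.mem_const _, fun x => by rw [hd.der_const]; simp⟩

lemma hasDer_add {F F' K K' : X → W} (h : HasDer S d F F') (k : HasDer S d K K') :
    HasDer S d (fun x => F x + K x) (fun x => F' x + K' x) := by
  intro l
  simp only [map_add]
  refine ⟨hd.mem_add (h l).1 (k l).1, fun x => ?_⟩
  rw [hd.der_add (h l).1 (k l).1, (h l).2, (k l).2]

lemma hasDer_sub {F F' K K' : X → W} (h : HasDer S d F F') (k : HasDer S d K K') :
    HasDer S d (fun x => F x - K x) (fun x => F' x - K' x) := by
  simpa only [LinearMap.neg_apply, LinearMap.id_apply, ← sub_eq_add_neg] using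
    hd.hasDer_add h (k.linear (-LinearMap.id))

lemma hasDer_sum {ι : Type*} (s : Finset ι) {F F' : ι → X → W}
    (h : ∀ i ∈ s, HasDer S d (F i) (F' i)) :
    HasDer S d (fun x => ∑ i ∈ s, F i x) (fun x => ∑ i ∈ s, F' i x) := by
  classical
  induction s using Finset.induction_on with
  | empty => simpa using hd.hasDer_const (0 : W)
  | insert i s hi ih =>
    simp only [Finset.sum_insert hi]
    exact hd.hasDer_add (h i (Finset.mem_insert_self i s))
      (ih fun j hj => h j (Finset.mem_insert_of_mem hj))

/-- The Leibniz rule for a bilinear product. -/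
lemma hasDer_bilin [FiniteDimensional ℝ W₁] [FiniteDimensional ℝ W₂] {F F' : X → W₁}
    {K K' : X → W₂} (h : HasDer S d F F') (k : HasDer S d K K') (B : W₁ →ₗ[ℝ] W₂ →ₗ[ℝ] W) :
    HasDer S d (fun x => B (F x) (K x)) (fun x => B (F' x) (K x) + B (F x) (K' x)) := by
  let b := Module.finBasis ℝ W₁
  let c := Module.finBasis ℝ W₂
  have hB : ∀ u v, B u v = ∑ i, ∑ j, (b.coord i u * c.coord j v) • B (b i) (c j) := by
    intro u v
    conv_lhs => rw [← b.sum_repr u, ← c.sum_repr v]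
    simp only [map_sum, map_smul, LinearMap.sum_apply, LinearMap.smul_apply, mul_smul,
      Module.Basis.coord_apply, Finset.smul_sum]
    rw [Finset.sum_comm]
    exact Finset.sum_congr rfl fun i _ => Finset.sum_congr rfl fun j _ => smul_comm _ _ _
  have h1 : HasDer S d (fun x => B (F x) (K x))
      (fun x => ∑ i, ∑ j, (b.coord i (F' x) * c.coord j (K x) +
        b.coord i (F x) * c.coord j (K' x)) • B (b i) (c j)) := by
    simp only [hB (F _)]
    refine hd.hasDer_sum _ fun i _ => hd.hasDer_sum _ fun j _ => ?_
    refine HasDer.linear (F := fun x => b.coord i (F x) * c.coord j (K x)) ?_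
      (LinearMap.toSpanSingleton ℝ W (B (b i) (c j)))
    refine hasDer_real hd (hd.mem_mul (h _).1 (k _).1) fun x => ?_
    rw [hd.der_mul (h _).1 (k _).1, (h _).2, (k _).2]
    rfl
  convert h1 using 2 with x
  rw [hB, hB (F _)]
  simp only [add_smul, Finset.sum_add_distrib]

/-- A function all of whose components lie in `S` has a derivative. -/
lemma exists_hasDer [FiniteDimensional ℝ W] {F : X → W}
    (h : ∀ l : W →ₗ[ℝ] ℝ, S fun x => l (F x)) : ∃ F', HasDer S d F F' := by
  let b := Module.finBasis ℝ W
  refine ⟨fun x => ∑ i, d (fun x => b.coord i (F x)) x • b i, ?_⟩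
  have h1 : F = fun x => ∑ i, b.coord i (F x) • b i := by
    ext x; exact (b.sum_repr (F x)).symm
  suffices h2 : HasDer S d (fun x => ∑ i, b.coord i (F x) • b i)
      (fun x => ∑ i, d (fun x => b.coord i (F x)) x • b i) by rwa [← h1] at h2
  refine hd.hasDer_sum _ fun i _ => ?_
  exact HasDer.linear (hasDer_real hd (h (b.coord i)) fun x => rfl)
    (LinearMap.toSpanSingleton ℝ W (b i))

end IsDerivationOn

end HasDer

/-! ### Smoothness and derivative of the adjoint representation -/

section Adjoint

variable {E G : Type*} [NormedAddCommGroup E] [NormedSpace ℝ E]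
  [TopologicalSpace G] [ChartedSpace E G] [Group G] [LieGroup 𝓘(ℝ, E) ∞ G]

lemma isDerivationOn_lder (X : GroupLieAlgebra 𝓘(ℝ, E) G) :
    IsDerivationOn (IsSmooth 𝓘(ℝ, E) (M := G)) (lder X) where
  mem_const c := isSmooth_const c
  mem_add := IsSmooth.add
  mem_mul := IsSmooth.mul
  der_const c := by
    ext g
    exact congrArg (fun T : E →ₗ[ℝ] ℝ => T X) (diff_const (I := 𝓘(ℝ, E)) c (1 : G))
  der_add {f h} hf hh g := by
    have hf' : IsSmooth 𝓘(ℝ, E) (fun k => f (g * k)) := hf.comp contMDiff_mul_left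
    have hh' : IsSmooth 𝓘(ℝ, E) (fun k => h (g * k)) := hh.comp contMDiff_mul_left
    exact congrArg (fun T : E →ₗ[ℝ] ℝ => T X) (diff_add hf' hh' 1)
  der_mul {f h} hf hh g := by
    have hf' : IsSmooth 𝓘(ℝ, E) (fun k => f (g * k)) := hf.comp contMDiff_mul_left
    have hh' : IsSmooth 𝓘(ℝ, E) (fun k => h (g * k)) := hh.comp contMDiff_mul_left
    refine (congrArg (fun T : E →ₗ[ℝ] ℝ => T X) (diff_mul hf' hh' 1)).trans ?_
    change f (g * 1) * lder X h g + h (g * 1) * lder X f g = _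
    rw [mul_one]; ring

lemma diff_conj {c : G → ℝ} (hc : IsSmooth 𝓘(ℝ, E) c) (g : G) (X : GroupLieAlgebra 𝓘(ℝ, E) G) :
    diff 𝓘(ℝ, E) (fun h => c (g * h * g⁻¹)) 1 X = diff 𝓘(ℝ, E) c 1 (Ad 𝓘(ℝ, E) g X) := by
  have hφ : IsSmooth 𝓘(ℝ, E) fun h => c (h * g⁻¹) := hc.comp contMDiff_mul_right
  have h1 := lder_eq_diff_transL hφ X g
  refine h1.trans ?_
  have h2 := diff_comp (I := 𝓘(ℝ, E)) (F := fun h => h * g⁻¹) g (hc.mdifferentiableAt (g * g⁻¹))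
    (mdifferentiableAt_mul_right _ _)
  have h3 : ∀ x : G, x = 1 → (diff 𝓘(ℝ, E) c x : E →ₗ[ℝ] ℝ) =
    (diff 𝓘(ℝ, E) c 1 : E →ₗ[ℝ] ℝ) := by rintro x rfl; rfl
  exact (congrArg (fun T : E →ₗ[ℝ] ℝ => T (transL 𝓘(ℝ, E) g X)) h2).trans
    (congrArg (fun T : E →ₗ[ℝ] ℝ => T (Ad 𝓘(ℝ, E) g X)) (h3 _ (mul_inv_cancel g)))

variable [FiniteDimensional ℝ E] [T2Space G]

/-- The matrix coefficients of `Ad` are derivatives at `h = 1` of functions of `g * h * g⁻¹`. -/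
lemma isSmooth_Ad (l : GroupLieAlgebra 𝓘(ℝ, E) G →ₗ[ℝ] ℝ) (X : GroupLieAlgebra 𝓘(ℝ, E) G) :
    IsSmooth 𝓘(ℝ, E) (fun g : G => l (Ad 𝓘(ℝ, E) g X)) := by
  obtain ⟨c, hc, hcl⟩ := exists_isSmooth_diff_eq (1 : G) l
  rw [← hcl]
  simp only [← diff_conj hc]
  refine isSmooth_diff_param (fun g h : G => c (g * h * g⁻¹)) ?_ 1 X
  exact hc.comp (((contMDiff_fst.mul contMDiff_snd)).mul contMDiff_fst.inv)

lemma exists_isSmooth_rder_eq (g : G) (l : GroupLieAlgebra 𝓘(ℝ, E) G →ₗ[ℝ] ℝ) :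
    ∃ φ : G → ℝ, IsSmooth 𝓘(ℝ, E) φ ∧ ∀ X, rder X φ g = l X := by
  obtain ⟨φ, hφ, h⟩ := exists_isSmooth_diff_eq g (l ∘ₗ transRInv 𝓘(ℝ, E) g)
  refine ⟨φ, hφ, fun X => ?_⟩
  rw [rder_eq_diff_transR hφ, h, LinearMap.comp_apply, transRInv_transR]

lemma exists_isSmooth_lder_eq (g : G) (l : GroupLieAlgebra 𝓘(ℝ, E) G →ₗ[ℝ] ℝ) :
    ∃ φ : G → ℝ, IsSmooth 𝓘(ℝ, E) φ ∧ ∀ X, lder X φ g = l X := by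
  obtain ⟨φ, hφ, h⟩ := exists_isSmooth_diff_eq g (l ∘ₗ transLInv 𝓘(ℝ, E) g)
  refine ⟨φ, hφ, fun X => ?_⟩
  rw [lder_eq_diff_transL hφ, h, LinearMap.comp_apply, transLInv_transL]

/-- Left-invariant vector fields expand in right-invariant ones with the coefficients of `Ad`,
and the two kinds of fields commute; this yields the derivative of `Ad`. -/
lemma hasDer_Ad (Z X : GroupLieAlgebra 𝓘(ℝ, E) G) :
    HasDer (IsSmooth 𝓘(ℝ, E)) (lder Z) (fun g : G => Ad 𝓘(ℝ, E) g X)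
      (fun g => Ad 𝓘(ℝ, E) g ⁅Z, X⁆) := by
  have hd := isDerivationOn_lder (G := G) Z
  have : CompleteSpace E := FiniteDimensional.complete ℝ E
  obtain ⟨A', hA'⟩ := hd.exists_hasDer (fun l => isSmooth_Ad l X)
  convert hA' using 1
  ext g
  rw [← sub_eq_zero, ← Module.forall_dual_apply_eq_zero_iff ℝ]
  intro l
  rw [map_sub, sub_eq_zero]
  obtain ⟨φ, hφ, hφl⟩ := exists_isSmooth_rder_eq g l
  let b := Module.finBasis ℝ (GroupLieAlgebra 𝓘(ℝ, E) G)
  have hr : ∀ (Y : GroupLieAlgebra 𝓘(ℝ, E) G) (ψ : G → ℝ) (k : G),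
      rder Y ψ k = ∑ i, b.coord i Y * rder (b i) ψ k := by
    intro Y ψ k
    conv_lhs => rw [← b.sum_repr Y]
    simp only [rder, map_sum, map_smul, smul_eq_mul, Module.Basis.coord_apply]
  -- differentiate the expansion of `lder X φ` in right-invariant derivatives along `Z`
  have h1 : lder X φ = fun k => ∑ i, b.coord i (Ad 𝓘(ℝ, E) k X) * rder (b i) φ k := by
    ext k
    rw [lder_eq_rder_Ad hφ, hr]
  have h2 : HasDer (IsSmooth 𝓘(ℝ, E)) (lder Z) (lder X φ)
      (fun k => ∑ i, (b.coord i (A' k) * rder (b i) φ k +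
        b.coord i (Ad 𝓘(ℝ, E) k X) * rder (b i) (lder Z φ) k)) := by
    rw [h1]
    refine hd.hasDer_sum _ fun i _ => hd.hasDer_bilin (hA'.linear (b.coord i)) ?_
      (LinearMap.mul ℝ ℝ)
    exact hasDer_real hd (isSmooth_rder hφ _) fun x => lder_rder_comm hφ _ _ _
  have h3 := (h2 LinearMap.id).2 g
  simp only [LinearMap.id_apply, Finset.sum_add_distrib, ← hr] at h3
  rw [hφl, ← lder_eq_rder_Ad (isSmooth_lder hφ Z)] at h3
  rw [← hφl, ← lder_eq_rder_Ad hφ, ← lder_comm hφ]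
  linarith

end Adjoint

/-! ### Contractions of two-tensors -/

section Contraction

variable {V W V' W' : Type*} [AddCommGroup V] [Module ℝ V] [AddCommGroup W] [Module ℝ W]
  [AddCommGroup V'] [Module ℝ V'] [AddCommGroup W'] [Module ℝ W']

/-- The contraction of a two-tensor with two linear forms. -/
def contract (a : V →ₗ[ℝ] ℝ) (b : W →ₗ[ℝ] ℝ) : V ⊗[ℝ] W →ₗ[ℝ] ℝ :=
  (TensorProduct.lid ℝ ℝ).toLinearMap ∘ₗ TensorProduct.map a b

@[simp] lemma contract_tmul (a : V →ₗ[ℝ] ℝ) (b : W →ₗ[ℝ] ℝ) (v : V) (w : W) :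
    contract a b (v ⊗ₜ w) = a v * b w := by simp [contract]

lemma contract_map (a : V' →ₗ[ℝ] ℝ) (b : W' →ₗ[ℝ] ℝ) (f : V →ₗ[ℝ] V') (g : W →ₗ[ℝ] W')
    (t : V ⊗[ℝ] W) : contract a b (TensorProduct.map f g t) = contract (a ∘ₗ f) (b ∘ₗ g) t := by
  induction t with
  | zero => simp
  | tmul => simp
  | add x y hx hy => simp only [map_add, hx, hy]

lemma contract_comm (a : V →ₗ[ℝ] ℝ) (b : W →ₗ[ℝ] ℝ) (t : V ⊗[ℝ] W) :
    contract b a (TensorProduct.comm ℝ V W t) = contract a b t := by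
  induction t with
  | zero => simp
  | tmul => simp [mul_comm]
  | add x y hx hy => simp only [map_add, hx, hy]

lemma contract_eq_rid (a : V →ₗ[ℝ] ℝ) (b : W →ₗ[ℝ] ℝ) (t : V ⊗[ℝ] W) :
    contract a b t = a (TensorProduct.rid ℝ V (TensorProduct.map LinearMap.id b t)) := by
  induction t with
  | zero => simp
  | tmul => simp [mul_comm]
  | add x y hx hy => simp only [map_add, hx, hy]

lemma rid_map (f : V →ₗ[ℝ] V') (b : W →ₗ[ℝ] ℝ) (t : V ⊗[ℝ] W) :
    TensorProduct.rid ℝ V' (TensorProduct.map f b t) =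
      f (TensorProduct.rid ℝ V (TensorProduct.map LinearMap.id b t)) := by
  induction t with
  | zero => simp
  | tmul => simp
  | add x y hx hy => simp only [map_add, hx, hy]

lemma contract_add_left (a a' : V →ₗ[ℝ] ℝ) (b : W →ₗ[ℝ] ℝ) (t : V ⊗[ℝ] W) :
    contract (a + a') b t = contract a b t + contract a' b t := by
  simp [contract, TensorProduct.map_add_left]

lemma contract_smul_left (c : ℝ) (a : V →ₗ[ℝ] ℝ) (b : W →ₗ[ℝ] ℝ) (t : V ⊗[ℝ] W) :
    contract (c • a) b t = c * contract a b t := by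
  simp [contract, TensorProduct.map_smul_left]

/-- On finite-dimensional spaces the forms `a ⊗ b` span the dual of the tensor product. -/
lemma exists_sum_contract [FiniteDimensional ℝ V] [FiniteDimensional ℝ W]
    (l : V ⊗[ℝ] W →ₗ[ℝ] ℝ) : ∃ (n : ℕ) (a : Fin n → V →ₗ[ℝ] ℝ) (b : Fin n → W →ₗ[ℝ] ℝ),
      l = ∑ i, contract (a i) (b i) := by
  let b := Module.finBasis ℝ V
  refine ⟨_, fun i => b.coord i, fun i => l ∘ₗ TensorProduct.mk ℝ V W (b i), ?_⟩
  ext v w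
  simp only [TensorProduct.AlgebraTensorModule.curry_apply, LinearMap.restrictScalars_self,
    TensorProduct.curry_apply, LinearMap.sum_apply, contract_tmul, LinearMap.comp_apply,
    TensorProduct.mk_apply]
  conv_lhs => rw [← b.sum_repr v]
  simp only [TensorProduct.sum_tmul, map_sum, ← TensorProduct.smul_tmul', map_smul, smul_eq_mul,
    Module.Basis.coord_apply]

lemma ext_contract [FiniteDimensional ℝ V] [FiniteDimensional ℝ W] {s t : V ⊗[ℝ] W}
    (h : ∀ a b, contract a b s = contract a b t) : s = t := by
  rw [← sub_eq_zero, ← Module.forall_dual_apply_eq_zero_iff ℝ]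
  intro l
  obtain ⟨n, a, b, rfl⟩ := exists_sum_contract l
  simp [LinearMap.sum_apply, h]

/-- A tensor-valued function is differentiated by differentiating its contractions. -/
lemma hasDer_of_contract [FiniteDimensional ℝ V] [FiniteDimensional ℝ W] {X : Type*}
    {S : (X → ℝ) → Prop} {d : (X → ℝ) → X → ℝ} (hd : IsDerivationOn S d)
    {F F' : X → V ⊗[ℝ] W} (hS : ∀ a b, S fun x => contract a b (F x))
    (hF : ∀ a b x, d (fun x => contract a b (F x)) x = contract a b (F' x)) :
    HasDer S d F F' := by
  intro l
  obtain ⟨n, a, b, rfl⟩ := exists_sum_contract l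
  have h := hd.hasDer_sum (W := ℝ) Finset.univ
    fun i _ => hasDer_real hd (hS (a i) (b i)) (hF (a i) (b i))
  simpa using h LinearMap.id

end Contraction

/-- The action `ad_X ⊗ 1 + 1 ⊗ ad_Y` on two-tensors. -/
def ad₂ (𝕂 : Type*) [CommRing 𝕂] {𝔤 𝔥 : Type*} [LieRing 𝔤] [LieAlgebra 𝕂 𝔤] [LieRing 𝔥]
    [LieAlgebra 𝕂 𝔥] (X : 𝔤) (Y : 𝔥) : 𝔤 ⊗[𝕂] 𝔥 →ₗ[𝕂] 𝔤 ⊗[𝕂] 𝔥 :=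
  TensorProduct.map (LieAlgebra.ad 𝕂 𝔤 X) LinearMap.id +
    TensorProduct.map LinearMap.id (LieAlgebra.ad 𝕂 𝔥 Y)

/-! ### The Poisson bracket as a derivation -/

section Bracket

variable {E H M : Type*} [NormedAddCommGroup E] [NormedSpace ℝ E] [TopologicalSpace H]
  {I : ModelWithCorners ℝ E H} [TopologicalSpace M] [ChartedSpace H M] {P : TensorField I M}
  {E₁ H₁ N₁ : Type*} [NormedAddCommGroup E₁] [NormedSpace ℝ E₁] [TopologicalSpace H₁]
  {J : ModelWithCorners ℝ E₁ H₁} [TopologicalSpace N₁] [ChartedSpace H₁ N₁]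

lemma pb_eq_contract (f h : M → ℝ) (m : M) :
    pb P f h m = contract (diff I f m) (diff I h m) (P m) := rfl

lemma IsPoisson.antisymm (hP : IsPoisson P) (f h : M → ℝ) (m : M) : pb P f h m = -pb P h f m := by
  rw [pb_eq_contract, pb_eq_contract, ← contract_comm, hP.skew, map_neg]

lemma isDerivationOn_pb (P : TensorField I M) (f : M → ℝ) :
    IsDerivationOn (IsSmooth I) (fun h => pb P h f) where
  mem_const c := isSmooth_const c
  mem_add := IsSmooth.add
  mem_mul := IsSmooth.mul
  der_const c := by
    ext m
    rw [pb_eq_contract, diff_const]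
    simp [contract, TensorProduct.map_zero_left]
  der_add hf hh m := by
    simp only [pb_eq_contract, diff_add hf hh, contract_add_left]
  der_mul hf hh m := by
    simp only [pb_eq_contract, diff_mul hf hh, contract_add_left, contract_smul_left]
    ring

lemma apply_pbMap (F : M → N₁) (f : M → ℝ) (m : M) (l : TangentSpace J (F m) →ₗ[ℝ] ℝ) :
    l (pbMap J P F f m) =
      contract (l ∘ₗ (mfderiv I J F m).toLinearMap) (diff I f m) (P m) := by
  rw [pbMap, rid_map, contract_eq_rid, LinearMap.comp_apply]

lemma pb_comp_left {φ : N₁ → ℝ} (hφ : IsSmooth J φ) {F : M → N₁} (hF : MDifferentiable I J F)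
    (f : M → ℝ) (m : M) :
    pb P (fun x => φ (F x)) f m = diff J φ (F m) (pbMap J P F f m) := by
  rw [pb_eq_contract, apply_pbMap, diff_comp m (hφ.mdifferentiableAt _) (hF m)]

end Bracket

/-! ### Derivations related to left-invariant ones -/

section Linear

variable {F Gs : Type*} [NormedAddCommGroup F] [NormedSpace ℝ F]
  [TopologicalSpace Gs] [ChartedSpace F Gs] [Group Gs]

lemma lder_neg_left (X : GroupLieAlgebra 𝓘(ℝ, F) Gs) (φ : Gs → ℝ) (g : Gs) :
    lder (-X) φ g = -lder X φ g := map_neg _ X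

lemma lder_sum_smul_left {ι : Type*} (s : Finset ι) (c : ι → ℝ)
    (X : ι → GroupLieAlgebra 𝓘(ℝ, F) Gs) (φ : Gs → ℝ) (g : Gs) :
    lder (∑ i ∈ s, c i • X i) φ g = ∑ i ∈ s, c i * lder (X i) φ g := by
  simp only [lder, map_sum, map_smul, smul_eq_mul]

end Linear

section Related

variable {F Gs : Type*} [NormedAddCommGroup F] [NormedSpace ℝ F] [FiniteDimensional ℝ F]
  [TopologicalSpace Gs] [ChartedSpace F Gs] [Group Gs] [LieGroup 𝓘(ℝ, F) ∞ Gs]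
  {E H M : Type*} [NormedAddCommGroup E] [NormedSpace ℝ E] [TopologicalSpace H]
  {I : ModelWithCorners ℝ E H} [TopologicalSpace M] [ChartedSpace H M]

/-- If the derivation `d` of functions on `M` is related by `Γ` to the family `v` of left-invariant
derivations of the group, then it differentiates `m ↦ lder (A m) φ (Γ m)` by the Leibniz rule. -/
lemma der_lder_comp {d : (M → ℝ) → M → ℝ} (hd : IsDerivationOn (IsSmooth I) d) {Γ : M → Gs}
    (hΓ : ContMDiff I 𝓘(ℝ, F) ∞ Γ) {v : M → GroupLieAlgebra 𝓘(ℝ, F) Gs}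
    (hv : ∀ φ, IsSmooth 𝓘(ℝ, F) φ → ∀ m, d (fun x => φ (Γ x)) m = lder (v m) φ (Γ m))
    {A A' : M → GroupLieAlgebra 𝓘(ℝ, F) Gs} (hA : HasDer (IsSmooth I) d A A')
    {φ : Gs → ℝ} (hφ : IsSmooth 𝓘(ℝ, F) φ) (m : M) :
    IsSmooth I (fun x => lder (A x) φ (Γ x)) ∧ d (fun x => lder (A x) φ (Γ x)) m =
      lder (A' m) φ (Γ m) + lder (v m) (lder (A m) φ) (Γ m) := by
  let b := Module.finBasis ℝ (GroupLieAlgebra 𝓘(ℝ, F) Gs)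
  have hb : ∀ (X : GroupLieAlgebra 𝓘(ℝ, F) Gs) (g : Gs),
      lder X φ g = ∑ i, b.coord i X * lder (b i) φ g := by
    intro X g
    conv_lhs => rw [← b.sum_repr X]
    exact lder_sum_smul_left _ _ _ _ _
  have h1 : HasDer (IsSmooth I) d (fun x => lder (A x) φ (Γ x))
      (fun x => ∑ i, (b.coord i (A' x) * lder (b i) φ (Γ x) +
        b.coord i (A x) * lder (v x) (lder (b i) φ) (Γ x))) := by
    simp only [hb (A _)]
    refine hd.hasDer_sum _ fun i _ => hd.hasDer_bilin (hA.linear (b.coord i)) ?_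
      (LinearMap.mul ℝ ℝ)
    exact hasDer_real hd ((isSmooth_lder hφ _).comp hΓ) (hv _ (isSmooth_lder hφ _))
  have h2 : lder (v m) (lder (A m) φ) (Γ m) =
      ∑ i, b.coord i (A m) * lder (v m) (lder (b i) φ) (Γ m) := by
    have h3 : lder (A m) φ = fun g => ∑ i, b.coord i (A m) * lder (b i) φ g := by
      ext g; exact hb _ _
    have hl := isDerivationOn_lder (v m)
    have h4 := hl.hasDer_sum (W := ℝ) Finset.univ fun i _ =>
      (hasDer_real hl (isSmooth_lder hφ (b i)) fun x => rfl).linear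
        (LinearMap.mul ℝ ℝ (b.coord i (A m)))
    rw [h3]
    exact (h4 LinearMap.id).2 (Γ m)
  refine ⟨(h1 LinearMap.id).1, ((h1 LinearMap.id).2 m).trans ?_⟩
  rw [LinearMap.id_apply, h2, hb (A' m), ← Finset.sum_add_distrib]

end Related

/-! ### The bracket of a moment map with itself -/

section Moment

variable {E G : Type*} [NormedAddCommGroup E] [NormedSpace ℝ E] [FiniteDimensional ℝ E]
  [TopologicalSpace G] [ChartedSpace E G] [Group G] [LieGroup 𝓘(ℝ, E) ∞ G]
  {F Gs : Type*} [NormedAddCommGroup F] [NormedSpace ℝ F] [FiniteDimensional ℝ F]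
  [TopologicalSpace Gs] [ChartedSpace F Gs] [Group Gs] [LieGroup 𝓘(ℝ, F) ∞ Gs]
  {V M : Type*} [NormedAddCommGroup V] [NormedSpace ℝ V]
  [TopologicalSpace M] [ChartedSpace V M]

/-- The logarithmic differential `v ↦ Γ⁻¹ dΓ(v)`. -/
def logDiff (Γ : M → Gs) (m : M) : TangentSpace 𝓘(ℝ, V) m →ₗ[ℝ] GroupLieAlgebra 𝓘(ℝ, F) Gs :=
  transLInv 𝓘(ℝ, F) (Γ m) ∘ₗ (mfderiv 𝓘(ℝ, V) 𝓘(ℝ, F) Γ m).toLinearMap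

/-- `Γ⁻¹ {Γ, f}`, a function with values in the Lie algebra. -/
def logBracket (PM : TensorField 𝓘(ℝ, V) M) (Γ : M → Gs) (f : M → ℝ) (m : M) :
    GroupLieAlgebra 𝓘(ℝ, F) Gs :=
  transLInv 𝓘(ℝ, F) (Γ m) (pbMap 𝓘(ℝ, F) PM Γ f m)

/-- `Γ₁⁻¹ Γ₂⁻¹ {Γ₁, Γ₂}`, a function with values in the tensor square of the Lie algebra. -/
def logTensor (PM : TensorField 𝓘(ℝ, V) M) (Γ : M → Gs) (m : M) :
    GroupLieAlgebra 𝓘(ℝ, F) Gs ⊗[ℝ] GroupLieAlgebra 𝓘(ℝ, F) Gs :=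
  TensorProduct.map (logDiff Γ m) (logDiff Γ m) (PM m)

variable {PM : TensorField 𝓘(ℝ, V) M} {Γ : M → Gs}

lemma apply_logBracket (l : GroupLieAlgebra 𝓘(ℝ, F) Gs →ₗ[ℝ] ℝ) (f : M → ℝ) (m : M) :
    l (logBracket PM Γ f m) = contract (l ∘ₗ logDiff Γ m) (diff 𝓘(ℝ, V) f m) (PM m) :=
  apply_pbMap Γ f m (l ∘ₗ transLInv 𝓘(ℝ, F) (Γ m))

/-- Bracketing with `f` differentiates functions of `Γ` along `Γ⁻¹ {Γ, f}`. -/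
lemma pb_comp_moment (hΓ : ContMDiff 𝓘(ℝ, V) 𝓘(ℝ, F) ∞ Γ) (f : M → ℝ) {φ : Gs → ℝ}
    (hφ : IsSmooth 𝓘(ℝ, F) φ) (m : M) :
    pb PM (fun x => φ (Γ x)) f m = lder (logBracket (F := F) PM Γ f m) φ (Γ m) := by
  rw [pb_comp_left hφ (hΓ.mdifferentiable (by simp)), lder_eq_diff_transL hφ, logBracket,
    transL_transLInv]

/-- For a function of `Γ` the bracket `Γ⁻¹ {Γ, φ ∘ Γ}` is a contraction of `Γ₁⁻¹ Γ₂⁻¹ {Γ₁, Γ₂}`. -/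
lemma apply_logBracket_comp (hΓ : ContMDiff 𝓘(ℝ, V) 𝓘(ℝ, F) ∞ Γ)
    (l : GroupLieAlgebra 𝓘(ℝ, F) Gs →ₗ[ℝ] ℝ) {φ : Gs → ℝ} (hφ : IsSmooth 𝓘(ℝ, F) φ) (m : M) :
    l (logBracket PM Γ (fun x => φ (Γ x)) m) =
      contract l (diff 𝓘(ℝ, F) φ (Γ m) ∘ₗ transL 𝓘(ℝ, F) (Γ m)) (logTensor PM Γ m) := by
  rw [apply_logBracket, logTensor, contract_map,
    diff_comp m (hφ.mdifferentiableAt _) (hΓ.mdifferentiable (by simp) m)]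
  congr 2
  ext v
  simp only [LinearMap.comp_apply, logDiff]
  rw [transL_transLInv]

variable {ρ : M → G → M}
  {τ : GroupLieAlgebra 𝓘(ℝ, F) Gs ≃ₗ[ℝ] Module.Dual ℝ (GroupLieAlgebra 𝓘(ℝ, E) G)}

lemma IsMomentMap.infAction_eq (hΓ : IsMomentMap PM ρ τ Γ) (ε : GroupLieAlgebra 𝓘(ℝ, E) G)
    {f : M → ℝ} (hf : IsSmooth 𝓘(ℝ, V) f) (m : M) :
    infAction ρ ε f m = -(τ (logBracket PM Γ f m) ε) := hΓ.action ε f hf m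

/-- The linear form `⟨ε, ·⟩` on the Lie algebra of the dual group. -/
def pairing (τ : GroupLieAlgebra 𝓘(ℝ, F) Gs ≃ₗ[ℝ] Module.Dual ℝ (GroupLieAlgebra 𝓘(ℝ, E) G))
    (ε : GroupLieAlgebra 𝓘(ℝ, E) G) : GroupLieAlgebra 𝓘(ℝ, F) Gs →ₗ[ℝ] ℝ :=
  Module.Dual.eval ℝ _ ε ∘ₗ τ.toLinearMap

/-- By reflexivity every linear form on the Lie algebra of the dual group is of the form
`⟨ε, ·⟩`. -/
lemma exists_pairing_eq (l : GroupLieAlgebra 𝓘(ℝ, F) Gs →ₗ[ℝ] ℝ) :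
    ∃ ε, pairing (E := E) (G := G) τ ε = l := by
  obtain ⟨ε, hε⟩ := (Module.evalEquiv ℝ (GroupLieAlgebra 𝓘(ℝ, E) G)).surjective
    (l ∘ₗ τ.symm.toLinearMap)
  refine ⟨ε, ?_⟩
  ext v
  have := LinearMap.congr_fun hε (τ v)
  simpa [pairing] using this

variable {PG : TensorField 𝓘(ℝ, E) G}

lemma IsPoissonLieAction.isDerivationOn_infAction (hρ : IsPoissonLieAction PM PG ρ)
    (ε : GroupLieAlgebra 𝓘(ℝ, E) G) :
    IsDerivationOn (IsSmooth 𝓘(ℝ, V)) (infAction ρ ε) where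
  mem_const c := isSmooth_const c
  mem_add := IsSmooth.add
  mem_mul := IsSmooth.mul
  der_const c := by
    ext m
    exact congrArg (fun T : E →ₗ[ℝ] ℝ => T ε) (diff_const (I := 𝓘(ℝ, E)) c (1 : G))
  der_add {f h} hf hh m := by
    have hs : ContMDiff 𝓘(ℝ, E) 𝓘(ℝ, V) ∞ (fun g => ρ m g) :=
      hρ.smooth.comp (contMDiff_const.prodMk contMDiff_id)
    exact congrArg (fun T : E →ₗ[ℝ] ℝ => T ε) (diff_add (hf.comp hs) (hh.comp hs) 1)
  der_mul {f h} hf hh m := by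
    have hs : ContMDiff 𝓘(ℝ, E) 𝓘(ℝ, V) ∞ (fun g => ρ m g) :=
      hρ.smooth.comp (contMDiff_const.prodMk contMDiff_id)
    refine (congrArg (fun T : E →ₗ[ℝ] ℝ => T ε) (diff_mul (hf.comp hs) (hh.comp hs) 1)).trans ?_
    change f (ρ m 1) * infAction ρ ε h m + h (ρ m 1) * infAction ρ ε f m = _
    rw [hρ.map_one]; ring

lemma IsPoissonLieAction.isSmooth_infAction [IsManifold 𝓘(ℝ, V) ∞ M]
    (hρ : IsPoissonLieAction PM PG ρ)
    (ε : GroupLieAlgebra 𝓘(ℝ, E) G) {f : M → ℝ} (hf : IsSmooth 𝓘(ℝ, V) f) :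
    IsSmooth 𝓘(ℝ, V) (infAction ρ ε f) :=
  isSmooth_diff_param (fun m g => f (ρ m g)) (hf.comp hρ.smooth) 1 ε

/-- The infinitesimal action is an action of the Lie algebra of `G`. -/
lemma IsPoissonLieAction.infAction_comm (hρ : IsPoissonLieAction PM PG ρ)
    (ε η : GroupLieAlgebra 𝓘(ℝ, E) G) {f : M → ℝ} (hf : IsSmooth 𝓘(ℝ, V) f) (m : M) :
    infAction ρ ε (infAction ρ η f) m - infAction ρ η (infAction ρ ε f) m =
      infAction ρ ⁅ε, η⁆ f m := by
  have : CompleteSpace E := FiniteDimensional.complete ℝ E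
  have hs : IsSmooth 𝓘(ℝ, E) (fun g => f (ρ m g)) :=
    hf.comp (hρ.smooth.comp (contMDiff_const.prodMk contMDiff_id))
  have h := lder_comm hs ε η 1
  simpa only [lder, infAction, one_mul, hρ.map_mul] using h

variable [IsManifold 𝓘(ℝ, V) ∞ M]

lemma IsMomentMap.isSmooth_logBracket (hρ : IsPoissonLieAction PM PG ρ)
    (hΓ : IsMomentMap PM ρ τ Γ) {f : M → ℝ} (hf : IsSmooth 𝓘(ℝ, V) f)
    (l : GroupLieAlgebra 𝓘(ℝ, F) Gs →ₗ[ℝ] ℝ) :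
    IsSmooth 𝓘(ℝ, V) (fun m => l (logBracket PM Γ f m)) := by
  obtain ⟨ε, rfl⟩ := exists_pairing_eq (τ := τ) l
  have h : (fun m => pairing τ ε (logBracket PM Γ f m)) = fun m => (-1) * infAction ρ ε f m := by
    ext m
    rw [hΓ.infAction_eq ε hf]
    simp [pairing]
  rw [h]
  exact (isSmooth_const (-1)).mul (hρ.isSmooth_infAction ε hf)

variable [T2Space Gs]

/-- The tensor `Γ₁⁻¹ Γ₂⁻¹ {Γ₁, Γ₂}` depends smoothly on the point: its contraction with `ε ⊗ l` is
up to sign the derivative of `g ↦ c (Γ(m)⁻¹ Γ(m g))` at `g = 1` in the direction `ε`, for any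
function `c` with differential `l` at the identity. -/
lemma IsMomentMap.isSmooth_logTensor (hρ : IsPoissonLieAction PM PG ρ)
    (hΓ : IsMomentMap PM ρ τ Γ) (l l' : GroupLieAlgebra 𝓘(ℝ, F) Gs →ₗ[ℝ] ℝ) :
    IsSmooth 𝓘(ℝ, V) (fun m => contract l l' (logTensor PM Γ m)) := by
  obtain ⟨ε, rfl⟩ := exists_pairing_eq (τ := τ) l
  obtain ⟨c, hc, hcl⟩ := exists_isSmooth_diff_eq (1 : Gs) l'
  have hcm : ∀ g : Gs, IsSmooth 𝓘(ℝ, F) (fun h => c (g⁻¹ * h)) := fun g =>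
    hc.comp contMDiff_mul_left
  have h : (fun m => contract (pairing τ ε) l' (logTensor PM Γ m)) =
      fun m => (-1) * diff 𝓘(ℝ, E) (fun g => c ((Γ m)⁻¹ * Γ (ρ m g))) 1 ε := by
    ext m
    have h1 := apply_logBracket_comp (PM := PM) hΓ.smooth (pairing τ ε) (hcm (Γ m)) m
    have h2 : diff 𝓘(ℝ, F) (fun h => c ((Γ m)⁻¹ * h)) (Γ m) ∘ₗ transL 𝓘(ℝ, F) (Γ m) = l' := by
      ext X
      rw [LinearMap.comp_apply, ← lder_eq_diff_transL (hcm (Γ m)), lder]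
      simp only [inv_mul_cancel_left]
      rw [← hcl]
    have h3 := hΓ.infAction_eq ε (f := fun x => c ((Γ m)⁻¹ * Γ x)) ((hcm (Γ m)).comp hΓ.smooth) m
    rw [h2] at h1
    rw [← h1]
    have h4 : diff 𝓘(ℝ, E) (fun g => c ((Γ m)⁻¹ * Γ (ρ m g))) 1 ε =
      infAction ρ ε (fun x => c ((Γ m)⁻¹ * Γ x)) m := rfl
    rw [h4, h3]
    simp [pairing]
  rw [h]
  refine (isSmooth_const (-1)).mul (isSmooth_diff_param (fun m g => c ((Γ m)⁻¹ * Γ (ρ m g))) ?_ 1 ε)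
  exact hc.comp (((hΓ.smooth.comp contMDiff_fst).inv).mul (hΓ.smooth.comp hρ.smooth))

/-- The Jacobi identity, tested on functions of `Γ`, is the Maurer-Cartan equation
`Γ⁻¹{Γ, {f, h}} = {Γ⁻¹{Γ, f}, h} - {Γ⁻¹{Γ, h}, f} + [Γ⁻¹{Γ, h}, Γ⁻¹{Γ, f}]`. -/
lemma logBracket_pb (hP : IsPoisson PM) (hΓ : ContMDiff 𝓘(ℝ, V) 𝓘(ℝ, F) ∞ Γ)
    {f h : M → ℝ} (hf : IsSmooth 𝓘(ℝ, V) f) (hh : IsSmooth 𝓘(ℝ, V) h)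
    {a b : M → GroupLieAlgebra 𝓘(ℝ, F) Gs}
    (ha : HasDer (IsSmooth 𝓘(ℝ, V)) (fun k => pb PM k h) (logBracket (F := F) PM Γ f) a)
    (hb : HasDer (IsSmooth 𝓘(ℝ, V)) (fun k => pb PM k f) (logBracket (F := F) PM Γ h) b) (m : M) :
    logBracket (F := F) PM Γ (pb PM f h) m =
      a m - b m + ⁅logBracket (F := F) PM Γ h m, logBracket (F := F) PM Γ f m⁆ := by
  have : CompleteSpace F := FiniteDimensional.complete ℝ F
  rw [← sub_eq_zero, ← Module.forall_dual_apply_eq_zero_iff ℝ]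
  intro l
  -- a test function `φ` on the group whose logarithmic differential at `Γ m` is `l`
  obtain ⟨φ, hφ, hφl⟩ := exists_isSmooth_lder_eq (Γ m) l
  have hφΓ : IsSmooth 𝓘(ℝ, V) (fun x => φ (Γ x)) := hφ.comp hΓ
  have hbr : ∀ k, pb PM (fun x => φ (Γ x)) k =
      fun x => lder (logBracket (F := F) PM Γ k x) φ (Γ x) := fun k =>
    funext fun x => pb_comp_moment hΓ k hφ x
  have h1 := (der_lder_comp (isDerivationOn_pb PM h) hΓ (fun φ hφ m => pb_comp_moment hΓ h hφ m)
    ha hφ m).2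
  have h2 := (der_lder_comp (isDerivationOn_pb PM f) hΓ (fun φ hφ m => pb_comp_moment hΓ f hφ m)
    hb hφ m).2
  have h3 := congrFun (hP.jacobi (fun x => φ (Γ x)) f h hφΓ hf hh) m
  simp only [Pi.add_apply, Pi.zero_apply] at h3
  rw [pb_comp_moment hΓ _ hφ, hP.antisymm f, hP.antisymm h] at h3
  have h4 : pb PM (pb PM h fun x => φ (Γ x)) f m = -pb PM (pb PM (fun x => φ (Γ x)) h) f m := by
    have : (pb PM h fun x => φ (Γ x)) = fun x => (-1) * pb PM (fun x => φ (Γ x)) h x := by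
      ext x; rw [hP.antisymm]; ring
    have hs := (isDerivationOn_pb PM f).der_mul (isSmooth_const (-1))
      (hP.smooth _ _ hφΓ hh) m
    rw [this, hs, (isDerivationOn_pb PM f).der_const]
    simp
  rw [h4, hbr f, hbr h, h1, h2] at h3
  have h5 := lder_comm hφ (logBracket (F := F) PM Γ h m) (logBracket (F := F) PM Γ f m) (Γ m)
  rw [hφl] at h5
  simp only [hφl] at h3
  simp only [map_sub, map_add]
  linarith

/-- The contraction of the first factor of a two-tensor with a linear form. -/
def contractLeft {W W' : Type*} [AddCommGroup W] [Module ℝ W] [AddCommGroup W'] [Module ℝ W']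
    (l : W →ₗ[ℝ] ℝ) : W ⊗[ℝ] W' →ₗ[ℝ] W' :=
  (TensorProduct.lid ℝ W').toLinearMap ∘ₗ TensorProduct.map l LinearMap.id

lemma apply_contractLeft {W W' : Type*} [AddCommGroup W] [Module ℝ W] [AddCommGroup W']
    [Module ℝ W'] (l : W →ₗ[ℝ] ℝ) (l' : W' →ₗ[ℝ] ℝ) (t : W ⊗[ℝ] W') :
    l' (contractLeft l t) = contract l l' t := by
  induction t with
  | zero => simp
  | tmul => simp [contractLeft]
  | add x y hx hy => simp only [map_add, hx, hy]

/-- The bracket of `L = Γ₁⁻¹ Γ₂⁻¹ {Γ₁, Γ₂}` with a function: up to the adjoint action of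
`Γ⁻¹ {Γ, f}` it is given by the transpose `C` of the Lie bracket of `𝔤`. This expresses that the
moment map generates an action of the Lie algebra `𝔤`. -/
lemma hasDer_logTensor (hP : IsPoisson PM) (hρ : IsPoissonLieAction PM PG ρ)
    (hΓ : IsMomentMap PM ρ τ Γ) {f : M → ℝ} (hf : IsSmooth 𝓘(ℝ, V) f)
    (C : GroupLieAlgebra 𝓘(ℝ, F) Gs →
      GroupLieAlgebra 𝓘(ℝ, F) Gs ⊗[ℝ] GroupLieAlgebra 𝓘(ℝ, F) Gs)
    (hC : ∀ ξ ε η, contract (pairing τ ε) (pairing τ η) (C ξ) = τ ξ ⁅ε, η⁆) :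
    HasDer (IsSmooth 𝓘(ℝ, V)) (fun k => pb PM k f) (logTensor (F := F) PM Γ)
      (fun m => -C (logBracket (F := F) PM Γ f m) -
        ad₂ ℝ (logBracket (F := F) PM Γ f m) (logBracket (F := F) PM Γ f m)
          (logTensor (F := F) PM Γ m)) := by
  have : CompleteSpace F := FiniteDimensional.complete ℝ F
  have hdf := isDerivationOn_pb PM f
  refine hasDer_of_contract hdf (fun l l' => hΓ.isSmooth_logTensor hρ l l') ?_
  intro l l' m
  obtain ⟨ε, rfl⟩ := exists_pairing_eq (τ := τ) l
  obtain ⟨η, rfl⟩ := exists_pairing_eq (τ := τ) l'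
  have hdε := hρ.isDerivationOn_infAction ε
  set a : M → GroupLieAlgebra 𝓘(ℝ, F) Gs := logBracket PM Γ f with ha
  -- the `ε`-component of `L`, which is minus the logarithmic derivative `Γ⁻¹ δ_ε Γ`
  let Lε : M → GroupLieAlgebra 𝓘(ℝ, F) Gs := fun m => contractLeft (pairing τ ε) (logTensor PM Γ m)
  have hLε : ∀ (l : GroupLieAlgebra 𝓘(ℝ, F) Gs →ₗ[ℝ] ℝ) (m : M),
      l (Lε m) = contract (pairing τ ε) l (logTensor PM Γ m) := fun l m => apply_contractLeft _ _ _
  obtain ⟨L', hL'⟩ := hdf.exists_hasDer (F := Lε) fun l => by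
    simp only [hLε]; exact hΓ.isSmooth_logTensor hρ _ _
  obtain ⟨δa, hδa⟩ := hdε.exists_hasDer (F := a) fun l => hΓ.isSmooth_logBracket hρ hf l
  -- a test function whose logarithmic differential at `Γ m` is `⟨η, ·⟩`
  obtain ⟨φ, hφ, hφl⟩ := exists_isSmooth_lder_eq (Γ m) (pairing τ η)
  have hφΓ : IsSmooth 𝓘(ℝ, V) (fun x => φ (Γ x)) := hφ.comp hΓ.smooth
  obtain ⟨b, hb⟩ := (isDerivationOn_pb PM fun x => φ (Γ x)).exists_hasDer (F := a)
    fun l => hΓ.isSmooth_logBracket hρ hf l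
  obtain ⟨b', hb'⟩ := hdf.exists_hasDer (F := logBracket (F := F) PM Γ fun x => φ (Γ x))
    fun l => hΓ.isSmooth_logBracket hρ hφΓ l
  -- pairing the Maurer-Cartan equation for `f` and `φ ∘ Γ` with `ε`
  have h0 := congrArg (pairing τ ε) (logBracket_pb hP hΓ.smooth hf hφΓ hb hb' m)
  have hpa : ∀ {k : M → ℝ}, IsSmooth 𝓘(ℝ, V) k → ∀ (ζ : GroupLieAlgebra 𝓘(ℝ, E) G) x,
      pairing τ ζ (logBracket PM Γ k x) = -infAction ρ ζ k x := fun hk ζ x => by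
    rw [hΓ.infAction_eq ζ hk]; simp [pairing]
  have hcomp : ∀ {ψ : Gs → ℝ}, IsSmooth 𝓘(ℝ, F) ψ → ∀ x,
      pairing τ ε (logBracket PM Γ (fun y => ψ (Γ y)) x) = lder (Lε x) ψ (Γ x) := by
    intro ψ hψ x
    rw [apply_logBracket_comp hΓ.smooth _ hψ, ← hLε, lder_eq_diff_transL hψ, LinearMap.comp_apply]
  have hrel : ∀ ψ : Gs → ℝ, IsSmooth 𝓘(ℝ, F) ψ → ∀ x,
      infAction ρ ε (fun y => ψ (Γ y)) x = lder (-Lε x) ψ (Γ x) := by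
    intro ψ hψ x
    rw [lder_neg_left, ← hcomp hψ, hpa (k := fun y => ψ (Γ y)) (hψ.comp hΓ.smooth), neg_neg]
  -- the four terms of that equation; the second derivatives of `φ` that occur in them cancel up to
  -- a first derivative along a Lie bracket
  have h1 : pairing τ ε (logBracket PM Γ (pb PM f fun x => φ (Γ x)) m) =
      pairing τ η (δa m) - lder (Lε m) (lder (a m) φ) (Γ m) := by
    have h2 := der_lder_comp hdε hΓ.smooth hrel hδa hφ m
    have h3 : (pb PM f fun x => φ (Γ x)) = fun x => (-1) * lder (a x) φ (Γ x) := by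
      ext x
      rw [hP.antisymm, pb_comp_moment hΓ.smooth f hφ]; ring
    rw [hpa (hP.smooth _ _ hf hφΓ), h3, hdε.der_mul (isSmooth_const _) h2.1, hdε.der_const, h2.2,
      hφl (δa m), lder_neg_left]
    simp only [Pi.zero_apply]; ring
  have h2 : pairing τ ε (b m) =
      -pairing τ η (logBracket PM Γ (fun x => pairing τ ε (a x)) m) := by
    rw [← (hb (pairing τ ε)).2]
    change pb PM (fun x => pairing τ ε (a x)) (fun x => φ (Γ x)) m = _
    rw [hP.antisymm, pb_comp_moment hΓ.smooth _ hφ, hφl]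
  have h3 : pairing τ ε (b' m) = pairing τ η (L' m) + lder (a m) (lder (Lε m) φ) (Γ m) := by
    rw [← (hb' (pairing τ ε)).2]
    simp only [hcomp hφ]
    rw [(der_lder_comp hdf hΓ.smooth (fun ψ hψ x => pb_comp_moment hΓ.smooth f hψ x) hL' hφ m).2,
      hφl]
  have h4 : pairing τ ε ⁅logBracket (F := F) PM Γ (fun x => φ (Γ x)) m, a m⁆ =
      -contract (pairing τ ε ∘ₗ LieAlgebra.ad ℝ _ (a m)) (pairing τ η) (logTensor PM Γ m) := by
    have h5 := apply_logBracket_comp (PM := PM) hΓ.smooth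
      (pairing τ ε ∘ₗ (LieAlgebra.ad ℝ _ (a m) : _ →ₗ[ℝ] _)) hφ m
    have h6 : diff 𝓘(ℝ, F) φ (Γ m) ∘ₗ transL 𝓘(ℝ, F) (Γ m) = pairing τ η := by
      ext X; rw [LinearMap.comp_apply, ← lder_eq_diff_transL hφ, hφl]
    rw [h6] at h5
    rw [← h5, LinearMap.comp_apply, LieAlgebra.ad_apply, ← map_neg, lie_skew]
  have h5 := lder_comm hφ (Lε m) (a m) (Γ m)
  have h6 : pairing τ η ⁅Lε m, a m⁆ =
      -contract (pairing τ ε) (pairing τ η ∘ₗ LieAlgebra.ad ℝ _ (a m)) (logTensor PM Γ m) := by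
    rw [← hLε, LinearMap.comp_apply, LieAlgebra.ad_apply, ← map_neg, lie_skew]
  have hsε : IsSmooth 𝓘(ℝ, V) (fun x => pairing τ ε (a x)) := hΓ.isSmooth_logBracket hρ hf _
  have h7 : pairing τ η (logBracket PM Γ (fun x => pairing τ ε (a x)) m) =
      infAction ρ η (infAction ρ ε f) m := by
    have : (fun x => pairing τ ε (a x)) = fun x => (-1) * infAction ρ ε f x := by
      ext x; rw [ha, hpa hf]; ring
    have hdη := hρ.isDerivationOn_infAction η
    rw [hpa hsε, this, hdη.der_mul (isSmooth_const _) (hρ.isSmooth_infAction ε hf), hdη.der_const]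
    simp
  have h8 : pairing τ η (δa m) = -infAction ρ ε (infAction ρ η f) m := by
    have : (fun x => pairing τ η (a x)) = fun x => (-1) * infAction ρ η f x := by
      ext x; rw [ha, hpa hf]; ring
    rw [← (hδa (pairing τ η)).2, this,
      hdε.der_mul (isSmooth_const _) (hρ.isSmooth_infAction η hf), hdε.der_const]
    simp
  -- the remaining second derivatives of `f` form a commutator of infinitesimal actions
  have h9 := hρ.infAction_comm ε η hf m
  have h10 : τ (a m) ⁅ε, η⁆ = -infAction ρ ⁅ε, η⁆ f m := hpa hf _ m
  have h11 : pb PM (fun x => contract (pairing τ ε) (pairing τ η) (logTensor PM Γ x)) f m =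
      pairing τ η (L' m) := by
    rw [← (hL' (pairing τ η)).2]
    simp only [hLε]
  rw [h11, map_sub, map_neg, hC, h10, ad₂, LinearMap.add_apply, map_add, contract_map,
    contract_map, LinearMap.comp_id, LinearMap.comp_id]
  rw [hφl, h6] at h5
  rw [map_add, map_sub, h1, h2, h3, h4, h7] at h0
  linarith

end Moment

/-! ### The modified Yang-Baxter equation in tensor form -/

section YangBaxter

variable {𝕂 𝔨 : Type*} [Field 𝕂] [LieRing 𝔨] [LieAlgebra 𝕂 𝔨]

/-- Let `t` be an invariant two-tensor and `R` skew with respect to `t`. The modified classical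
Yang-Baxter equation with parameter `c ^ 2` computes the action of `(R^η X, R^ε X)` on the tensor
`((R + (η - ε) c / 2) ⊗ 1) t`, where `R^η = R + η c` and `η`, `ε` are signs: it is minus the image
of `(ad_X ⊗ 1) t` under `R^η ⊗ R^ε`. -/
lemma ad₂_kernel_of_mcybe [NeZero (2 : 𝕂)] {t : 𝔨 ⊗[𝕂] 𝔨} (ht : ∀ X : 𝔨, ad₂ 𝕂 X X t = 0)
    {R : 𝔨 →ₗ[𝕂] 𝔨}
    (hR : TensorProduct.map LinearMap.id R t = -TensorProduct.map R LinearMap.id t) {c : 𝕂}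
    (hYB : ∀ X Y : 𝔨, ⁅R X, R Y⁆ - R (⁅R X, Y⁆ + ⁅X, R Y⁆) = -(c ^ 2 • ⁅X, Y⁆))
    {η ε : 𝕂} (hη : η = 1 ∨ η = -1) (hε : ε = 1 ∨ ε = -1) (X : 𝔨) :
    ad₂ 𝕂 (R X + (η * c) • X) (R X + (ε * c) • X)
        (TensorProduct.map R LinearMap.id t + ((η - ε) / 2 * c) • t) =
      -TensorProduct.map (R + (η * c) • LinearMap.id) (R + (ε * c) • LinearMap.id)
        (TensorProduct.map (LieAlgebra.ad 𝕂 𝔨 X) LinearMap.id t) := by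
  have hneg : ∀ (A B : 𝔨 →ₗ[𝕂] 𝔨) (s : 𝔨 ⊗[𝕂] 𝔨),
      TensorProduct.map (-A) B s = -TensorProduct.map A B s := fun A B s => by
    rw [← neg_one_smul 𝕂 A, TensorProduct.map_smul_left, LinearMap.smul_apply, neg_one_smul]
  -- an operator on the second factor of `t` can be moved to the first one
  have hswap : ∀ (A B B' : 𝔨 →ₗ[𝕂] 𝔨),
      TensorProduct.map LinearMap.id B t = TensorProduct.map B' LinearMap.id t →
      TensorProduct.map A B t = TensorProduct.map (A ∘ₗ B') LinearMap.id t := fun A B B' h => by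
    have h1 : TensorProduct.map A B t =
        TensorProduct.map A LinearMap.id (TensorProduct.map LinearMap.id B t) := by
      rw [TensorProduct.map_map, LinearMap.comp_id, LinearMap.id_comp]
    rw [h1, h, TensorProduct.map_map, LinearMap.comp_id]
  have had : ∀ Y : 𝔨, TensorProduct.map LinearMap.id (LieAlgebra.ad 𝕂 𝔨 Y) t =
      TensorProduct.map (-LieAlgebra.ad 𝕂 𝔨 Y) LinearMap.id t := by
    intro Y
    have h := ht Y
    rw [ad₂, LinearMap.add_apply] at h
    rw [hneg]
    exact eq_neg_of_add_eq_zero_right h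
  have hRε : TensorProduct.map LinearMap.id (R + (ε * c) • LinearMap.id) t =
      TensorProduct.map (-R + (ε * c) • LinearMap.id) LinearMap.id t := by
    simp only [TensorProduct.map_add_left, TensorProduct.map_add_right, TensorProduct.map_smul_left,
      TensorProduct.map_smul_right, hneg, LinearMap.add_apply, LinearMap.smul_apply, hR]
  have h1 : TensorProduct.map R LinearMap.id t + ((η - ε) / 2 * c) • t =
      TensorProduct.map (R + ((η - ε) / 2 * c) • LinearMap.id) LinearMap.id t := by
    simp [TensorProduct.map_add_left, TensorProduct.map_smul_left]
  rw [h1, ad₂, LinearMap.add_apply, TensorProduct.map_map, TensorProduct.map_map,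
    TensorProduct.map_map]
  simp only [LinearMap.comp_id, LinearMap.id_comp]
  rw [hswap _ _ _ (had _), hswap _ _ _ hRε, ← hneg, ← LinearMap.add_apply,
    ← TensorProduct.map_add_left]
  congr 2
  ext Y
  have h2 := hYB X Y
  have h3 : ⁅R X, R Y⁆ = R ⁅R X, Y⁆ + R ⁅X, R Y⁆ - c ^ 2 • ⁅X, Y⁆ := by
    rw [map_add] at h2
    rw [eq_sub_iff_add_eq, ← sub_eq_zero]
    rw [← sub_eq_zero] at h2
    rw [← h2]; abel
  have h2' : (2 : 𝕂) ≠ 0 := NeZero.ne 2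
  simp only [LinearMap.add_apply, LinearMap.comp_apply, LinearMap.neg_apply, LinearMap.smul_apply,
    LinearMap.id_apply, LieAlgebra.ad_apply, map_add, map_neg, map_smul, h3]
  rcases hη with rfl | rfl <;> rcases hε with rfl | rfl <;>
  · match_scalars <;> field_simp <;> ring

end YangBaxter

/-! ### Kernels of endomorphisms with respect to the Killing form -/

section Kernel

variable {𝔤 : Type*} [LieRing 𝔤] [LieAlgebra ℝ 𝔤] [FiniteDimensional ℝ 𝔤]
  [LieAlgebra.IsKilling ℝ 𝔤]

/-- The kernel of `T` represents the bilinear form `κ(X, T Y)`. -/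
lemma contract_kernel (T : 𝔤 →ₗ[ℝ] 𝔤) (X Y : 𝔤) :
    contract (killingForm ℝ 𝔤 X) (killingForm ℝ 𝔤 Y) (kernel T) = killingForm ℝ 𝔤 X (T Y) := by
  have hn := LieAlgebra.IsKilling.killingForm_nondegenerate ℝ 𝔤
  have hY : Y = ∑ i, killingForm ℝ 𝔤 Y
      (LinearMap.BilinForm.dualBasis (killingForm ℝ 𝔤) hn (Module.finBasis ℝ 𝔤) i) •
        Module.finBasis ℝ 𝔤 i := by
    conv_lhs => rw [← (Module.finBasis ℝ 𝔤).sum_repr Y]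
    refine Finset.sum_congr rfl fun i _ => ?_
    congr 1
    conv_rhs => rw [LieModule.traceForm_comm, ← (Module.finBasis ℝ 𝔤).sum_repr Y]
    simp only [map_sum, map_smul, smul_eq_mul]
    rw [Finset.sum_eq_single i]
    · exact ((congrArg _ (LinearMap.BilinForm.apply_dualBasis_left (hB := hn)
        (b := Module.finBasis ℝ 𝔤) i i)).trans (by simp)).symm
    · intro j _ hj
      exact (congrArg _ (LinearMap.BilinForm.apply_dualBasis_left (hB := hn)
        (b := Module.finBasis ℝ 𝔤) i j)).trans (by simp [hj])
    · simp
  conv_rhs => rw [hY]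
  simp only [kernel, map_sum, contract_tmul, map_smul, smul_eq_mul]
  exact Finset.sum_congr rfl fun i _ => mul_comm _ _

lemma exists_killingForm_eq (l : 𝔤 →ₗ[ℝ] ℝ) : ∃ X, killingForm ℝ 𝔤 X = l := by
  have hn := LieAlgebra.IsKilling.killingForm_nondegenerate ℝ 𝔤
  exact ⟨(LinearMap.BilinForm.toDual _ hn).symm l, by
    ext Y; exact LinearMap.BilinForm.apply_toDual_symm_apply (hB := hn) l Y⟩

lemma ext_killingForm {s t : 𝔤 ⊗[ℝ] 𝔤}
    (h : ∀ X Y, contract (killingForm ℝ 𝔤 X) (killingForm ℝ 𝔤 Y) s =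
      contract (killingForm ℝ 𝔤 X) (killingForm ℝ 𝔤 Y) t) : s = t := by
  refine ext_contract fun a b => ?_
  obtain ⟨X, rfl⟩ := exists_killingForm_eq a
  obtain ⟨Y, rfl⟩ := exists_killingForm_eq b
  exact h X Y

lemma kernel_eq_map (T : 𝔤 →ₗ[ℝ] 𝔤) :
    kernel T = TensorProduct.map T LinearMap.id (kernel LinearMap.id) := by
  simp [kernel]

lemma kernel_splitR (R : 𝔤 →ₗ[ℝ] 𝔤) (η : ℝ) :
    kernel (splitR R η) = kernel R + η • kernel LinearMap.id := by
  rw [kernel_eq_map, kernel_eq_map R, splitR, TensorProduct.map_add_left,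
    TensorProduct.map_smul_left]
  simp

/-- The Casimir tensor is invariant. -/
lemma ad₂_kernel_id (X : 𝔤) : ad₂ ℝ X X (kernel (LinearMap.id : 𝔤 →ₗ[ℝ] 𝔤)) = 0 := by
  refine ext_killingForm fun Y Z => ?_
  have h : ∀ Y : 𝔤, killingForm ℝ 𝔤 Y ∘ₗ LieAlgebra.ad ℝ 𝔤 X = killingForm ℝ 𝔤 ⁅Y, X⁆ := by
    intro Y; ext Z
    simp only [LinearMap.comp_apply, LieAlgebra.ad_apply]
    exact (LieModule.traceForm_apply_lie_apply ℝ 𝔤 𝔤 Y X Z).symm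
  rw [ad₂, LinearMap.add_apply, map_add, contract_map, contract_map, h, h, LinearMap.comp_id,
    LinearMap.comp_id, contract_kernel, contract_kernel, map_zero, LinearMap.id_apply,
    LinearMap.id_apply, LieModule.traceForm_apply_lie_apply, ← lie_skew Z X, map_neg]
  ring

/-- Skew-symmetry of `R` says that `R` can be moved between the factors of the Casimir tensor at
the price of a sign. -/
lemma map_id_kernel_of_isSkew {R : 𝔤 →ₗ[ℝ] 𝔤} (hR : IsSkew R) :
    TensorProduct.map LinearMap.id R (kernel LinearMap.id) =
      -TensorProduct.map R LinearMap.id (kernel (LinearMap.id : 𝔤 →ₗ[ℝ] 𝔤)) := by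
  refine ext_killingForm fun Y Z => ?_
  have h : ∀ Y : 𝔤, killingForm ℝ 𝔤 Y ∘ₗ R = -killingForm ℝ 𝔤 (R Y) := by
    intro Y; ext Z
    simp [hR Y Z]
  have h' : contract (killingForm ℝ 𝔤 Y) (-killingForm ℝ 𝔤 (R Z)) (kernel LinearMap.id) =
      -killingForm ℝ 𝔤 Y (R Z) := by
    rw [← map_neg, contract_kernel]; simp
  rw [contract_map, h, map_neg, ← kernel_eq_map, contract_kernel, LinearMap.comp_id, h']

lemma comm_kernel_ad (X : 𝔤) : TensorProduct.comm ℝ 𝔤 𝔤 (kernel (LieAlgebra.ad ℝ 𝔤 X)) =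
    -kernel (LieAlgebra.ad ℝ 𝔤 X) := by
  refine ext_killingForm fun Y Z => ?_
  rw [contract_comm, map_neg, contract_kernel, contract_kernel, LieAlgebra.ad_apply,
    LieAlgebra.ad_apply, ← LieModule.traceForm_apply_lie_apply, ← lie_skew, map_neg,
    LieModule.traceForm_comm]
  rfl

lemma contract_kernel_ad (X Y Z : 𝔤) :
    contract (killingForm ℝ 𝔤 Y) (killingForm ℝ 𝔤 Z) (kernel (LieAlgebra.ad ℝ 𝔤 X)) =
      -killingForm ℝ 𝔤 X ⁅Y, Z⁆ := by
  rw [contract_kernel, LieAlgebra.ad_apply, ← lie_skew, map_neg,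
    ← LieModule.traceForm_apply_lie_apply, LieModule.traceForm_comm]

/-- The tensor form of the modified Yang-Baxter equation in the split case, `c = 1`. -/
lemma ad₂_splitR {R : 𝔤 →ₗ[ℝ] 𝔤} (hR : IsSkew R) (hYB : IsMCYBE R 1) {η ε : ℝ}
    (hη : η = 1 ∨ η = -1) (hε : ε = 1 ∨ ε = -1) (X : 𝔤) :
    ad₂ ℝ (splitR R η X) (splitR R ε X) (kernel R + ((η - ε) / 2) • kernel LinearMap.id) =
      -TensorProduct.map (splitR R η) (splitR R ε) (kernel (LieAlgebra.ad ℝ 𝔤 X)) := by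
  have h := ad₂_kernel_of_mcybe (c := (1 : ℝ)) ad₂_kernel_id (map_id_kernel_of_isSkew hR)
    (by simpa [IsMCYBE] using hYB) hη hε X
  rw [kernel_eq_map (LieAlgebra.ad ℝ 𝔤 X : 𝔤 →ₗ[ℝ] 𝔤), kernel_eq_map R]
  simpa [splitR] using h

end Kernel

/-! ### Complexification -/

section Complexification

variable {𝔤 : Type*} [LieRing 𝔤] [LieAlgebra ℝ 𝔤]

@[simp] lemma mapC_tmul {V V' W W' : Type*} [AddCommGroup V] [Module ℝ V] [AddCommGroup V']
    [Module ℝ V'] [AddCommGroup W] [Module ℝ W] [Module ℂ W] [IsScalarTower ℝ ℂ W]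
    [AddCommGroup W'] [Module ℝ W'] [Module ℂ W'] [IsScalarTower ℝ ℂ W']
    (f : V →ₗ[ℝ] W) (g : V' →ₗ[ℝ] W') (v : V) (v' : V') :
    mapC f g (v ⊗ₜ v') = f v ⊗ₜ[ℂ] g v' := rfl

lemma incl_apply (X : 𝔤) : incl X = (1 : ℂ) ⊗ₜ[ℝ] X := rfl

lemma nonSplitR_apply (R : 𝔤 →ₗ[ℝ] 𝔤) (η : ℝ) (X : 𝔤) :
    nonSplitR R η X = R.baseChange ℂ (incl X) + ((η : ℂ) * Complex.I) • incl X := by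
  simp [nonSplitR, incl_apply, TensorProduct.smul_tmul']

lemma ad_incl (X : 𝔤) :
    LieAlgebra.ad ℂ (ℂ ⊗[ℝ] 𝔤) (incl X) = (LieAlgebra.ad ℝ 𝔤 X : 𝔤 →ₗ[ℝ] 𝔤).baseChange ℂ := by
  ext Y
  simp [incl_apply]

lemma mapC_incl_map (A B : 𝔤 →ₗ[ℝ] 𝔤) (t : 𝔤 ⊗[ℝ] 𝔤) :
    mapC incl incl (TensorProduct.map A B t) =
      TensorProduct.map (A.baseChange ℂ) (B.baseChange ℂ) (mapC incl incl t) := by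
  induction t with
  | zero => simp
  | tmul => simp [incl_apply]
  | add x y hx hy => simp only [map_add, hx, hy]

lemma mapC_nonSplitR (R : 𝔤 →ₗ[ℝ] 𝔤) (η ε : ℝ) (t : 𝔤 ⊗[ℝ] 𝔤) :
    mapC (nonSplitR R η) (nonSplitR R ε) t =
      TensorProduct.map (R.baseChange ℂ + ((η : ℂ) * Complex.I) • LinearMap.id)
        (R.baseChange ℂ + ((ε : ℂ) * Complex.I) • LinearMap.id) (mapC incl incl t) := by
  induction t with
  | zero => simp
  | tmul => simp only [mapC_tmul, nonSplitR_apply, TensorProduct.map_tmul, LinearMap.add_apply,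
      LinearMap.smul_apply, LinearMap.id_apply]
  | add x y hx hy => simp only [map_add, hx, hy]

lemma mapC_incl_injective [FiniteDimensional ℝ 𝔤] :
    Function.Injective (mapC (incl (𝔤 := 𝔤)) (incl (𝔤 := 𝔤))) := by
  intro s t hst
  refine ext_contract fun a b => ?_
  have h : ∀ t : 𝔤 ⊗[ℝ] 𝔤, TensorProduct.lid ℂ ℂ (TensorProduct.map
      ((TensorProduct.AlgebraTensorModule.rid ℝ ℂ ℂ).toLinearMap ∘ₗ a.baseChange ℂ)
      ((TensorProduct.AlgebraTensorModule.rid ℝ ℂ ℂ).toLinearMap ∘ₗ b.baseChange ℂ)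
      (mapC incl incl t)) = (contract a b t : ℂ) := by
    intro t
    induction t with
    | zero => simp
    | tmul => simp [incl_apply]
    | add x y hx hy => simp only [map_add, hx, hy, Complex.ofReal_add]
  exact_mod_cast (h s).symm.trans ((congrArg _ (congrArg _ hst)).trans (h t))

/-- The complex linear extension of `R` satisfies the modified Yang-Baxter equation with `c = i`. -/
lemma baseChange_mcybe {R : 𝔤 →ₗ[ℝ] 𝔤} (hYB : IsMCYBE R (-1)) (X Y : ℂ ⊗[ℝ] 𝔤) :
    LieAlgebra.ad ℂ (ℂ ⊗[ℝ] 𝔤) (R.baseChange ℂ X) (R.baseChange ℂ Y) -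
      R.baseChange ℂ (LieAlgebra.ad ℂ (ℂ ⊗[ℝ] 𝔤) (R.baseChange ℂ X) Y +
        LieAlgebra.ad ℂ (ℂ ⊗[ℝ] 𝔤) X (R.baseChange ℂ Y)) =
      -(Complex.I ^ 2 • LieAlgebra.ad ℂ (ℂ ⊗[ℝ] 𝔤) X Y) := by
  induction X with
  | zero => simp
  | add X X' hX hX' =>
    simp only [map_add, LinearMap.add_apply, smul_add, neg_add] at *
    rw [← hX, ← hX']; abel
  | tmul z X =>
    induction Y with
    | zero => simp
    | add Y Y' hY hY' =>
      simp only [map_add, smul_add, neg_add] at *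
      rw [← hY, ← hY']; abel
    | tmul w Y =>
      have h := hYB X Y
      have hb : ∀ X Y : 𝔤, LieAlgebra.ad ℂ (ℂ ⊗[ℝ] 𝔤) (z ⊗ₜ X) (w ⊗ₜ Y) = (z * w) ⊗ₜ ⁅X, Y⁆ :=
        fun X Y => LieAlgebra.ExtendScalars.bracket_tmul ℝ ℂ 𝔤 𝔤 z w X Y
      simp only [LinearMap.baseChange_tmul, hb, ← TensorProduct.tmul_add, ← TensorProduct.tmul_sub]
      rw [h]
      simp

variable [FiniteDimensional ℝ 𝔤] [LieAlgebra.IsKilling ℝ 𝔤]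

/-- The tensor form of the modified Yang-Baxter equation in the non-split case, `c = i`. -/
lemma ad₂_nonSplitR {R : 𝔤 →ₗ[ℝ] 𝔤} (hR : IsSkew R) (hYB : IsMCYBE R (-1)) {η ε : ℝ}
    (hη : η = 1 ∨ η = -1) (hε : ε = 1 ∨ ε = -1) (X : 𝔤) :
    ad₂ ℂ (nonSplitR R η X) (nonSplitR R ε X) (mapC incl incl (kernel R) +
        (((η - ε) / 2 : ℝ) * Complex.I) • mapC incl incl (kernel LinearMap.id)) =
      -mapC (nonSplitR R η) (nonSplitR R ε) (kernel (LieAlgebra.ad ℝ 𝔤 X)) := by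
  set t := mapC incl incl (kernel (LinearMap.id : 𝔤 →ₗ[ℝ] 𝔤)) with ht
  have hid : ∀ A : 𝔤 →ₗ[ℝ] 𝔤, mapC incl incl (kernel A) =
      TensorProduct.map (A.baseChange ℂ) LinearMap.id t := fun A => by
    rw [kernel_eq_map, mapC_incl_map, LinearMap.baseChange_id]
  have hinv : ∀ X, ad₂ ℂ X X t = 0 := by
    intro X
    induction X with
    | zero => simp [ad₂, TensorProduct.map_zero_left, TensorProduct.map_zero_right]
    | add X Y hX hY =>
      have h : ad₂ ℂ (X + Y) (X + Y) = ad₂ ℂ X X + ad₂ ℂ Y Y := by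
        simp only [ad₂, map_add, TensorProduct.map_add_left, TensorProduct.map_add_right]
        abel
      rw [h, LinearMap.add_apply, hX, hY, add_zero]
    | tmul z X =>
      have hz : z ⊗ₜ[ℝ] X = z • incl X := by simp [incl_apply, TensorProduct.smul_tmul']
      have h : ad₂ ℂ (z ⊗ₜ[ℝ] X) (z ⊗ₜ[ℝ] X) = z • ad₂ ℂ (incl X) (incl X) := by
        simp only [hz, ad₂, map_smul, TensorProduct.map_smul_left, TensorProduct.map_smul_right,
          smul_add]
      have h1 := congrArg (mapC incl incl) (ad₂_kernel_id X)
      rw [ad₂, LinearMap.add_apply, map_add, mapC_incl_map, mapC_incl_map, map_zero,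
        LinearMap.baseChange_id, ← ad_incl] at h1
      rw [h, LinearMap.smul_apply, ad₂, LinearMap.add_apply, h1, smul_zero]
  have hskew : TensorProduct.map LinearMap.id (R.baseChange ℂ) t =
      -TensorProduct.map (R.baseChange ℂ) LinearMap.id t := by
    have h1 := congrArg (mapC incl incl) (map_id_kernel_of_isSkew hR)
    rwa [map_neg, mapC_incl_map, mapC_incl_map, LinearMap.baseChange_id] at h1
  have h := ad₂_kernel_of_mcybe (c := Complex.I) hinv hskew (baseChange_mcybe hYB)
    (η := (η : ℂ)) (ε := (ε : ℂ)) (by exact_mod_cast hη) (by exact_mod_cast hε) (incl X)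
  rw [mapC_nonSplitR, hid, hid (LieAlgebra.ad ℝ 𝔤 X : 𝔤 →ₗ[ℝ] 𝔤), ← ad_incl,
    nonSplitR_apply, nonSplitR_apply]
  push_cast
  exact h

end Complexification

/-! ### Leibniz rules for linear maps and tensor products -/

section Leibniz

variable {X : Type*} {S : (X → ℝ) → Prop} {d : (X → ℝ) → X → ℝ}

lemma HasDer.congr_deriv {W : Type*} [AddCommGroup W] [Module ℝ W] {F F' F'' : X → W}
    (h : HasDer S d F F') (h' : ∀ x, F' x = F'' x) : HasDer S d F F'' := funext h' ▸ h

/-- The Leibniz rule for the evaluation of a family of linear maps on a vector-valued function. -/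
lemma IsDerivationOn.hasDer_apply {W W₁ : Type*} [AddCommGroup W] [Module ℝ W]
    [FiniteDimensional ℝ W] [AddCommGroup W₁] [Module ℝ W₁] [FiniteDimensional ℝ W₁]
    (hd : IsDerivationOn S d) {T T' : X → W →ₗ[ℝ] W₁} {u u' : X → W}
    (hT : ∀ w, HasDer S d (fun x => T x w) (fun x => T' x w)) (hu : HasDer S d u u') :
    HasDer S d (fun x => T x (u x)) (fun x => T' x (u x) + T x (u' x)) := by
  let b := Module.finBasis ℝ W
  have hb : ∀ (A : W →ₗ[ℝ] W₁) (w : W), A w = ∑ i, b.coord i w • A (b i) := by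
    intro A w
    conv_lhs => rw [← b.sum_repr w]
    simp only [map_sum, map_smul, Module.Basis.coord_apply]
  have h := hd.hasDer_sum Finset.univ fun i _ =>
    hd.hasDer_bilin (hu.linear (b.coord i)) (hT (b i)) (LinearMap.lsmul ℝ W₁)
  simp only [LinearMap.lsmul_apply, Finset.sum_add_distrib, ← hb] at h
  simpa only [add_comm] using h

variable {𝕂 : Type*} [Field 𝕂] [Algebra ℝ 𝕂] {W W₁ : Type*}
  [AddCommGroup W] [Module 𝕂 W] [Module ℝ W] [IsScalarTower ℝ 𝕂 W]
  [AddCommGroup W₁] [Module 𝕂 W₁] [Module ℝ W₁] [IsScalarTower ℝ 𝕂 W₁]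

/-- The real bilinear map `(v, w) ↦ v ⊗ w` to a tensor product over a larger field. -/
def tmulReal (𝕂 W W₁ : Type*) [Field 𝕂] [Algebra ℝ 𝕂]
    [AddCommGroup W] [Module 𝕂 W] [Module ℝ W] [IsScalarTower ℝ 𝕂 W]
    [AddCommGroup W₁] [Module 𝕂 W₁] [Module ℝ W₁] [IsScalarTower ℝ 𝕂 W₁] :
    W →ₗ[ℝ] W₁ →ₗ[ℝ] W ⊗[𝕂] W₁ :=
  LinearMap.mk₂ ℝ (fun v w => v ⊗ₜ[𝕂] w) (fun _ _ _ => TensorProduct.add_tmul _ _ _)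
    (fun _ _ _ => (TensorProduct.smul_tmul' _ _ _).symm) (fun _ _ _ => TensorProduct.tmul_add _ _ _)
    (fun c v w => by
      rw [← algebraMap_smul 𝕂 c w, TensorProduct.tmul_smul, algebraMap_smul])

/-- The Leibniz rule for the tensor product of two families of linear maps. -/
lemma IsDerivationOn.hasDer_map [FiniteDimensional ℝ W] [FiniteDimensional ℝ W₁]
    (hd : IsDerivationOn S d) {A A' : X → W →ₗ[𝕂] W} {B B' : X → W₁ →ₗ[𝕂] W₁}
    (hA : ∀ w, HasDer S d (fun x => A x w) (fun x => A' x w))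
    (hB : ∀ w, HasDer S d (fun x => B x w) (fun x => B' x w)) (t : W ⊗[𝕂] W₁) :
    HasDer S d (fun x => TensorProduct.map (A x) (B x) t)
      (fun x => TensorProduct.map (A' x) (B x) t + TensorProduct.map (A x) (B' x) t) := by
  induction t with
  | zero => simpa using hd.hasDer_const (0 : W ⊗[𝕂] W₁)
  | tmul v w => exact hd.hasDer_bilin (hA v) (hB w) (tmulReal 𝕂 W W₁)
  | add s t hs ht =>
    simp only [map_add]
    convert hd.hasDer_add hs ht using 2
    abel

end Leibniz

/-! ### Primitives of cocycles on the dual group -/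

section Primitive

variable {F Gs : Type*} [NormedAddCommGroup F] [NormedSpace ℝ F] [FiniteDimensional ℝ F]
  [TopologicalSpace Gs] [ChartedSpace F Gs] [Group Gs] [LieGroup 𝓘(ℝ, F) ∞ Gs]

/-- On a connected group a function whose left-invariant derivatives vanish is constant. -/
lemma eq_of_hasDer_lder_zero [PreconnectedSpace Gs] {W : Type*} [AddCommGroup W] [Module ℝ W]
    {Φ : Gs → W}
    (h : ∀ ξ : GroupLieAlgebra 𝓘(ℝ, F) Gs, HasDer (IsSmooth 𝓘(ℝ, F)) (lder ξ) Φ fun _ => 0)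
    (g k : Gs) : Φ g = Φ k := by
  rw [← sub_eq_zero, ← Module.forall_dual_apply_eq_zero_iff ℝ]
  intro l
  rw [map_sub, sub_eq_zero]
  refine eq_of_diff_eq_zero (E := F) (f := fun x => l (Φ x)) (h 0 l).1 (fun x => ?_) g k
  ext v
  have h1 := (h (transLInv 𝓘(ℝ, F) x v) l).2 x
  rw [lder_eq_diff_transL (h 0 l).1, transL_transLInv, map_zero] at h1
  exact h1

/-- `Ad ⊗ Ad` satisfies the differential equation of a representation with differential
`ad ⊗ 1 + 1 ⊗ ad`. -/
lemma hasDer_map_Ad [T2Space Gs] (ξ : GroupLieAlgebra 𝓘(ℝ, F) Gs)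
    (t : GroupLieAlgebra 𝓘(ℝ, F) Gs ⊗[ℝ] GroupLieAlgebra 𝓘(ℝ, F) Gs) :
    HasDer (IsSmooth 𝓘(ℝ, F)) (lder ξ)
      (fun g : Gs => TensorProduct.map (Ad 𝓘(ℝ, F) g) (Ad 𝓘(ℝ, F) g) t)
      (fun g => TensorProduct.map (Ad 𝓘(ℝ, F) g) (Ad 𝓘(ℝ, F) g) (ad₂ ℝ ξ ξ t)) := by
  have : FiniteDimensional ℝ (GroupLieAlgebra 𝓘(ℝ, F) Gs) :=
    inferInstanceAs (FiniteDimensional ℝ F)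
  have h := (isDerivationOn_lder ξ).hasDer_map (𝕂 := ℝ)
    (A := fun g : Gs => Ad 𝓘(ℝ, F) g) (A' := fun g => Ad 𝓘(ℝ, F) g ∘ₗ LieAlgebra.ad ℝ _ ξ)
    (B := fun g : Gs => Ad 𝓘(ℝ, F) g) (B' := fun g => Ad 𝓘(ℝ, F) g ∘ₗ LieAlgebra.ad ℝ _ ξ)
    (fun w => hasDer_Ad ξ w) (fun w => hasDer_Ad ξ w) t
  refine h.congr_deriv fun g => ?_
  simp only [ad₂, LinearMap.add_apply, map_add, TensorProduct.map_map, LinearMap.comp_id]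

/-- Let `C` be a skew map from the Lie algebra to its tensor square. If the images of the one-form
`-(Ad ⊗ Ad) C` under a jointly injective family of linear maps have primitives that vanish at `1`,
then this one-form has itself a primitive, which is skew-symmetric. -/
lemma exists_primitive [PreconnectedSpace Gs]
    {C : GroupLieAlgebra 𝓘(ℝ, F) Gs →
      GroupLieAlgebra 𝓘(ℝ, F) Gs ⊗[ℝ] GroupLieAlgebra 𝓘(ℝ, F) Gs}
    (hC : ∀ ξ, TensorProduct.comm ℝ _ _ (C ξ) = -C ξ)
    {ι U : Type*} [Fintype ι] [AddCommGroup U] [Module ℝ U]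
    (J : ι → GroupLieAlgebra 𝓘(ℝ, F) Gs ⊗[ℝ] GroupLieAlgebra 𝓘(ℝ, F) Gs →ₗ[ℝ] U) (w : ι → ℝ)
    (hJ : Function.Injective (∑ i, w i • J i : _ →ₗ[ℝ] U)) (K : ι → Gs → U)
    (hK : ∀ i ξ, HasDer (IsSmooth 𝓘(ℝ, F)) (lder ξ) (K i)
      fun g => -J i (TensorProduct.map (Ad 𝓘(ℝ, F) g) (Ad 𝓘(ℝ, F) g) (C ξ)))
    (hK1 : ∀ i, K i 1 = 0) :
    ∃ Q : Gs → GroupLieAlgebra 𝓘(ℝ, F) Gs ⊗[ℝ] GroupLieAlgebra 𝓘(ℝ, F) Gs,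
      (∀ ξ, HasDer (IsSmooth 𝓘(ℝ, F)) (lder ξ) Q
        fun g => -TensorProduct.map (Ad 𝓘(ℝ, F) g) (Ad 𝓘(ℝ, F) g) (C ξ)) ∧
      (∀ i g, J i (Q g) = K i g) ∧ ∀ g, TensorProduct.comm ℝ _ _ (Q g) = -Q g := by
  -- a left inverse of the weighted sum recovers the primitive from its images
  obtain ⟨p, hp⟩ := LinearMap.exists_leftInverse_of_injective _ (LinearMap.ker_eq_bot.2 hJ)
  let Q : Gs → GroupLieAlgebra 𝓘(ℝ, F) Gs ⊗[ℝ] GroupLieAlgebra 𝓘(ℝ, F) Gs :=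
    fun g => p (∑ i, w i • K i g)
  have hQ : ∀ ξ, HasDer (IsSmooth 𝓘(ℝ, F)) (lder ξ) Q
      fun g => -TensorProduct.map (Ad 𝓘(ℝ, F) g) (Ad 𝓘(ℝ, F) g) (C ξ) := by
    intro ξ
    have h := ((isDerivationOn_lder ξ).hasDer_sum Finset.univ fun i _ =>
      (hK i ξ).linear (w i • LinearMap.id)).linear p
    refine h.congr_deriv fun g => ?_
    have h1 := LinearMap.congr_fun hp
      (TensorProduct.map (Ad 𝓘(ℝ, F) g) (Ad 𝓘(ℝ, F) g) (C ξ))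
    rw [LinearMap.comp_apply, LinearMap.id_apply] at h1
    conv_rhs => rw [← h1]
    simp [LinearMap.sum_apply]
  have hQ1 : Q 1 = 0 := by simp [Q, hK1]
  refine ⟨Q, hQ, fun i g => ?_, fun g => ?_⟩
  · have h : J i (Q g) - K i g = J i (Q 1) - K i 1 := by
      refine eq_of_hasDer_lder_zero (F := F) (Φ := fun g => J i (Q g) - K i g) (fun ξ => ?_) g 1
      exact ((isDerivationOn_lder ξ).hasDer_sub ((hQ ξ).linear (J i)) (hK i ξ)).congr_deriv
        fun g => by simp
    rw [hQ1, hK1, map_zero, sub_zero] at h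
    exact sub_eq_zero.1 h
  · have h : TensorProduct.comm ℝ _ _ (Q g) + Q g = TensorProduct.comm ℝ _ _ (Q 1) + Q 1 := by
      refine eq_of_hasDer_lder_zero (F := F)
        (Φ := fun g => TensorProduct.comm ℝ _ _ (Q g) + Q g) (fun ξ => ?_) g 1
      refine ((isDerivationOn_lder ξ).hasDer_add
        ((hQ ξ).linear (TensorProduct.comm ℝ _ _).toLinearMap) (hQ ξ)).congr_deriv fun g => ?_
      rw [LinearEquiv.coe_coe, map_neg, ← TensorProduct.map_comm, hC, map_neg]
      simp
    rw [hQ1, map_zero, add_zero] at h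
    exact eq_neg_of_add_eq_zero_left h

/-- Let `A` and `B` be representations of the group by automorphisms of a Lie algebra `𝔨`, with
differentials `ad ∘ j` and `ad ∘ k`. Then the coboundary `r - (A ⊗ B) r` of a tensor `r` is a
primitive of `-(j ⊗ k) (Ad ⊗ Ad) C`, provided that `C` is related to the action on `r`. -/
lemma hasDer_coboundary {𝕂 𝔨 : Type*} [Field 𝕂] [Algebra ℝ 𝕂] [LieRing 𝔨] [LieAlgebra 𝕂 𝔨]
    [Module ℝ 𝔨] [IsScalarTower ℝ 𝕂 𝔨] [FiniteDimensional ℝ 𝔨]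
    {j k : GroupLieAlgebra 𝓘(ℝ, F) Gs →ₗ[ℝ] 𝔨} {A B : Gs → 𝔨 →ₗ[𝕂] 𝔨}
    (hA : ∀ ξ x, HasDer (IsSmooth 𝓘(ℝ, F)) (lder ξ) (fun g => A g x)
      fun g => A g (LieAlgebra.ad 𝕂 𝔨 (j ξ) x))
    (hB : ∀ ξ x, HasDer (IsSmooth 𝓘(ℝ, F)) (lder ξ) (fun g => B g x)
      fun g => B g (LieAlgebra.ad 𝕂 𝔨 (k ξ) x))
    (hAj : ∀ g ξ, A g (j ξ) = j (Ad 𝓘(ℝ, F) g ξ)) (hBk : ∀ g ξ, B g (k ξ) = k (Ad 𝓘(ℝ, F) g ξ))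
    {J : GroupLieAlgebra 𝓘(ℝ, F) Gs ⊗[ℝ] GroupLieAlgebra 𝓘(ℝ, F) Gs →ₗ[ℝ] 𝔨 ⊗[𝕂] 𝔨}
    (hJ : ∀ ξ ζ, J (ξ ⊗ₜ ζ) = j ξ ⊗ₜ k ζ) {r : 𝔨 ⊗[𝕂] 𝔨} {γ : ℝ}
    {C : GroupLieAlgebra 𝓘(ℝ, F) Gs →
      GroupLieAlgebra 𝓘(ℝ, F) Gs ⊗[ℝ] GroupLieAlgebra 𝓘(ℝ, F) Gs}
    (hr : ∀ ξ, γ • ad₂ 𝕂 (j ξ) (k ξ) r = J (C ξ)) (ξ : GroupLieAlgebra 𝓘(ℝ, F) Gs) :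
    HasDer (IsSmooth 𝓘(ℝ, F)) (lder ξ) (fun g => γ • (r - TensorProduct.map (A g) (B g) r))
      fun g => -J (TensorProduct.map (Ad 𝓘(ℝ, F) g) (Ad 𝓘(ℝ, F) g) (C ξ)) := by
  have hd := isDerivationOn_lder (G := Gs) ξ
  have h := (hd.hasDer_sub (hd.hasDer_const r) (hd.hasDer_map
    (A' := fun g => A g ∘ₗ LieAlgebra.ad 𝕂 𝔨 (j ξ)) (B' := fun g => B g ∘ₗ LieAlgebra.ad 𝕂 𝔨 (k ξ))
    (hA ξ) (hB ξ) r)).linear (γ • LinearMap.id)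
  refine h.congr_deriv fun g => ?_
  have hJAd : ∀ t, J (TensorProduct.map (Ad 𝓘(ℝ, F) g) (Ad 𝓘(ℝ, F) g) t) =
      TensorProduct.map (A g) (B g) (J t) := by
    intro t
    induction t with
    | zero => simp
    | tmul => simp [hJ, hAj, hBk]
    | add x y hx hy => simp only [map_add, hx, hy]
  have hreal : ∀ t : 𝔨 ⊗[𝕂] 𝔨, TensorProduct.map (A g) (B g) (γ • t) =
      γ • TensorProduct.map (A g) (B g) t := fun t => by
    rw [← algebraMap_smul 𝕂 γ t, map_smul, algebraMap_smul]
  rw [hJAd, ← hr, hreal]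
  simp only [ad₂, LinearMap.add_apply, map_add, TensorProduct.map_map,
    LinearMap.comp_id, LinearMap.smul_apply, LinearMap.id_apply, zero_sub, smul_neg]

end Primitive

/-! ### The central tensor -/

section Central

variable {E G : Type*} [NormedAddCommGroup E] [NormedSpace ℝ E] [FiniteDimensional ℝ E]
  [TopologicalSpace G] [ChartedSpace E G] [Group G] [LieGroup 𝓘(ℝ, E) ∞ G]
  {F Gs : Type*} [NormedAddCommGroup F] [NormedSpace ℝ F] [FiniteDimensional ℝ F]
  [TopologicalSpace Gs] [ChartedSpace F Gs] [Group Gs] [LieGroup 𝓘(ℝ, F) ∞ Gs]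
  {V M : Type*} [NormedAddCommGroup V] [NormedSpace ℝ V]
  [TopologicalSpace M] [ChartedSpace V M]
  {PM : TensorField 𝓘(ℝ, V) M} {Γ : M → Gs} {ρ : M → G → M}
  {τ : GroupLieAlgebra 𝓘(ℝ, F) Gs ≃ₗ[ℝ] Module.Dual ℝ (GroupLieAlgebra 𝓘(ℝ, E) G)}
  {PG : TensorField 𝓘(ℝ, E) G}

/-- The chain rule for vector-valued functions of the moment map. -/
lemma hasDer_comp_moment (hΓ : ContMDiff 𝓘(ℝ, V) 𝓘(ℝ, F) ∞ Γ) (f : M → ℝ)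
    {W : Type*} [AddCommGroup W] [Module ℝ W] {Φ : Gs → W}
    {Φ' : GroupLieAlgebra 𝓘(ℝ, F) Gs → Gs → W}
    (hΦ : ∀ ξ, HasDer (IsSmooth 𝓘(ℝ, F)) (lder ξ) Φ (Φ' ξ)) :
    HasDer (IsSmooth 𝓘(ℝ, V)) (fun k => pb PM k f) (fun m => Φ (Γ m))
      (fun m => Φ' (logBracket (F := F) PM Γ f m) (Γ m)) := fun l =>
  ⟨(hΦ 0 l).1.comp hΓ, fun m => by
    exact (pb_comp_moment hΓ f (φ := fun g => l (Φ g)) (hΦ 0 l).1 m).trans ((hΦ _ l).2 _)⟩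

variable [IsManifold 𝓘(ℝ, V) ∞ M] [T2Space Gs]

/-- The failure of the moment map to be Poisson for the multiplicative bracket on the dual group
that is given by `Q` Poisson commutes with all functions: along `Γ`, the tensor `Q` satisfies the
same differential equation as the right-translated bracket of `Γ` with itself. -/
lemma isCentral_of_primitive (hP : IsPoisson PM) (hρ : IsPoissonLieAction PM PG ρ)
    (hΓ : IsMomentMap PM ρ τ Γ)
    {C : GroupLieAlgebra 𝓘(ℝ, F) Gs →
      GroupLieAlgebra 𝓘(ℝ, F) Gs ⊗[ℝ] GroupLieAlgebra 𝓘(ℝ, F) Gs}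
    (hC : ∀ ξ ε η, contract (pairing τ ε) (pairing τ η) (C ξ) = τ ξ ⁅ε, η⁆)
    {Q : Gs → GroupLieAlgebra 𝓘(ℝ, F) Gs ⊗[ℝ] GroupLieAlgebra 𝓘(ℝ, F) Gs}
    (hQ : ∀ ξ, HasDer (IsSmooth 𝓘(ℝ, F)) (lder ξ) Q
      fun g => -TensorProduct.map (Ad 𝓘(ℝ, F) g) (Ad 𝓘(ℝ, F) g) (C ξ)) :
    IsCentral PM fun m => TensorProduct.map (Ad 𝓘(ℝ, F) (Γ m)) (Ad 𝓘(ℝ, F) (Γ m))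
      (logTensor (F := F) PM Γ m) - Q (Γ m) := by
  have : FiniteDimensional ℝ (GroupLieAlgebra 𝓘(ℝ, F) Gs) :=
    inferInstanceAs (FiniteDimensional ℝ F)
  have key : ∀ f, IsSmooth 𝓘(ℝ, V) f → HasDer (IsSmooth 𝓘(ℝ, V)) (fun k => pb PM k f)
      (fun m => TensorProduct.map (Ad 𝓘(ℝ, F) (Γ m)) (Ad 𝓘(ℝ, F) (Γ m))
        (logTensor (F := F) PM Γ m) - Q (Γ m)) fun _ => 0 := by
    intro f hf
    have hd := isDerivationOn_pb PM f
    have h1 := hd.hasDer_apply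
      (T := fun m => TensorProduct.map (Ad 𝓘(ℝ, F) (Γ m)) (Ad 𝓘(ℝ, F) (Γ m)))
      (T' := fun m => TensorProduct.map (Ad 𝓘(ℝ, F) (Γ m)) (Ad 𝓘(ℝ, F) (Γ m)) ∘ₗ
        ad₂ ℝ (logBracket (F := F) PM Γ f m) (logBracket (F := F) PM Γ f m))
      (fun t => hasDer_comp_moment hΓ.smooth f (fun ξ => hasDer_map_Ad ξ t))
      (hasDer_logTensor hP hρ hΓ hf C hC)
    have h2 := hd.hasDer_sub h1 (hasDer_comp_moment hΓ.smooth f hQ)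
    refine h2.congr_deriv fun m => ?_
    simp only [LinearMap.comp_apply, map_sub, map_neg]
    abel
  intro l
  refine ⟨(key (fun _ => 0) (isSmooth_const 0) l).1, fun f hf => ?_⟩
  ext m
  exact ((key f hf l).2 m).trans (map_zero l)

lemma comm_logTensor (hP : IsPoisson PM) (m : M) :
    TensorProduct.comm ℝ _ _ (logTensor (F := F) PM Γ m) = -logTensor (F := F) PM Γ m := by
  rw [logTensor, ← TensorProduct.map_comm, hP.skew, map_neg]

end Central

/-! ### Composition of the moment map with group homomorphisms -/

section Hom

variable {F Gs : Type*} [NormedAddCommGroup F] [NormedSpace ℝ F] [FiniteDimensional ℝ F]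
  [TopologicalSpace Gs] [ChartedSpace F Gs] [Group Gs] [LieGroup 𝓘(ℝ, F) ∞ Gs]

/-- The image of a connected group under a homomorphism is contained in the integral subgroup of any
set which contains the image of the differential. -/
lemma hom_mem_integralSubgroup [PreconnectedSpace Gs] {E' H' G' : Type*} [NormedAddCommGroup E']
    [NormedSpace ℝ E'] [TopologicalSpace H'] {I' : ModelWithCorners ℝ E' H'} [TopologicalSpace G']
    [ChartedSpace H' G'] [Group G'] [LieGroup I' 1 G'] {D : Gs →* G'}
    (hD : ContMDiff 𝓘(ℝ, F) I' ∞ D) {𝔥 : Set (GroupLieAlgebra I' G')}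
    (h : ∀ ξ, homDiff 𝓘(ℝ, F) I' D ξ ∈ 𝔥) (g : Gs) : D g ∈ integralSubgroup I' 𝔥 := by
  have : IsTopologicalGroup Gs := topologicalGroup_of_lieGroup 𝓘(ℝ, F) ∞
  let K : Subgroup Gs := (integralSubgroup I' 𝔥).comap D
  have hDd : MDifferentiable 𝓘(ℝ, F) I' D := hD.mdifferentiable (by simp)
  -- in a connected group a subgroup that is a neighbourhood of `1` is everything
  suffices hK : (K : Set Gs) ∈ nhds (1 : Gs) by
    have hopen : IsOpen (K : Set Gs) := Subgroup.isOpen_of_mem_nhds K hK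
    have hclosed : IsClosed (K : Set Gs) := Subgroup.isClosed_of_isOpen K hopen
    have huniv : (K : Set Gs) = Set.univ :=
      IsClopen.eq_univ ⟨hclosed, hopen⟩ ⟨1, K.one_mem⟩
    have hg : g ∈ (K : Set Gs) := huniv ▸ Set.mem_univ g
    exact hg
  set e := extChartAt 𝓘(ℝ, F) (1 : Gs) with he
  obtain ⟨r, hr, hball⟩ := Metric.mem_nhds_iff.1
    (extChartAt_target_mem_nhds (I := 𝓘(ℝ, F)) (1 : Gs))
  have h1 : e.source ∈ nhds (1 : Gs) := extChartAt_source_mem_nhds (I := 𝓘(ℝ, F)) (1 : Gs)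
  have h2 : e ⁻¹' Metric.ball (e 1) r ∈ nhds (1 : Gs) :=
    (continuousAt_extChartAt (I := 𝓘(ℝ, F)) (1 : Gs)).preimage_mem_nhds (Metric.ball_mem_nhds _ hr)
  filter_upwards [h1, h2] with x hx hxr
  -- the segment from `e 1` to `e x`, reparametrised so that it is defined for all times
  let c : ℝ → F := fun t => e 1 + Real.smoothTransition t • (e x - e 1)
  have hc : ContDiff ℝ ∞ c :=
    contDiff_const.add (Real.smoothTransition.contDiff.smul contDiff_const)
  have hct : ∀ t, c t ∈ e.target := by
    intro t
    refine hball ?_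
    rw [Metric.mem_ball, dist_eq_norm]
    have h3 : c t - e 1 = Real.smoothTransition t • (e x - e 1) := by simp [c]
    rw [h3, norm_smul, Real.norm_of_nonneg (Real.smoothTransition.nonneg t)]
    have h4 : ‖e x - e 1‖ < r := by rwa [← dist_eq_norm]
    exact (mul_le_of_le_one_left (norm_nonneg _) (Real.smoothTransition.le_one t)).trans_lt h4
  let a : ℝ → Gs := fun t => e.symm (c t)
  have ha : ContMDiff 𝓘(ℝ, ℝ) 𝓘(ℝ, F) ∞ a := by
    have h3 := (contMDiffOn_extChartAt_symm (I := 𝓘(ℝ, F)) (n := ∞) (1 : Gs)).comp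
      (hc.contMDiff.contMDiffOn (s := Set.univ)) fun t _ => hct t
    exact contMDiffOn_univ.1 h3
  refine Subgroup.subset_closure ⟨fun t => D (a t), hD.comp ha, ?_, ?_, fun t => ?_⟩
  · have : a 0 = 1 := by
      simp only [a, c, Real.smoothTransition.zero, zero_smul, add_zero]
      exact extChartAt_to_inv (I := 𝓘(ℝ, F)) (1 : Gs)
    simp only [this, map_one]
  · have : a 1 = x := by
      simp only [a, c, Real.smoothTransition.one, one_smul, add_sub_cancel]
      exact e.left_inv hx
    simp only [this]
  · refine ⟨_, h (transLInv 𝓘(ℝ, F) (a t) (mfderiv 𝓘(ℝ, ℝ) 𝓘(ℝ, F) a t (1 : ℝ))), ?_⟩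
    rw [← mfderiv_hom_transL hDd, transL_transLInv]
    exact congrArg (fun T : ℝ →L[ℝ] E' => T 1)
      (mfderiv_comp (I' := 𝓘(ℝ, F)) t (hDd (a t)) (ha.mdifferentiable (by simp) t))

variable {E' G' : Type*} [NormedAddCommGroup E'] [NormedSpace ℝ E'] [FiniteDimensional ℝ E']
  [TopologicalSpace G'] [ChartedSpace E' G'] [Group G'] [LieGroup 𝓘(ℝ, E') ∞ G']

lemma lder_comp_hom {D : Gs →* G'} (hD : ContMDiff 𝓘(ℝ, F) 𝓘(ℝ, E') ∞ D)
    (ξ : GroupLieAlgebra 𝓘(ℝ, F) Gs) {φ : G' → ℝ} (hφ : IsSmooth 𝓘(ℝ, E') φ) (g : Gs) :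
    lder ξ (fun h => φ (D h)) g = lder (homDiff 𝓘(ℝ, F) 𝓘(ℝ, E') D ξ) φ (D g) := by
  have hDd : MDifferentiable 𝓘(ℝ, F) 𝓘(ℝ, E') D := hD.mdifferentiable (by simp)
  rw [lder_eq_diff_transL (φ := fun h => φ (D h)) (hφ.comp hD), lder_eq_diff_transL hφ,
    ← mfderiv_hom_transL hDd,
    diff_comp g (hφ.mdifferentiableAt _) (hDd g)]
  rfl

lemma hasDer_Ad_hom [T2Space G'] {D : Gs →* G'} (hD : ContMDiff 𝓘(ℝ, F) 𝓘(ℝ, E') ∞ D)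
    (ξ : GroupLieAlgebra 𝓘(ℝ, F) Gs) (X : GroupLieAlgebra 𝓘(ℝ, E') G') :
    HasDer (IsSmooth 𝓘(ℝ, F)) (lder ξ) (fun g => Ad 𝓘(ℝ, E') (D g) X)
      fun g => Ad 𝓘(ℝ, E') (D g) ⁅homDiff 𝓘(ℝ, F) 𝓘(ℝ, E') D ξ, X⁆ := fun l =>
  ⟨(hasDer_Ad 0 X l).1.comp hD, fun g => (lder_comp_hom hD ξ (hasDer_Ad 0 X l).1 g).trans
    ((hasDer_Ad _ X l).2 (D g))⟩

variable {V M : Type*} [NormedAddCommGroup V] [NormedSpace ℝ V]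
  [TopologicalSpace M] [ChartedSpace V M] {Γ : M → Gs}

/-- The differential of `D ∘ Γ` in the right trivialisation. -/
lemma mfderiv_hom_comp {D : Gs →* G'} (hD : ContMDiff 𝓘(ℝ, F) 𝓘(ℝ, E') ∞ D)
    (hΓ : ContMDiff 𝓘(ℝ, V) 𝓘(ℝ, F) ∞ Γ) (m : M) :
    (mfderiv 𝓘(ℝ, V) 𝓘(ℝ, E') (fun x => D (Γ x)) m).toLinearMap =
      transR 𝓘(ℝ, E') (D (Γ m)) ∘ₗ Ad 𝓘(ℝ, E') (D (Γ m)) ∘ₗ homDiff 𝓘(ℝ, F) 𝓘(ℝ, E') D ∘ₗ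
        logDiff (F := F) Γ m := by
  have hDd : MDifferentiable 𝓘(ℝ, F) 𝓘(ℝ, E') D := hD.mdifferentiable (by simp)
  ext v
  simp only [LinearMap.comp_apply, transR_Ad]
  rw [← mfderiv_hom_transL hDd, logDiff, LinearMap.comp_apply, transL_transLInv]
  exact congrArg (fun T : V →L[ℝ] E' => T v)
    (mfderiv_comp (I' := 𝓘(ℝ, F)) m (hDd (Γ m)) (hΓ.mdifferentiable (by simp) m))

lemma transLInv_pbMap_hom_comp (PM : TensorField 𝓘(ℝ, V) M) {D : Gs →* G'}
    (hD : ContMDiff 𝓘(ℝ, F) 𝓘(ℝ, E') ∞ D) (hΓ : ContMDiff 𝓘(ℝ, V) 𝓘(ℝ, F) ∞ Γ) (f : M → ℝ) (m : M) :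
    transLInv 𝓘(ℝ, E') (D (Γ m)) (pbMap 𝓘(ℝ, E') PM (fun x => D (Γ x)) f m) =
      homDiff 𝓘(ℝ, F) 𝓘(ℝ, E') D (logBracket (F := F) PM Γ f m) := by
  rw [pbMap, rid_map, mfderiv_hom_comp hD hΓ, LinearMap.comp_apply, LinearMap.comp_apply, transR_Ad,
    transLInv_transL, LinearMap.comp_apply, logDiff, logBracket, pbMap]
  exact congrArg _ (congrArg _ (rid_map _ _ _).symm)

end Hom

/-! ### Existence of the central tensor -/

section Core

variable {E G : Type*} [NormedAddCommGroup E] [NormedSpace ℝ E] [FiniteDimensional ℝ E]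
  [TopologicalSpace G] [ChartedSpace E G] [Group G] [LieGroup 𝓘(ℝ, E) ∞ G]
  [LieAlgebra.IsKilling ℝ (GroupLieAlgebra 𝓘(ℝ, E) G)]
  {F Gs : Type*} [NormedAddCommGroup F] [NormedSpace ℝ F] [FiniteDimensional ℝ F]
  [TopologicalSpace Gs] [ChartedSpace F Gs] [Group Gs] [LieGroup 𝓘(ℝ, F) ∞ Gs]
  {V M : Type*} [NormedAddCommGroup V] [NormedSpace ℝ V]
  [TopologicalSpace M] [ChartedSpace V M]

/-- The identification `π⁻¹ ∘ τ` of the Lie algebra of the dual group with `𝔤`, where `π` is given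
by the Killing form. -/
def dualEquiv (τ : GroupLieAlgebra 𝓘(ℝ, F) Gs ≃ₗ[ℝ] Module.Dual ℝ (GroupLieAlgebra 𝓘(ℝ, E) G)) :
    GroupLieAlgebra 𝓘(ℝ, F) Gs ≃ₗ[ℝ] GroupLieAlgebra 𝓘(ℝ, E) G :=
  τ.trans (LinearMap.BilinForm.toDual (killingForm ℝ (GroupLieAlgebra 𝓘(ℝ, E) G))
    (LieAlgebra.IsKilling.killingForm_nondegenerate ℝ (GroupLieAlgebra 𝓘(ℝ, E) G))).symm

variable {τ : GroupLieAlgebra 𝓘(ℝ, F) Gs ≃ₗ[ℝ] Module.Dual ℝ (GroupLieAlgebra 𝓘(ℝ, E) G)}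

lemma killingForm_dualEquiv (ξ : GroupLieAlgebra 𝓘(ℝ, F) Gs) :
    killingForm ℝ (GroupLieAlgebra 𝓘(ℝ, E) G) (dualEquiv τ ξ) = τ ξ := by
  ext ε
  exact LinearMap.BilinForm.apply_toDual_symm_apply (hB :=
    LieAlgebra.IsKilling.killingForm_nondegenerate ℝ (GroupLieAlgebra 𝓘(ℝ, E) G)) (τ ξ) ε

lemma dualEquiv_symm_apply (X : GroupLieAlgebra 𝓘(ℝ, E) G) :
    (dualEquiv τ).symm X = τ.symm (killingForm ℝ _ X) := rfl

/-- The transpose of the Lie bracket of `𝔤`, as a map from the Lie algebra of the dual group to its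
tensor square. -/
def cobracket (τ : GroupLieAlgebra 𝓘(ℝ, F) Gs ≃ₗ[ℝ] Module.Dual ℝ (GroupLieAlgebra 𝓘(ℝ, E) G))
    (ξ : GroupLieAlgebra 𝓘(ℝ, F) Gs) :
    GroupLieAlgebra 𝓘(ℝ, F) Gs ⊗[ℝ] GroupLieAlgebra 𝓘(ℝ, F) Gs :=
  -TensorProduct.map (dualEquiv τ).symm.toLinearMap (dualEquiv τ).symm.toLinearMap
    (kernel (LieAlgebra.ad ℝ _ (dualEquiv τ ξ)))

lemma map_cobracket (ξ : GroupLieAlgebra 𝓘(ℝ, F) Gs) :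
    TensorProduct.map (dualEquiv τ).toLinearMap (dualEquiv τ).toLinearMap (cobracket τ ξ) =
      -kernel (LieAlgebra.ad ℝ _ (dualEquiv τ ξ)) := by
  rw [cobracket, map_neg, TensorProduct.map_map, LinearEquiv.comp_symm, TensorProduct.map_id,
    LinearMap.id_apply]

lemma comm_cobracket (ξ : GroupLieAlgebra 𝓘(ℝ, F) Gs) :
    TensorProduct.comm ℝ _ _ (cobracket τ ξ) = -cobracket τ ξ := by
  rw [cobracket, map_neg, ← TensorProduct.map_comm, comm_kernel_ad, map_neg]

lemma contract_cobracket (ξ : GroupLieAlgebra 𝓘(ℝ, F) Gs) (ε η : GroupLieAlgebra 𝓘(ℝ, E) G) :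
    contract (pairing τ ε) (pairing τ η) (cobracket τ ξ) = τ ξ ⁅ε, η⁆ := by
  have h : ∀ ε, pairing τ ε ∘ₗ (dualEquiv τ).symm.toLinearMap = killingForm ℝ _ ε := by
    intro ε; ext X
    change τ ((dualEquiv τ).symm X) ε = _
    rw [← killingForm_dualEquiv, LieModule.traceForm_comm]
    exact congrArg (killingForm ℝ (GroupLieAlgebra 𝓘(ℝ, E) G) ε)
      ((dualEquiv τ).apply_symm_apply X)
  rw [cobracket, map_neg, contract_map, h, h, contract_kernel_ad, neg_neg, killingForm_dualEquiv]

variable [IsManifold 𝓘(ℝ, V) ∞ M] [T2Space Gs] [PreconnectedSpace Gs]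
  {PM : TensorField 𝓘(ℝ, V) M} {Γ : M → Gs} {ρ : M → G → M} {PG : TensorField 𝓘(ℝ, E) G}

/-- Let `A i` be a jointly faithful family of representations of the dual group by automorphisms of
a Lie algebra `𝔨` with differentials `ad ∘ j i`, where `j i : 𝔤 → 𝔨`, and let the tensors `r i k`
satisfy the Yang-Baxter type identity `hr`. Then the translated bracket of the moment map with
itself is the sum of the coboundary of `r i k` and of the image of a central tensor that does not
depend on `i` and `k`. -/
lemma exists_central (hP : IsPoisson PM) (hρ : IsPoissonLieAction PM PG ρ)
    (hΓ : IsMomentMap PM ρ τ Γ)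
    {𝕂 𝔨 : Type*} [Field 𝕂] [Algebra ℝ 𝕂] [LieRing 𝔨] [LieAlgebra 𝕂 𝔨]
    [Module ℝ 𝔨] [IsScalarTower ℝ 𝕂 𝔨] [FiniteDimensional ℝ 𝔨]
    {ι : Type*} [Fintype ι] {j : ι → GroupLieAlgebra 𝓘(ℝ, E) G →ₗ[ℝ] 𝔨}
    {A : ι → Gs → 𝔨 →ₗ[𝕂] 𝔨} (hA1 : ∀ i x, A i 1 x = x)
    (hA : ∀ i ξ x, HasDer (IsSmooth 𝓘(ℝ, F)) (lder ξ) (fun g => A i g x)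
      fun g => A i g (LieAlgebra.ad 𝕂 𝔨 (j i (dualEquiv τ ξ)) x))
    (hAj : ∀ i g ξ, A i g (j i (dualEquiv τ ξ)) = j i (dualEquiv τ (Ad 𝓘(ℝ, F) g ξ)))
    {J : ι → ι → GroupLieAlgebra 𝓘(ℝ, E) G ⊗[ℝ] GroupLieAlgebra 𝓘(ℝ, E) G →ₗ[ℝ] 𝔨 ⊗[𝕂] 𝔨}
    (hJ : ∀ i k X Y, J i k (X ⊗ₜ Y) = j i X ⊗ₜ j k Y) (w : ι × ι → ℝ)
    (hJi : Function.Injective (∑ p : ι × ι, w p • J p.1 p.2 : _ →ₗ[ℝ] 𝔨 ⊗[𝕂] 𝔨))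
    {r : ι → ι → 𝔨 ⊗[𝕂] 𝔨} {γ : ℝ}
    (hr : ∀ i k X, γ • ad₂ 𝕂 (j i X) (j k X) (r i k) = -J i k (kernel (LieAlgebra.ad ℝ _ X))) :
    ∃ N : M → GroupLieAlgebra 𝓘(ℝ, E) G ⊗[ℝ] GroupLieAlgebra 𝓘(ℝ, E) G,
      (∀ m, TensorProduct.comm ℝ _ _ (N m) = -N m) ∧ IsCentral PM N ∧
      ∀ i k m, TensorProduct.map (A i (Γ m)) (A k (Γ m))
        (J i k (TensorProduct.map (dualEquiv τ).toLinearMap (dualEquiv τ).toLinearMap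
          (logTensor (F := F) PM Γ m))) =
        γ • (r i k - TensorProduct.map (A i (Γ m)) (A k (Γ m)) (r i k)) + J i k (N m) := by
  let σ₂ := TensorProduct.map (dualEquiv τ).toLinearMap (dualEquiv τ).toLinearMap
  have hK := fun (p : ι × ι) ξ => hasDer_coboundary (γ := γ) (r := r p.1 p.2)
    (j := j p.1 ∘ₗ (dualEquiv τ).toLinearMap) (k := j p.2 ∘ₗ (dualEquiv τ).toLinearMap)
    (A := A p.1) (B := A p.2) (J := J p.1 p.2 ∘ₗ σ₂) (C := cobracket τ)
    (hA p.1) (hA p.2) (hAj p.1) (hAj p.2) (fun ξ ζ => hJ p.1 p.2 _ _)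
    (fun ξ => (hr p.1 p.2 (dualEquiv τ ξ)).trans (by
      rw [LinearMap.comp_apply, map_cobracket, map_neg])) ξ
  have hinj : Function.Injective (∑ p : ι × ι, w p • (J p.1 p.2 ∘ₗ σ₂) : _ →ₗ[ℝ] 𝔨 ⊗[𝕂] 𝔨) := by
    have h : (∑ p : ι × ι, w p • (J p.1 p.2 ∘ₗ σ₂) : _ →ₗ[ℝ] 𝔨 ⊗[𝕂] 𝔨) =
        (∑ p : ι × ι, w p • J p.1 p.2) ∘ₗ σ₂ := by
      refine LinearMap.ext fun t => ?_
      simp only [LinearMap.sum_apply, LinearMap.smul_apply, LinearMap.comp_apply]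
    rw [h]
    exact hJi.comp (TensorProduct.congr (dualEquiv τ) (dualEquiv τ)).injective
  obtain ⟨Q, hQ, hQJ, hQs⟩ := exists_primitive (comm_cobracket (τ := τ))
    (fun p : ι × ι => J p.1 p.2 ∘ₗ σ₂) w hinj _ hK
    (fun p => by
      have h : ∀ i, A i 1 = LinearMap.id := fun i => LinearMap.ext (hA1 i)
      rw [h, h, TensorProduct.map_id, LinearMap.id_apply, sub_self, smul_zero])
  refine ⟨fun m => σ₂ (TensorProduct.map (Ad 𝓘(ℝ, F) (Γ m)) (Ad 𝓘(ℝ, F) (Γ m))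
      (logTensor (F := F) PM Γ m) - Q (Γ m)), fun m => ?_, fun l => ?_, fun i k m => ?_⟩
  · simp only [σ₂]
    rw [← TensorProduct.map_comm, map_sub, ← TensorProduct.map_comm, comm_logTensor hP, hQs,
      map_neg, ← neg_sub', map_neg]
  · exact isCentral_of_primitive hP hρ hΓ contract_cobracket hQ (l ∘ₗ σ₂)
  · have hJA : ∀ t, J i k (σ₂ (TensorProduct.map (Ad 𝓘(ℝ, F) (Γ m)) (Ad 𝓘(ℝ, F) (Γ m)) t)) =
        TensorProduct.map (A i (Γ m)) (A k (Γ m)) (J i k (σ₂ t)) := by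
      intro t
      induction t with
      | zero => simp only [map_zero]
      | tmul => simp only [σ₂, TensorProduct.map_tmul, hJ, hAj, LinearEquiv.coe_coe]
      | add x y hx hy => simp only [map_add, hx, hy]
    have h : J i k (σ₂ (Q (Γ m))) =
        γ • (r i k - TensorProduct.map (A i (Γ m)) (A k (Γ m)) (r i k)) :=
      hQJ (i, k) (Γ m)
    beta_reduce
    rw [← h, map_sub, map_sub, hJA]
    exact (add_sub_cancel _ _).symm

end Core

/-! ### The split case -/

section Split

variable {E G : Type*} [NormedAddCommGroup E] [NormedSpace ℝ E] [FiniteDimensional ℝ E]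
  [TopologicalSpace G] [ChartedSpace E G] [Group G] [LieGroup 𝓘(ℝ, E) ∞ G]
  {F Gs : Type*} [NormedAddCommGroup F] [NormedSpace ℝ F] [FiniteDimensional ℝ F]
  [TopologicalSpace Gs] [ChartedSpace F Gs] [Group Gs] [LieGroup 𝓘(ℝ, F) ∞ Gs]
  {V M : Type*} [NormedAddCommGroup V] [NormedSpace ℝ V]
  [TopologicalSpace M] [ChartedSpace V M]
  {PM : TensorField 𝓘(ℝ, V) M} {Γ : M → Gs}

/-- The sign `±1` that corresponds to a Boolean. -/
def sgn (i : Bool) : ℝ := cond i 1 (-1)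

lemma sgn_eq (i : Bool) : sgn i = 1 ∨ sgn i = -1 := by cases i <;> simp [sgn]

/-- Right translation turns a relation for the left-translated bracket of `Γ` with itself into a
bracket relation for the images of `Γ` under homomorphisms. -/
lemma isSTS_hom_comp {D₁ D₂ : Gs →* G} (hD₁ : ContMDiff 𝓘(ℝ, F) 𝓘(ℝ, E) ∞ D₁)
    (hD₂ : ContMDiff 𝓘(ℝ, F) 𝓘(ℝ, E) ∞ D₂) (hΓ : ContMDiff 𝓘(ℝ, V) 𝓘(ℝ, F) ∞ Γ) {γ : ℝ}
    {r : GroupLieAlgebra 𝓘(ℝ, E) G ⊗[ℝ] GroupLieAlgebra 𝓘(ℝ, E) G}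
    {N : M → GroupLieAlgebra 𝓘(ℝ, E) G ⊗[ℝ] GroupLieAlgebra 𝓘(ℝ, E) G}
    (h : ∀ m, TensorProduct.map (Ad 𝓘(ℝ, E) (D₁ (Γ m))) (Ad 𝓘(ℝ, E) (D₂ (Γ m)))
        (TensorProduct.map (homDiff 𝓘(ℝ, F) 𝓘(ℝ, E) D₁) (homDiff 𝓘(ℝ, F) 𝓘(ℝ, E) D₂)
          (logTensor (F := F) PM Γ m)) =
      γ • (r - TensorProduct.map (Ad 𝓘(ℝ, E) (D₁ (Γ m))) (Ad 𝓘(ℝ, E) (D₂ (Γ m))) r) + N m) :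
    IsSTS PM (fun m => D₁ (Γ m)) (fun m => D₂ (Γ m)) γ r N := by
  intro m
  have hL : ∀ g : G, transR 𝓘(ℝ, E) g ∘ₗ Ad 𝓘(ℝ, E) g = transL 𝓘(ℝ, E) g := fun g =>
    LinearMap.ext fun X => transR_Ad g X
  have h1 := congrArg (TensorProduct.map (transR 𝓘(ℝ, E) (D₁ (Γ m))) (transR 𝓘(ℝ, E) (D₂ (Γ m))))
    (h m)
  rw [map_add, map_smul, map_sub, TensorProduct.map_map _ _ _ _ r, hL, hL, logTensor,
    TensorProduct.map_map, TensorProduct.map_map, TensorProduct.map_map, LinearMap.comp_assoc,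
    LinearMap.comp_assoc, LinearMap.comp_assoc, LinearMap.comp_assoc, ← mfderiv_hom_comp hD₁ hΓ,
    ← mfderiv_hom_comp hD₂ hΓ] at h1
  exact h1

variable [LieAlgebra.IsKilling ℝ (GroupLieAlgebra 𝓘(ℝ, E) G)]
  {τ : GroupLieAlgebra 𝓘(ℝ, F) Gs ≃ₗ[ℝ] Module.Dual ℝ (GroupLieAlgebra 𝓘(ℝ, E) G)}
  {R : GroupLieAlgebra 𝓘(ℝ, E) G →ₗ[ℝ] GroupLieAlgebra 𝓘(ℝ, E) G} {γ : ℝ}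

/-- The components of a realisation of the dual group in `G × G`; `true` stands for the sign `+`. -/
def splitHom (D : Gs →* G × G) (i : Bool) : Gs →* G :=
  cond i (MonoidHom.fst G G) (MonoidHom.snd G G) |>.comp D

lemma IsSplitRealisation.contMDiff_splitHom {D : Gs →* G × G} (hD : IsSplitRealisation γ R τ D)
    (i : Bool) : ContMDiff 𝓘(ℝ, F) 𝓘(ℝ, E) ∞ (splitHom D i) := by
  cases i
  · exact contMDiff_snd.comp hD.smooth
  · exact contMDiff_fst.comp hD.smooth

lemma IsSplitRealisation.mfderiv_one {D : Gs →* G × G} (hD : IsSplitRealisation γ R τ D)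
    (ξ : GroupLieAlgebra 𝓘(ℝ, F) Gs) :
    (mfderiv 𝓘(ℝ, F) (𝓘(ℝ, E).prod 𝓘(ℝ, E)) D 1 ξ : E × E) =
      (γ • splitR R 1 (dualEquiv τ ξ), γ • splitR R (-1) (dualEquiv τ ξ)) := by
  have h := hD.differential (dualEquiv τ ξ)
  rwa [← dualEquiv_symm_apply, LinearEquiv.symm_apply_apply] at h

lemma IsSplitRealisation.homDiff_splitHom {D : Gs →* G × G} (hD : IsSplitRealisation γ R τ D)
    (i : Bool) : homDiff 𝓘(ℝ, F) 𝓘(ℝ, E) (splitHom D i) =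
      (γ • splitR R (sgn i)) ∘ₗ (dualEquiv τ).toLinearMap := by
  refine LinearMap.ext fun ξ => ?_
  have h := hD.mfderiv_one ξ
  have hDd : MDifferentiableAt 𝓘(ℝ, F) (𝓘(ℝ, E).prod 𝓘(ℝ, E)) D (1 : Gs) :=
    hD.smooth.mdifferentiable (by simp) 1
  cases i
  · have h1 := mfderiv_comp (I' := 𝓘(ℝ, E).prod 𝓘(ℝ, E)) (I'' := 𝓘(ℝ, E)) (1 : Gs)
      (mdifferentiableAt_snd (x := D 1)) hDd
    rw [mfderiv_snd] at h1
    exact (congrArg (fun T : F →L[ℝ] E => T ξ) h1).trans (congrArg (fun v : E × E => v.2) h)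
  · have h1 := mfderiv_comp (I' := 𝓘(ℝ, E).prod 𝓘(ℝ, E)) (I'' := 𝓘(ℝ, E)) (1 : Gs)
      (mdifferentiableAt_fst (x := D 1)) hDd
    rw [mfderiv_fst] at h1
    exact (congrArg (fun T : F →L[ℝ] E => T ξ) h1).trans (congrArg (fun v : E × E => v.1) h)

/-- The four maps `R^η ⊗ R^ε` are jointly injective, since `R⁺ - R⁻ = 2`; the weights `η ε` form the
tensor square of this difference. -/
lemma injective_sum_map_splitR (hγ : γ ≠ 0) : Function.Injective
    (∑ p : Bool × Bool, (sgn p.1 * sgn p.2) •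
      TensorProduct.map (γ • splitR R (sgn p.1)) (γ • splitR R (sgn p.2)) : _ →ₗ[ℝ] _) := by
  have h : (∑ p : Bool × Bool, (sgn p.1 * sgn p.2) •
      TensorProduct.map (γ • splitR R (sgn p.1)) (γ • splitR R (sgn p.2)) : _ →ₗ[ℝ] _) =
      ((2 * γ) ^ 2) • LinearMap.id := by
    ext X Y
    simp only [Fintype.sum_prod_type, Fintype.sum_bool, sgn, cond_true, cond_false, splitR,
      TensorProduct.map_add_left, TensorProduct.map_add_right, TensorProduct.map_smul_left,
      TensorProduct.map_smul_right, smul_add, TensorProduct.map_id,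
      TensorProduct.AlgebraTensorModule.curry_apply, LinearMap.restrictScalars_self,
      TensorProduct.curry_apply, LinearMap.add_apply, LinearMap.smul_apply, TensorProduct.map_tmul,
      LinearMap.id_apply]
    module
  rw [h]
  intro s t hst
  have h2 : ((2 * γ) ^ 2) ≠ 0 := by positivity
  exact smul_right_injective _ h2 hst

variable [T2Space G] [T2Space Gs] [PreconnectedSpace Gs] [IsManifold 𝓘(ℝ, V) ∞ M]
  {ρ : M → G → M} {PG : TensorField 𝓘(ℝ, E) G}

lemma IsSplitRealisation.mem_subgroupDR {D : Gs →* G × G} (hD : IsSplitRealisation γ R τ D)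
    (g : Gs) : D g ∈ subgroupDR (G := G) R := by
  have h : ∀ ξ, ∃ X, (homDiff 𝓘(ℝ, F) (𝓘(ℝ, E).prod 𝓘(ℝ, E)) D ξ : E × E) =
      (splitR R 1 X, splitR R (-1) X) := fun ξ => ⟨γ • dualEquiv τ ξ, by
    rw [map_smul, map_smul]
    exact hD.mfderiv_one ξ⟩
  exact hom_mem_integralSubgroup hD.smooth h g

/-- The bracket relations for all pairs of signs in the split case. For equal signs the tensor is
`R₁₂`, and for different signs it is `R^±₁₂`. -/
lemma exists_central_split (hγ : γ ≠ 0) (hR : IsSkew R) (hYB : IsMCYBE R 1) (hP : IsPoisson PM)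
    (hρ : IsPoissonLieAction PM PG ρ) (hΓ : IsMomentMap PM ρ τ Γ) {D : Gs →* G × G}
    (hD : IsSplitRealisation γ R τ D) :
    ∃ N : M → GroupLieAlgebra 𝓘(ℝ, E) G ⊗[ℝ] GroupLieAlgebra 𝓘(ℝ, E) G,
      (∀ m, TensorProduct.comm ℝ _ _ (N m) = -N m) ∧ IsCentral PM N ∧
      ∀ i k, IsSTS PM (fun m => splitHom D i (Γ m)) (fun m => splitHom D k (Γ m)) γ
        (kernel R + ((sgn i - sgn k) / 2) • kernel LinearMap.id) fun m =>
          TensorProduct.map (γ • splitR R (sgn i)) (γ • splitR R (sgn k)) (N m) := by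
  have : FiniteDimensional ℝ (GroupLieAlgebra 𝓘(ℝ, E) G) := inferInstanceAs (FiniteDimensional ℝ E)
  have hs := hD.contMDiff_splitHom
  have hd := hD.homDiff_splitHom
  have hd' : ∀ i ξ, homDiff 𝓘(ℝ, F) 𝓘(ℝ, E) (splitHom D i) ξ =
      (γ • splitR R (sgn i)) (dualEquiv τ ξ) := fun i ξ => LinearMap.congr_fun (hd i) ξ
  obtain ⟨N, hN, hNc, h⟩ := exists_central (𝕂 := ℝ) hP hρ hΓ
    (j := fun i => γ • splitR R (sgn i)) (A := fun i g => Ad 𝓘(ℝ, E) (splitHom D i g))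
    (fun i x => by rw [map_one, Ad_one])
    (fun i ξ x => by
      rw [← hd']
      exact hasDer_Ad_hom (hs i) ξ x)
    (fun i g ξ => by
      rw [← hd', ← hd', homDiff_Ad ((hs i).mdifferentiable (by simp))])
    (J := fun i k => TensorProduct.map (γ • splitR R (sgn i)) (γ • splitR R (sgn k)))
    (fun _ _ _ _ => rfl) (fun p => sgn p.1 * sgn p.2) (injective_sum_map_splitR hγ)
    (r := fun i k => kernel R + ((sgn i - sgn k) / 2) • kernel LinearMap.id) (γ := γ)
    (fun i k X => by
      have h := ad₂_splitR hR hYB (sgn_eq i) (sgn_eq k) X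
      have h1 : ad₂ ℝ ((γ • splitR R (sgn i)) X) ((γ • splitR R (sgn k)) X) =
          γ • ad₂ ℝ (splitR R (sgn i) X) (splitR R (sgn k) X) := by
        simp only [ad₂, LinearMap.smul_apply, map_smul, TensorProduct.map_smul_left,
          TensorProduct.map_smul_right, smul_add]
      rw [h1, LinearMap.smul_apply, h, TensorProduct.map_smul_left, TensorProduct.map_smul_right,
        LinearMap.smul_apply, LinearMap.smul_apply, smul_neg, smul_neg])
  refine ⟨N, hN, hNc, fun i k => isSTS_hom_comp (hs i) (hs k) hΓ.smooth fun m => ?_⟩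
  rw [hd, hd, ← h i k m]
  exact congrArg _ (TensorProduct.map_map _ _ _ _ _).symm

lemma infAction_split (hγ : γ ≠ 0) (hΓ : IsMomentMap PM ρ τ Γ) {D : Gs →* G × G}
    (hD : IsSplitRealisation γ R τ D) (ε : GroupLieAlgebra 𝓘(ℝ, E) G) {f : M → ℝ}
    (hf : IsSmooth 𝓘(ℝ, V) f) (m : M) :
    infAction ρ ε f m = -(1 / (2 * γ)) * killingForm ℝ (GroupLieAlgebra 𝓘(ℝ, E) G) ε
      (transLInv 𝓘(ℝ, E) (splitHom D true (Γ m))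
          (pbMap 𝓘(ℝ, E) PM (fun m => splitHom D true (Γ m)) f m) -
        transLInv 𝓘(ℝ, E) (splitHom D false (Γ m))
          (pbMap 𝓘(ℝ, E) PM (fun m => splitHom D false (Γ m)) f m)) := by
  rw [transLInv_pbMap_hom_comp PM (hD.contMDiff_splitHom _) hΓ.smooth,
    transLInv_pbMap_hom_comp PM (hD.contMDiff_splitHom _) hΓ.smooth, hD.homDiff_splitHom,
    hD.homDiff_splitHom, hΓ.infAction_eq ε hf, ← killingForm_dualEquiv, LieModule.traceForm_comm]
  set X := dualEquiv τ (logBracket (F := F) PM Γ f m) with hX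
  have h : ((γ • splitR R (sgn true)) ∘ₗ (dualEquiv τ).toLinearMap) (logBracket (F := F) PM Γ f m) -
      ((γ • splitR R (sgn false)) ∘ₗ (dualEquiv τ).toLinearMap) (logBracket (F := F) PM Γ f m) =
      (2 * γ) • X := by
    simp only [LinearMap.comp_apply, LinearEquiv.coe_coe, ← hX, LinearMap.smul_apply, splitR, sgn,
      LinearMap.add_apply, LinearMap.id_apply, cond_true, cond_false]
    module
  rw [h, map_smul, smul_eq_mul]
  field_simp

end Split

/-! ### Complex Lie groups as real Lie groups -/

section RestrictScalars

variable {A B M N : Type*} [NormedAddCommGroup A] [NormedSpace ℂ A] [NormedAddCommGroup B]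
  [NormedSpace ℂ B] [TopologicalSpace M] [ChartedSpace A M] [TopologicalSpace N] [ChartedSpace B N]

lemma isManifold_restrictScalars [IsManifold 𝓘(ℂ, A) ω M] : IsManifold 𝓘(ℝ, A) ∞ M := by
  refine isManifold_of_contDiffOn 𝓘(ℝ, A) ∞ M fun e e' he he' => ?_
  have h := (contDiffGroupoid ω 𝓘(ℂ, A)).compatible he he'
  have h1 := ((mem_groupoid_of_pregroupoid.1 h).1 : ContDiffOn ℂ ω _ _)
  exact (h1.restrict_scalars ℝ).of_le le_top

/-- For a holomorphic map the real and the complex derivatives coincide. -/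
lemma mfderiv_restrictScalars {f : M → N} {x : M} (h : MDifferentiableAt 𝓘(ℂ, A) 𝓘(ℂ, B) f x) :
    (mfderiv 𝓘(ℝ, A) 𝓘(ℝ, B) f x : A →L[ℝ] B) =
      (mfderiv 𝓘(ℂ, A) 𝓘(ℂ, B) f x : A →L[ℂ] B).restrictScalars ℝ := by
  have h1 := h.hasMFDerivAt
  have h2 : HasFDerivWithinAt (𝕜 := ℂ) (writtenInExtChartAt 𝓘(ℂ, A) 𝓘(ℂ, B) x f)
    (mfderiv 𝓘(ℂ, A) 𝓘(ℂ, B) f x : A →L[ℂ] B) (Set.range 𝓘(ℂ, A)) (extChartAt 𝓘(ℂ, A) x x) := h1.2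
  have h3 : HasMFDerivAt 𝓘(ℝ, A) 𝓘(ℝ, B) f x
      ((mfderiv 𝓘(ℂ, A) 𝓘(ℂ, B) f x : A →L[ℂ] B).restrictScalars ℝ) :=
    ⟨h1.1, h2.restrictScalars ℝ⟩
  exact h3.mfderiv

end RestrictScalars

section ComplexGroup

variable {A G : Type*} [NormedAddCommGroup A] [NormedSpace ℂ A]
  [TopologicalSpace G] [ChartedSpace A G] [Group G] [LieGroup 𝓘(ℂ, A) ω G]

/-- A complex Lie group is a real Lie group. -/
lemma lieGroup_restrictScalars : LieGroup 𝓘(ℝ, A) ∞ G := by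
  have := isManifold_restrictScalars (A := A) (M := G)
  refine { contMDiff_mul := ?_, contMDiff_inv := ?_ }
  · have h := contMDiff_mul 𝓘(ℂ, A) ω (G := G)
    rw [contMDiff_iff] at h ⊢
    exact ⟨h.1, fun x y => ((h.2 x y).restrict_scalars ℝ).of_le le_top⟩
  · have h := contMDiff_inv 𝓘(ℂ, A) ω (G := G)
    rw [contMDiff_iff] at h ⊢
    exact ⟨h.1, fun x y => ((h.2 x y).restrict_scalars ℝ).of_le le_top⟩

lemma transL_restrictScalars (g : G) (X : A) :
    (transL 𝓘(ℝ, A) g X : A) = (transL 𝓘(ℂ, A) g X : A) :=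
  congrArg (fun T : A →L[ℝ] A => T X)
    (mfderiv_restrictScalars (mdifferentiableAt_mul_left (I := 𝓘(ℂ, A)) g (1 : G)))

lemma transR_restrictScalars (g : G) (X : A) :
    (transR 𝓘(ℝ, A) g X : A) = (transR 𝓘(ℂ, A) g X : A) :=
  congrArg (fun T : A →L[ℝ] A => T X)
    (mfderiv_restrictScalars (mdifferentiableAt_mul_right (I := 𝓘(ℂ, A)) g (1 : G)))

lemma transLInv_restrictScalars (g : G) (X : A) :
    (transLInv 𝓘(ℝ, A) g X : A) = (transLInv 𝓘(ℂ, A) g X : A) :=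
  congrArg (fun T : A →L[ℝ] A => T X)
    (mfderiv_restrictScalars (mdifferentiableAt_mul_left (I := 𝓘(ℂ, A)) g⁻¹ g))

lemma Ad_restrictScalars (g : G) (X : A) :
    (Ad 𝓘(ℝ, A) g X : A) = (Ad 𝓘(ℂ, A) g X : A) := by
  have h : ∀ Y : A, (transRInv 𝓘(ℝ, A) g Y : A) = (transRInv 𝓘(ℂ, A) g Y : A) := fun Y =>
    congrArg (fun T : A →L[ℝ] A => T Y)
      (mfderiv_restrictScalars (mdifferentiableAt_mul_right (I := 𝓘(ℂ, A)) g⁻¹ g))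
  exact (h _).trans (congrArg (fun Y : A => (transRInv 𝓘(ℂ, A) g Y : A))
    (transL_restrictScalars g X))

open VectorField in
/-- The Lie bracket at `x` in terms of the preferred chart. -/
lemma mlieBracket_eq_lieBracket {𝕜 : Type*} [NontriviallyNormedField 𝕜] {E M : Type*}
    [NormedAddCommGroup E] [NormedSpace 𝕜 E] [TopologicalSpace M] [ChartedSpace E M]
    [IsManifold 𝓘(𝕜, E) 1 M] (V W : ∀ x : M, TangentSpace 𝓘(𝕜, E) x) (x : M) :
    (mlieBracket 𝓘(𝕜, E) V W x : E) = lieBracket 𝕜 (E := E)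
      (mpullbackWithin 𝓘(𝕜, E) 𝓘(𝕜, E) (extChartAt 𝓘(𝕜, E) x).symm V (Set.range 𝓘(𝕜, E)) : E → E)
      (mpullbackWithin 𝓘(𝕜, E) 𝓘(𝕜, E) (extChartAt 𝓘(𝕜, E) x).symm W (Set.range 𝓘(𝕜, E)) : E → E)
      (extChartAt 𝓘(𝕜, E) x x) := by
  set V' : E → E :=
    mpullbackWithin 𝓘(𝕜, E) 𝓘(𝕜, E) (extChartAt 𝓘(𝕜, E) x).symm V (Set.range 𝓘(𝕜, E))
  set W' : E → E :=
    mpullbackWithin 𝓘(𝕜, E) 𝓘(𝕜, E) (extChartAt 𝓘(𝕜, E) x).symm W (Set.range 𝓘(𝕜, E))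
  have hr : Set.range 𝓘(𝕜, E) = Set.univ := by simp
  have h1 : mlieBracket 𝓘(𝕜, E) V W x =
      (mfderiv 𝓘(𝕜, E) 𝓘(𝕜, E) (extChartAt 𝓘(𝕜, E) x) x).inverse
        (lieBracketWithin 𝕜 (E := E) V' W'
          (((extChartAt 𝓘(𝕜, E) x).symm ⁻¹' Set.univ) ∩ Set.range 𝓘(𝕜, E))
          (extChartAt 𝓘(𝕜, E) x x)) := rfl
  rw [h1, mfderiv_extChartAt_self, hr, Set.preimage_univ, Set.univ_inter, lieBracketWithin_univ]
  exact congrArg (fun T : E →L[𝕜] E => T (lieBracket 𝕜 (E := E) V' W' (extChartAt 𝓘(𝕜, E) x x)))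
    ContinuousLinearMap.inverse_id

open VectorField in
/-- The Lie brackets of a complex Lie group and of the underlying real Lie group coincide. -/
lemma bracket_restrictScalars [CompleteSpace A] (X Y : A) :
    (mlieBracket 𝓘(ℝ, A) (mulInvariantVectorField (I := 𝓘(ℝ, A)) (G := G) X)
      (mulInvariantVectorField (I := 𝓘(ℝ, A)) (G := G) Y) 1 : A) =
    (mlieBracket 𝓘(ℂ, A) (mulInvariantVectorField (I := 𝓘(ℂ, A)) (G := G) X)
      (mulInvariantVectorField (I := 𝓘(ℂ, A)) (G := G) Y) 1 : A) := by
  have : LieGroup 𝓘(ℝ, A) ∞ G := lieGroup_restrictScalars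
  have : IsManifold 𝓘(ℝ, A) 1 G := IsManifold.of_le (n := ∞) (by simp)
  have : IsManifold 𝓘(ℂ, A) 1 G := IsManifold.of_le (n := ω) le_top
  have : IsManifold 𝓘(ℂ, A) 2 G := IsManifold.of_le (n := ω) le_top
  rw [mlieBracket_eq_lieBracket, mlieBracket_eq_lieBracket]
  set e := extChartAt 𝓘(ℂ, A) (1 : G) with he
  have hr : Set.range 𝓘(ℂ, A) = Set.univ := by simp
  have hpull : ∀ Z : A, ∀ y ∈ e.target,
      (mpullbackWithin 𝓘(ℝ, A) 𝓘(ℝ, A) e.symm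
        (mulInvariantVectorField (I := 𝓘(ℝ, A)) (G := G) Z) (Set.range 𝓘(ℝ, A)) y : A) =
      (mpullbackWithin 𝓘(ℂ, A) 𝓘(ℂ, A) e.symm
        (mulInvariantVectorField (I := 𝓘(ℂ, A)) (G := G) Z) (Set.range 𝓘(ℂ, A)) y : A) := by
    intro Z y hy
    obtain ⟨T, hT⟩ : ∃ T : A ≃L[ℂ] A, (T : A →L[ℂ] A) =
        (mfderivWithin 𝓘(ℂ, A) 𝓘(ℂ, A) e.symm (Set.range 𝓘(ℂ, A)) y : A →L[ℂ] A) :=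
      isInvertible_mfderivWithin_extChartAt_symm (I := 𝓘(ℂ, A)) hy
    have hmd : MDifferentiableAt 𝓘(ℂ, A) 𝓘(ℂ, A) e.symm y := by
      have := mdifferentiableWithinAt_extChartAt_symm (I := 𝓘(ℂ, A)) hy
      rwa [hr, mdifferentiableWithinAt_univ] at this
    have h1 : (mfderivWithin 𝓘(ℝ, A) 𝓘(ℝ, A) e.symm (Set.range 𝓘(ℝ, A)) y : A →L[ℝ] A) =
        (mfderivWithin 𝓘(ℂ, A) 𝓘(ℂ, A) e.symm (Set.range 𝓘(ℂ, A)) y : A →L[ℂ] A).restrictScalars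
          ℝ := by
      have hr' : Set.range 𝓘(ℝ, A) = Set.univ := by simp
      rw [hr, hr', mfderivWithin_univ, mfderivWithin_univ]
      exact mfderiv_restrictScalars hmd
    have h2 : (mfderivWithin 𝓘(ℝ, A) 𝓘(ℝ, A) e.symm (Set.range 𝓘(ℝ, A)) y : A →L[ℝ] A).inverse =
        (T.symm.restrictScalars ℝ : A →L[ℝ] A) := by
      rw [h1, ← hT]
      exact ContinuousLinearMap.inverse_equiv (T.restrictScalars ℝ)
    have h3 : (mfderivWithin 𝓘(ℂ, A) 𝓘(ℂ, A) e.symm (Set.range 𝓘(ℂ, A)) y : A →L[ℂ] A).inverse =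
        (T.symm : A →L[ℂ] A) := by
      rw [← hT]
      exact ContinuousLinearMap.inverse_equiv T
    exact (congrArg (fun S : A →L[ℝ] A =>
      S (mulInvariantVectorField (I := 𝓘(ℝ, A)) Z (e.symm y) : A))
      h2).trans ((congrArg (fun v : A => T.symm v)
        (transL_restrictScalars (e.symm y) Z)).trans
        (congrArg (fun S : A →L[ℂ] A => S (mulInvariantVectorField (I := 𝓘(ℂ, A)) Z (e.symm y) : A))
          h3).symm)
  have htn : ∀ᶠ y in nhds (e 1), y ∈ e.target := extChartAt_target_mem_nhds (1 : G)
  have hdiff : ∀ Z : A, DifferentiableAt ℂ (mpullbackWithin 𝓘(ℂ, A) 𝓘(ℂ, A) e.symm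
      (mulInvariantVectorField (I := 𝓘(ℂ, A)) (G := G) Z) (Set.range 𝓘(ℂ, A)) : A → A) (e 1) := by
    intro Z
    have h1 := ((contMDiff_mulInvariantVectorField (I := 𝓘(ℂ, A)) (G := G) Z).mdifferentiableAt
      (x := 1) (by simp)).mdifferentiableWithinAt (s := Set.univ)
      |>.differentiableWithinAt_mpullbackWithin_vectorField
    rw [Set.preimage_univ, Set.univ_inter] at h1
    exact h1.differentiableAt (by rw [hr]; exact Filter.univ_mem)
  have hfd : ∀ Z : A, fderiv ℝ (mpullbackWithin 𝓘(ℝ, A) 𝓘(ℝ, A) e.symm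
        (mulInvariantVectorField (I := 𝓘(ℝ, A)) (G := G) Z) (Set.range 𝓘(ℝ, A)) : A → A) (e 1) =
      (fderiv ℂ (mpullbackWithin 𝓘(ℂ, A) 𝓘(ℂ, A) e.symm
        (mulInvariantVectorField (I := 𝓘(ℂ, A)) (G := G) Z) (Set.range 𝓘(ℂ, A)) : A → A)
          (e 1)).restrictScalars ℝ := by
    intro Z
    have h1 : (mpullbackWithin 𝓘(ℝ, A) 𝓘(ℝ, A) e.symm
        (mulInvariantVectorField (I := 𝓘(ℝ, A)) (G := G) Z) (Set.range 𝓘(ℝ, A)) : A → A)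
        =ᶠ[nhds (e 1)] (mpullbackWithin 𝓘(ℂ, A) 𝓘(ℂ, A) e.symm
        (mulInvariantVectorField (I := 𝓘(ℂ, A)) (G := G) Z) (Set.range 𝓘(ℂ, A)) : A → A) := by
      filter_upwards [htn] with y hy using hpull Z y hy
    rw [h1.fderiv_eq]
    exact (hdiff Z).fderiv_restrictScalars ℝ
  have h1 := htn.self_of_nhds
  have key := congrArg₂ (fun v w : A => v - w)
    (congrArg₂ (fun (S : A →L[ℝ] A) (v : A) => S v) (hfd Y) (hpull X _ h1))
    (congrArg₂ (fun (S : A →L[ℝ] A) (v : A) => S v) (hfd X) (hpull Y _ h1))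
  exact key

end ComplexGroup

/-! ### The non-split case -/

section ComplexTensor

/-- If `f` and `g` factor through complex linear maps `S` and `S'`, then `mapC f g` factors through
`S ⊗ S'`. -/
lemma mapC_comp {V V' U U' W W' Z Z' : Type*} [AddCommGroup V] [Module ℝ V] [AddCommGroup V']
    [Module ℝ V'] [AddCommGroup U] [Module ℝ U] [AddCommGroup U'] [Module ℝ U']
    [AddCommGroup W] [Module ℝ W] [Module ℂ W] [IsScalarTower ℝ ℂ W]
    [AddCommGroup W'] [Module ℝ W'] [Module ℂ W'] [IsScalarTower ℝ ℂ W']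
    [AddCommGroup Z] [Module ℝ Z] [Module ℂ Z] [IsScalarTower ℝ ℂ Z]
    [AddCommGroup Z'] [Module ℝ Z'] [Module ℂ Z'] [IsScalarTower ℝ ℂ Z']
    {f : V →ₗ[ℝ] Z} {g : V' →ₗ[ℝ] Z'} (S : W →ₗ[ℂ] Z) (S' : W' →ₗ[ℂ] Z')
    (f' : U →ₗ[ℝ] W) (g' : U' →ₗ[ℝ] W') (u : V →ₗ[ℝ] U) (u' : V' →ₗ[ℝ] U')
    (hf : ∀ v, f v = S (f' (u v))) (hg : ∀ v, g v = S' (g' (u' v))) (t : V ⊗[ℝ] V') :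
    mapC f g t = TensorProduct.map S S' (mapC f' g' (TensorProduct.map u u' t)) := by
  induction t with
  | zero => simp only [map_zero]
  | tmul v w => simp only [mapC_tmul, TensorProduct.map_tmul, hf, hg]
  | add x y hx hy => simp only [map_add, hx, hy]

variable {𝔤 : Type*} [LieRing 𝔤] [LieAlgebra ℝ 𝔤] {R : 𝔤 →ₗ[ℝ] 𝔤} {γ : ℝ}

lemma real_smul_eq {W : Type*} [AddCommGroup W] [Module ℝ W] [Module ℂ W] [IsScalarTower ℝ ℂ W]
    (c : ℝ) (x : W) : c • x = (c : ℂ) • x :=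
  (algebraMap_smul ℂ c x).symm

lemma mapC_smul_nonSplitR (η ε : ℝ) (t : 𝔤 ⊗[ℝ] 𝔤) :
    mapC (γ • nonSplitR R η) (γ • nonSplitR R ε) t =
      (γ : ℂ) • (γ : ℂ) • mapC (nonSplitR R η) (nonSplitR R ε) t := by
  induction t with
  | zero => simp only [map_zero, smul_zero]
  | tmul v w =>
    simp only [mapC_tmul, LinearMap.smul_apply, TensorProduct.smul_tmul',
      real_smul_eq, TensorProduct.tmul_smul]
  | add x y hx hy => simp only [map_add, hx, hy, smul_add]

/-- The four maps `R^η ⊗ R^ε` are jointly injective, since `R⁺ - R⁻ = 2 i`; the weights `η ε` form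
the tensor square of this difference. -/
lemma injective_sum_mapC_nonSplitR [FiniteDimensional ℝ 𝔤] (hγ : γ ≠ 0) : Function.Injective
    (∑ p : Bool × Bool, (sgn p.1 * sgn p.2) •
      mapC (γ • nonSplitR R (sgn p.1)) (γ • nonSplitR R (sgn p.2)) :
      𝔤 ⊗[ℝ] 𝔤 →ₗ[ℝ] (ℂ ⊗[ℝ] 𝔤) ⊗[ℂ] (ℂ ⊗[ℝ] 𝔤)) := by
  have h : ∀ t, (∑ p : Bool × Bool, (sgn p.1 * sgn p.2) •
      mapC (γ • nonSplitR R (sgn p.1)) (γ • nonSplitR R (sgn p.2)) :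
      𝔤 ⊗[ℝ] 𝔤 →ₗ[ℝ] (ℂ ⊗[ℝ] 𝔤) ⊗[ℂ] (ℂ ⊗[ℝ] 𝔤)) t =
      (2 * γ * Complex.I) • (2 * γ * Complex.I) • mapC incl incl t := by
    intro t
    induction t with
    | zero => simp only [map_zero, smul_zero]
    | tmul X Y =>
      refine (LinearMap.sum_apply _ _ _).trans ?_
      simp only [LinearMap.smul_apply, mapC_tmul, nonSplitR_apply, Fintype.sum_prod_type,
        Fintype.sum_bool, sgn, cond_true, cond_false, real_smul_eq, smul_add, smul_smul,
        TensorProduct.tmul_add, TensorProduct.add_tmul, ← TensorProduct.smul_tmul',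
        TensorProduct.tmul_smul]
      push_cast
      module
    | add x y hx hy => simp only [map_add, hx, hy, smul_add]
  intro s t hst
  rw [h, h] at hst
  have h2 : (2 * γ * Complex.I : ℂ) ≠ 0 := by
    simp [hγ]
  exact mapC_incl_injective (smul_right_injective _ h2 (smul_right_injective _ h2 hst))

lemma killingForm_incl [FiniteDimensional ℝ 𝔤] (X Y : 𝔤) :
    killingForm ℂ (ℂ ⊗[ℝ] 𝔤) (incl X) (incl Y) = (killingForm ℝ 𝔤 X Y : ℂ) := by
  have h := LieModule.traceForm_baseChange ℝ 𝔤 𝔤 ℂ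
  have h1 := LinearMap.congr_fun₂ h (incl X) (incl Y)
  refine h1.trans ?_
  simp [incl_apply]

lemma killingForm_nonSplitR [FiniteDimensional ℝ 𝔤] (η : ℝ) (X Y : 𝔤) :
    killingForm ℂ (ℂ ⊗[ℝ] 𝔤) (incl X) ((γ • nonSplitR R η) Y) =
      γ * (killingForm ℝ 𝔤 X (R Y) + η * killingForm ℝ 𝔤 X Y * Complex.I) := by
  rw [LinearMap.smul_apply, real_smul_eq γ (nonSplitR R η Y), nonSplitR_apply, map_smul, map_add,
    map_smul,
    killingForm_incl]
  have h : R.baseChange ℂ (incl Y) = incl (R Y) := by simp [incl_apply]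
  rw [h, killingForm_incl, smul_eq_mul, smul_eq_mul]
  ring

end ComplexTensor

section NonSplit

variable {E G : Type*} [NormedAddCommGroup E] [NormedSpace ℝ E] [FiniteDimensional ℝ E]
  [TopologicalSpace G] [ChartedSpace E G] [Group G] [LieGroup 𝓘(ℝ, E) ∞ G]
  {F Gs : Type*} [NormedAddCommGroup F] [NormedSpace ℝ F] [FiniteDimensional ℝ F]
  [TopologicalSpace Gs] [ChartedSpace F Gs] [Group Gs] [LieGroup 𝓘(ℝ, F) ∞ Gs]
  {V M : Type*} [NormedAddCommGroup V] [NormedSpace ℝ V]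
  [TopologicalSpace M] [ChartedSpace V M]
  {Fc Gc : Type*} [NormedAddCommGroup Fc] [NormedSpace ℂ Fc] [FiniteDimensional ℂ Fc]
  [TopologicalSpace Gc] [ChartedSpace Fc Gc] [Group Gc] [LieGroup 𝓘(ℂ, Fc) ω Gc]
  {PM : TensorField 𝓘(ℝ, V) M} {Γ : M → Gs}

/-- The identification of the real Lie algebra of a complex Lie group with `𝔤ᶜ`, as a real linear
map. -/
def realIso {𝔤 : Type*} [LieRing 𝔤] [LieAlgebra ℝ 𝔤]
    (ψ : GroupLieAlgebra 𝓘(ℂ, Fc) Gc ≃ₗ⁅ℂ⁆ ℂ ⊗[ℝ] 𝔤) :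
    GroupLieAlgebra 𝓘(ℝ, Fc) Gc →ₗ[ℝ] ℂ ⊗[ℝ] 𝔤 where
  toFun v := ψ (v : Fc)
  map_add' v w := map_add ψ (v : Fc) (w : Fc)
  map_smul' c v := (LinearMap.map_smul (ψ : GroupLieAlgebra 𝓘(ℂ, Fc) Gc →ₗ[ℂ] ℂ ⊗[ℝ] 𝔤) (c : ℂ)
    (v : Fc)).trans (real_smul_eq c (ψ (v : Fc))).symm

/-- The adjoint action of a complex Lie group, transported to `𝔤ᶜ`. -/
def AdC {𝔤 : Type*} [LieRing 𝔤] [LieAlgebra ℝ 𝔤]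
    (ψ : GroupLieAlgebra 𝓘(ℂ, Fc) Gc ≃ₗ⁅ℂ⁆ ℂ ⊗[ℝ] 𝔤) (g : Gc) : ℂ ⊗[ℝ] 𝔤 →ₗ[ℂ] ℂ ⊗[ℝ] 𝔤 :=
  (ψ : GroupLieAlgebra 𝓘(ℂ, Fc) Gc →ₗ[ℂ] ℂ ⊗[ℝ] 𝔤) ∘ₗ Ad 𝓘(ℂ, Fc) g ∘ₗ
    (ψ.symm : ℂ ⊗[ℝ] 𝔤 →ₗ[ℂ] GroupLieAlgebra 𝓘(ℂ, Fc) Gc)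

lemma AdC_realIso {𝔤 : Type*} [LieRing 𝔤] [LieAlgebra ℝ 𝔤]
    (ψ : GroupLieAlgebra 𝓘(ℂ, Fc) Gc ≃ₗ⁅ℂ⁆ ℂ ⊗[ℝ] 𝔤) (g : Gc) (X : GroupLieAlgebra 𝓘(ℝ, Fc) Gc) :
    AdC ψ g (realIso ψ X) = realIso ψ (Ad 𝓘(ℝ, Fc) g X) := by
  refine (congrArg (fun Y : GroupLieAlgebra 𝓘(ℂ, Fc) Gc => ψ (Ad 𝓘(ℂ, Fc) g Y))
    (ψ.symm_apply_apply (X : Fc))).trans ?_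
  exact congrArg (fun Y : Fc => ψ Y) (Ad_restrictScalars (A := Fc) g X).symm

lemma realIso_bracket [LieGroup 𝓘(ℝ, Fc) ∞ Gc] {𝔤 : Type*} [LieRing 𝔤] [LieAlgebra ℝ 𝔤]
    (ψ : GroupLieAlgebra 𝓘(ℂ, Fc) Gc ≃ₗ⁅ℂ⁆ ℂ ⊗[ℝ] 𝔤) (X Y : GroupLieAlgebra 𝓘(ℝ, Fc) Gc) :
    realIso ψ ⁅X, Y⁆ = LieAlgebra.ad ℂ _ (realIso ψ X) (realIso ψ Y) := by
  have : CompleteSpace Fc := FiniteDimensional.complete ℂ Fc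
  refine (congrArg (fun Y : Fc => ψ Y) (bracket_restrictScalars (A := Fc) (G := Gc) X Y)).trans ?_
  exact LieEquiv.map_lie ψ (X : Fc) (Y : Fc)

lemma realIso_surjective {𝔤 : Type*} [LieRing 𝔤] [LieAlgebra ℝ 𝔤]
    (ψ : GroupLieAlgebra 𝓘(ℂ, Fc) Gc ≃ₗ⁅ℂ⁆ ℂ ⊗[ℝ] 𝔤) : Function.Surjective (realIso ψ) :=
  fun x => ⟨(ψ.symm x : Fc), ψ.apply_symm_apply x⟩

/-- Right translation turns a relation for the left-translated bracket of `Γ` with itself into a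
bracket relation for the images of `Γ` under homomorphisms to a complex Lie group. -/
lemma isSTSC_hom_comp [LieGroup 𝓘(ℝ, Fc) ∞ Gc] {𝔤 : Type*} [LieRing 𝔤] [LieAlgebra ℝ 𝔤]
    {ψ : GroupLieAlgebra 𝓘(ℂ, Fc) Gc ≃ₗ⁅ℂ⁆ ℂ ⊗[ℝ] 𝔤} {D₁ D₂ : Gs →* Gc}
    (hD₁ : ContMDiff 𝓘(ℝ, F) 𝓘(ℝ, Fc) ∞ D₁) (hD₂ : ContMDiff 𝓘(ℝ, F) 𝓘(ℝ, Fc) ∞ D₂)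
    (hΓ : ContMDiff 𝓘(ℝ, V) 𝓘(ℝ, F) ∞ Γ) {γ : ℝ}
    {r : (ℂ ⊗[ℝ] 𝔤) ⊗[ℂ] (ℂ ⊗[ℝ] 𝔤)} {N : M → (ℂ ⊗[ℝ] 𝔤) ⊗[ℂ] (ℂ ⊗[ℝ] 𝔤)}
    (h : ∀ m, TensorProduct.map (AdC ψ (D₁ (Γ m))) (AdC ψ (D₂ (Γ m)))
        (mapC (realIso ψ ∘ₗ homDiff 𝓘(ℝ, F) 𝓘(ℝ, Fc) D₁) (realIso ψ ∘ₗ homDiff 𝓘(ℝ, F) 𝓘(ℝ, Fc) D₂)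
          (logTensor (F := F) PM Γ m)) =
      γ • (r - TensorProduct.map (AdC ψ (D₁ (Γ m))) (AdC ψ (D₂ (Γ m))) r) + N m) :
    IsSTSC PM ψ (fun m => D₁ (Γ m)) (fun m => D₂ (Γ m)) γ r N := by
  intro m right left
  have hL : ∀ g : Gc, (transR 𝓘(ℂ, Fc) g ∘ₗ
        (ψ.symm : ℂ ⊗[ℝ] 𝔤 →ₗ[ℂ] GroupLieAlgebra 𝓘(ℂ, Fc) Gc)) ∘ₗ AdC ψ g =
      transL 𝓘(ℂ, Fc) g ∘ₗ (ψ.symm : ℂ ⊗[ℝ] 𝔤 →ₗ[ℂ] GroupLieAlgebra 𝓘(ℂ, Fc) Gc) := by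
    intro g
    ext x
    exact (congrArg (fun Y => transR 𝓘(ℂ, Fc) g Y) (ψ.symm_apply_apply _)).trans (transR_Ad g _)
  have hd : ∀ {D : Gs →* Gc}, ContMDiff 𝓘(ℝ, F) 𝓘(ℝ, Fc) ∞ D → ∀ v : TangentSpace 𝓘(ℝ, V) m,
      diffC (V := V) (fun m => D (Γ m)) m v = ((transR 𝓘(ℂ, Fc) (D (Γ m)) ∘ₗ
        (ψ.symm : ℂ ⊗[ℝ] 𝔤 →ₗ[ℂ] GroupLieAlgebra 𝓘(ℂ, Fc) Gc)) ∘ₗ AdC ψ (D (Γ m)))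
          ((realIso ψ ∘ₗ homDiff 𝓘(ℝ, F) 𝓘(ℝ, Fc) D) (logDiff (F := F) (V := V) Γ m v)) := by
    intro D hD v
    refine (LinearMap.congr_fun (mfderiv_hom_comp hD hΓ m) v).trans ?_
    refine ((transR_restrictScalars _ _).trans ?_)
    refine congrArg (fun Y => transR 𝓘(ℂ, Fc) (D (Γ m)) Y) ?_
    refine ((congrArg (fun Y => (ψ.symm Y : Fc)) (AdC_realIso ψ (D (Γ m))
      (homDiff 𝓘(ℝ, F) 𝓘(ℝ, Fc) D (logDiff (F := F) Γ m v)))).trans ?_).symm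
    exact ψ.symm_apply_apply _
  have h1 : pbTensorC PM (fun m => D₁ (Γ m)) (fun m => D₂ (Γ m)) m =
      right (TensorProduct.map (AdC ψ (D₁ (Γ m))) (AdC ψ (D₂ (Γ m)))
        (mapC (realIso ψ ∘ₗ homDiff 𝓘(ℝ, F) 𝓘(ℝ, Fc) D₁) (realIso ψ ∘ₗ homDiff 𝓘(ℝ, F) 𝓘(ℝ, Fc) D₂)
          (logTensor (F := F) PM Γ m))) := by
    refine (mapC_comp _ _ _ _ (logDiff Γ m) (logDiff Γ m) (hd hD₁) (hd hD₂) (PM m)).trans ?_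
    exact (TensorProduct.map_map _ _ _ _ _).symm
  have h2 : left r = right (TensorProduct.map (AdC ψ (D₁ (Γ m))) (AdC ψ (D₂ (Γ m))) r) := by
    refine Eq.trans ?_ (TensorProduct.map_map _ _ _ _ _).symm
    rw [hL, hL]
  have h3 : ∀ x, right (γ • x) = (γ : ℂ) • right x := fun x =>
    (congrArg right (real_smul_eq γ x)).trans (right.map_smul _ x)
  rw [h1, h2, h m, map_add, h3, map_sub]

variable [LieAlgebra.IsKilling ℝ (GroupLieAlgebra 𝓘(ℝ, E) G)]
  {τ : GroupLieAlgebra 𝓘(ℝ, F) Gs ≃ₗ[ℝ] Module.Dual ℝ (GroupLieAlgebra 𝓘(ℝ, E) G)}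
  {R : GroupLieAlgebra 𝓘(ℝ, E) G →ₗ[ℝ] GroupLieAlgebra 𝓘(ℝ, E) G} {γ : ℝ}
  {ψ : GroupLieAlgebra 𝓘(ℂ, Fc) Gc ≃ₗ⁅ℂ⁆ ℂ ⊗[ℝ] GroupLieAlgebra 𝓘(ℝ, E) G}

lemma IsNonSplitRealisation.realIso_homDiff {η : ℝ} {D : Gs →* Gc}
    (hD : IsNonSplitRealisation γ R η τ ψ D) (ξ : GroupLieAlgebra 𝓘(ℝ, F) Gs) :
    realIso ψ (homDiff 𝓘(ℝ, F) 𝓘(ℝ, Fc) D ξ) = (γ • nonSplitR R η) (dualEquiv τ ξ) := by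
  have h := hD.differential (dualEquiv τ ξ)
  rw [← dualEquiv_symm_apply, LinearEquiv.symm_apply_apply] at h
  exact h

variable [T2Space Gs] [PreconnectedSpace Gs] [IsManifold 𝓘(ℝ, V) ∞ M]
  {ρ : M → G → M} {PG : TensorField 𝓘(ℝ, E) G}

lemma IsNonSplitRealisation.mem_subgroupPM {η : ℝ} {D : Gs →* Gc}
    (hD : IsNonSplitRealisation γ R η τ ψ D) (g : Gs) : D g ∈ subgroupPM R η ψ := by
  have : LieGroup 𝓘(ℝ, Fc) ∞ Gc := lieGroup_restrictScalars
  have h : ∀ ξ, ∃ X, realIso ψ (homDiff 𝓘(ℝ, F) 𝓘(ℝ, Fc) D ξ) = nonSplitR R η X :=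
    fun ξ => ⟨γ • dualEquiv τ ξ, by rw [map_smul]; exact hD.realIso_homDiff ξ⟩
  exact hom_mem_integralSubgroup hD.smooth h g

/-- The bracket relations for all pairs of signs in the non-split case. For equal signs the tensor
is `R₁₂`, and for different signs it is `R^±₁₂`. -/
lemma exists_central_nonSplit (hγ : γ ≠ 0) (hR : IsSkew R) (hYB : IsMCYBE R (-1))
    (hP : IsPoisson PM) (hρ : IsPoissonLieAction PM PG ρ) (hΓ : IsMomentMap PM ρ τ Γ)
    {D : Bool → Gs →* Gc} (hD : ∀ i, IsNonSplitRealisation γ R (sgn i) τ ψ (D i)) :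
    ∃ N : M → GroupLieAlgebra 𝓘(ℝ, E) G ⊗[ℝ] GroupLieAlgebra 𝓘(ℝ, E) G,
      (∀ m, TensorProduct.comm ℝ _ _ (N m) = -N m) ∧ IsCentral PM N ∧
      ∀ i k, IsSTSC PM ψ (fun m => D i (Γ m)) (fun m => D k (Γ m)) γ
        (mapC incl incl (kernel R) + (((sgn i - sgn k) / 2 : ℝ) * Complex.I) •
          mapC incl incl (kernel LinearMap.id)) fun m =>
          mapC (γ • nonSplitR R (sgn i)) (γ • nonSplitR R (sgn k)) (N m) := by
  have : FiniteDimensional ℝ (GroupLieAlgebra 𝓘(ℝ, E) G) := inferInstanceAs (FiniteDimensional ℝ E)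
  have : LieGroup 𝓘(ℝ, Fc) ∞ Gc := lieGroup_restrictScalars
  have : FiniteDimensional ℝ Fc := FiniteDimensional.complexToReal Fc
  have : IsTopologicalGroup Gc := topologicalGroup_of_lieGroup 𝓘(ℝ, Fc) ∞
  -- a topological group that is locally Euclidean is `T1`, hence Hausdorff
  have : T1Space Gc := 𝓘(ℝ, Fc).t1Space Gc
  have hs := fun i => (hD i).smooth
  have hd := fun i => (hD i).realIso_homDiff
  obtain ⟨N, hN, hNc, h⟩ := exists_central (𝕂 := ℂ) hP hρ hΓ
    (j := fun i => γ • nonSplitR R (sgn i)) (A := fun i g => AdC ψ (D i g))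
    (fun i x => by
      obtain ⟨X, rfl⟩ := realIso_surjective ψ x
      rw [AdC_realIso, map_one, Ad_one])
    (fun i ξ x => by
      obtain ⟨X, rfl⟩ := realIso_surjective ψ x
      rw [← hd]
      simp only [AdC_realIso, ← realIso_bracket]
      exact (hasDer_Ad_hom (hs i) ξ X).linear (realIso ψ))
    (fun i g ξ => by
      rw [← hd, ← hd, homDiff_Ad ((hs i).mdifferentiable (by simp)), AdC_realIso])
    (J := fun i k => mapC (γ • nonSplitR R (sgn i)) (γ • nonSplitR R (sgn k)))
    (fun _ _ _ _ => rfl) (fun p => sgn p.1 * sgn p.2) (injective_sum_mapC_nonSplitR hγ)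
    (r := fun i k => mapC incl incl (kernel R) + (((sgn i - sgn k) / 2 : ℝ) * Complex.I) •
          mapC incl incl (kernel LinearMap.id)) (γ := γ)
    (fun i k X => by
      have h := ad₂_nonSplitR hR hYB (sgn_eq i) (sgn_eq k) X
      have h1 : ad₂ ℂ ((γ • nonSplitR R (sgn i)) X) ((γ • nonSplitR R (sgn k)) X) =
          (γ : ℂ) • ad₂ ℂ (nonSplitR R (sgn i) X) (nonSplitR R (sgn k) X) := by
        simp only [ad₂, LinearMap.smul_apply, real_smul_eq γ (nonSplitR R _ _), map_smul,
          TensorProduct.map_smul_left, TensorProduct.map_smul_right, smul_add]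
      rw [h1, LinearMap.smul_apply, h, mapC_smul_nonSplitR, real_smul_eq γ, smul_neg, smul_neg])
  refine ⟨N, hN, hNc, fun i k => isSTSC_hom_comp (hs i) (hs k) hΓ.smooth fun m => ?_⟩
  rw [← h i k m]
  refine congrArg _ ((mapC_comp LinearMap.id LinearMap.id (γ • nonSplitR R (sgn i))
    (γ • nonSplitR R (sgn k)) (dualEquiv τ).toLinearMap (dualEquiv τ).toLinearMap
    (fun ξ => hd i ξ) (fun ξ => hd k ξ) _).trans ?_)
  rw [TensorProduct.map_id, LinearMap.id_apply]

/-- The imaginary part of this pairing is the infinitesimal action, up to the factor `-γ η`; the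
real part does not depend on the sign `η`. -/
lemma killingForm_logBracket_nonSplit (hΓ : IsMomentMap PM ρ τ Γ) {η : ℝ} {D : Gs →* Gc}
    (hD : IsNonSplitRealisation γ R η τ ψ D) (ε : GroupLieAlgebra 𝓘(ℝ, E) G) {f : M → ℝ}
    (hf : IsSmooth 𝓘(ℝ, V) f) (m : M) :
    killingForm ℂ (ℂ ⊗[ℝ] GroupLieAlgebra 𝓘(ℝ, E) G) (incl ε)
      (ψ (transLInv 𝓘(ℂ, Fc) (D (Γ m)) (pbMapC PM (fun m => D (Γ m)) f m))) =
      γ * (killingForm ℝ (GroupLieAlgebra 𝓘(ℝ, E) G) ε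
        (R (dualEquiv τ (logBracket (F := F) PM Γ f m))) - η * infAction ρ ε f m * Complex.I) := by
  have : FiniteDimensional ℝ (GroupLieAlgebra 𝓘(ℝ, E) G) := inferInstanceAs (FiniteDimensional ℝ E)
  have : LieGroup 𝓘(ℝ, Fc) ∞ Gc := lieGroup_restrictScalars
  have : FiniteDimensional ℝ Fc := FiniteDimensional.complexToReal Fc
  have h1 : ψ (transLInv 𝓘(ℂ, Fc) (D (Γ m)) (pbMapC PM (fun m => D (Γ m)) f m)) =
      (γ • nonSplitR R η) (dualEquiv τ (logBracket (F := F) PM Γ f m)) := by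
    rw [← hD.realIso_homDiff, ← transLInv_pbMap_hom_comp PM hD.smooth hΓ.smooth]
    exact congrArg (fun Y : Fc => ψ Y) (transLInv_restrictScalars _ _).symm
  rw [h1, killingForm_nonSplitR, hΓ.infAction_eq ε hf, ← killingForm_dualEquiv,
    LieModule.traceForm_comm ℝ _ _ _ ε]
  push_cast
  ring

end NonSplit

end PoissonLie

end

open PoissonLie in
theorem mainTheorem2
    -- the coboundary Poisson-Lie group `G`
    {E G : Type*} [NormedAddCommGroup E] [NormedSpace ℝ E] [FiniteDimensional ℝ E]
    [TopologicalSpace G] [T2Space G] [ChartedSpace E G] [Group G] [LieGroup 𝓘(ℝ, E) ∞ G]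
    [LieAlgebra.IsSemisimple ℝ (GroupLieAlgebra 𝓘(ℝ, E) G)]
    (R : GroupLieAlgebra 𝓘(ℝ, E) G →ₗ[ℝ] GroupLieAlgebra 𝓘(ℝ, E) G) (hR : IsSkew R)
    (γ : ℝ) (hγ : γ ≠ 0)
    -- the dual group `G*`
    {F Gs : Type*} [NormedAddCommGroup F] [NormedSpace ℝ F] [FiniteDimensional ℝ F]
    [TopologicalSpace Gs] [T2Space Gs] [ChartedSpace F Gs] [Group Gs] [LieGroup 𝓘(ℝ, F) ∞ Gs]
    [SimplyConnectedSpace Gs]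
    (τ : GroupLieAlgebra 𝓘(ℝ, F) Gs ≃ₗ[ℝ] Module.Dual ℝ (GroupLieAlgebra 𝓘(ℝ, E) G))
    (hτ : IsDualBracket (sklyanin (G := G) γ R) τ)
    -- the Poisson manifold `M`
    {V M : Type*} [NormedAddCommGroup V] [NormedSpace ℝ V] [FiniteDimensional ℝ V]
    [TopologicalSpace M] [T2Space M] [ChartedSpace V M] [IsManifold 𝓘(ℝ, V) ∞ M]
    (PM : TensorField 𝓘(ℝ, V) M) (hPM : IsPoisson PM)
    -- the Poisson-Lie action and its moment map
    (ρ : M → G → M) (hρ : IsPoissonLieAction PM (sklyanin γ R) ρ)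
    (Γ : M → Gs) (hΓ : IsMomentMap PM ρ τ Γ) :
    -- split case
    (IsMCYBE R 1 →
      ∀ D : Gs →* G × G, IsSplitRealisation γ R τ D →
      ∀ Γp Γm : M → G, (∀ m, (Γp m, Γm m) = D (Γ m)) →
        (∀ m, (Γp m, Γm m) ∈ subgroupDR (G := G) R) ∧
        (∃ N : M → GroupLieAlgebra 𝓘(ℝ, E) G ⊗[ℝ] GroupLieAlgebra 𝓘(ℝ, E) G,
          (∀ m, TensorProduct.comm ℝ _ _ (N m) = -N m) ∧ IsCentral PM N ∧
          IsSTS PM Γp Γp γ (kernel R) (fun m =>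
            TensorProduct.map (γ • splitR R 1) (γ • splitR R 1) (N m)) ∧
          IsSTS PM Γm Γm γ (kernel R) (fun m =>
            TensorProduct.map (γ • splitR R (-1)) (γ • splitR R (-1)) (N m)) ∧
          IsSTS PM Γp Γm γ (kernel (splitR R 1)) (fun m =>
            TensorProduct.map (γ • splitR R 1) (γ • splitR R (-1)) (N m)) ∧
          IsSTS PM Γm Γp γ (kernel (splitR R (-1))) (fun m =>
            TensorProduct.map (γ • splitR R (-1)) (γ • splitR R 1) (N m))) ∧
        (∀ (ε : GroupLieAlgebra 𝓘(ℝ, E) G) (f : M → ℝ), IsSmooth 𝓘(ℝ, V) f → ∀ m,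
          infAction ρ ε f m = -(1 / (2 * γ)) * killingForm ℝ (GroupLieAlgebra 𝓘(ℝ, E) G) ε
            (transLInv 𝓘(ℝ, E) (Γp m) (pbMap 𝓘(ℝ, E) PM Γp f m) -
              transLInv 𝓘(ℝ, E) (Γm m) (pbMap 𝓘(ℝ, E) PM Γm f m)))) ∧
    -- non-split case
    (IsMCYBE R (-1) →
      ∀ (Fc : Type uF) (Gc : Type uG) [NormedAddCommGroup Fc] [NormedSpace ℂ Fc]
        [FiniteDimensional ℂ Fc]
        [TopologicalSpace Gc] [ChartedSpace Fc Gc] [Group Gc] [LieGroup 𝓘(ℂ, Fc) ω Gc]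
        (ψ : GroupLieAlgebra 𝓘(ℂ, Fc) Gc ≃ₗ⁅ℂ⁆ ℂ ⊗[ℝ] GroupLieAlgebra 𝓘(ℝ, E) G)
        (Dp Dm : Gs →* Gc), IsNonSplitRealisation γ R 1 τ ψ Dp →
        IsNonSplitRealisation γ R (-1) τ ψ Dm →
      ∀ Γp Γm : M → Gc, (∀ m, Γp m = Dp (Γ m)) → (∀ m, Γm m = Dm (Γ m)) →
        (∀ m, Γp m ∈ subgroupPM R 1 ψ) ∧ (∀ m, Γm m ∈ subgroupPM R (-1) ψ) ∧
        (∃ N : M → GroupLieAlgebra 𝓘(ℝ, E) G ⊗[ℝ] GroupLieAlgebra 𝓘(ℝ, E) G,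
          (∀ m, TensorProduct.comm ℝ _ _ (N m) = -N m) ∧ IsCentral PM N ∧
          IsSTSC PM ψ Γp Γp γ (mapC incl incl (kernel R)) (fun m =>
            mapC (γ • nonSplitR R 1) (γ • nonSplitR R 1) (N m)) ∧
          IsSTSC PM ψ Γm Γm γ (mapC incl incl (kernel R)) (fun m =>
            mapC (γ • nonSplitR R (-1)) (γ • nonSplitR R (-1)) (N m)) ∧
          IsSTSC PM ψ Γp Γm γ (nonSplitKernel R 1) (fun m =>
            mapC (γ • nonSplitR R 1) (γ • nonSplitR R (-1)) (N m)) ∧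
          IsSTSC PM ψ Γm Γp γ (nonSplitKernel R (-1)) (fun m =>
            mapC (γ • nonSplitR R (-1)) (γ • nonSplitR R 1) (N m))) ∧
        (∀ (ε : GroupLieAlgebra 𝓘(ℝ, E) G) (f : M → ℝ), IsSmooth 𝓘(ℝ, V) f → ∀ m,
          let κ := killingForm ℂ (ℂ ⊗[ℝ] GroupLieAlgebra 𝓘(ℝ, E) G)
          let ξp := ψ (transLInv 𝓘(ℂ, Fc) (Γp m) (pbMapC PM Γp f m))
          let ξm := ψ (transLInv 𝓘(ℂ, Fc) (Γm m) (pbMapC PM Γm f m))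
          infAction ρ ε f m = -(1 / γ) * (κ (incl ε) ξp).im ∧
          infAction ρ ε f m = (1 / γ) * (κ (incl ε) ξm).im ∧
          (infAction ρ ε f m : ℂ) =
            -(1 / (2 * Complex.I * γ)) * κ (incl ε) (ξp - ξm)))
  := by
  -- the coefficients of the Casimir tensor for different signs
  have hpm : (sgn true - sgn false) / 2 = 1 := by norm_num [sgn]
  have hmp : (sgn false - sgn true) / 2 = -1 := by norm_num [sgn]
  constructor
  · intro hYB D hD Γp Γm hΓD
    obtain rfl : Γp = fun m => splitHom D true (Γ m) :=
      funext fun m => congrArg Prod.fst (hΓD m)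
    obtain rfl : Γm = fun m => splitHom D false (Γ m) :=
      funext fun m => congrArg Prod.snd (hΓD m)
    refine ⟨fun m => by rw [hΓD]; exact hD.mem_subgroupDR (Γ m), ?_,
      fun ε f hf m => infAction_split hγ hΓ hD ε hf m⟩
    obtain ⟨N, hN, hNc, h⟩ := exists_central_split hγ hR hYB hPM hρ hΓ hD
    refine ⟨N, hN, hNc, ?_, ?_, ?_, ?_⟩
    · simpa [sgn] using h true true
    · simpa [sgn] using h false false
    · have h1 := h true false
      rw [hpm, ← kernel_splitR] at h1
      exact h1
    · have h1 := h false true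
      rw [hmp, ← kernel_splitR] at h1
      exact h1
  · intro hYB Fc Gc _ _ _ _ _ _ _ ψ Dp Dm hDp hDm Γp Γm hΓp hΓm
    obtain rfl : Γp = fun m => Dp (Γ m) := funext hΓp
    obtain rfl : Γm = fun m => Dm (Γ m) := funext hΓm
    refine ⟨fun m => hDp.mem_subgroupPM (Γ m), fun m => hDm.mem_subgroupPM (Γ m), ?_, ?_⟩
    · obtain ⟨N, hN, hNc, h⟩ := exists_central_nonSplit (D := fun i => cond i Dp Dm) hγ hR hYB hPM
        hρ hΓ (by rintro (_ | _); exacts [hDm, hDp])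
      refine ⟨N, hN, hNc, ?_, ?_, ?_, ?_⟩
      · simpa [sgn] using h true true
      · simpa [sgn] using h false false
      · have h1 := h true false
        rw [hpm] at h1
        exact h1
      · have h1 := h false true
        rw [hmp] at h1
        exact h1
    · intro ε f hf m κ ξp ξm
      have hp : κ (incl ε) ξp = _ := killingForm_logBracket_nonSplit hΓ hDp ε hf m
      have hm : κ (incl ε) ξm = _ := killingForm_logBracket_nonSplit hΓ hDm ε hf m
      refine ⟨?_, ?_, ?_⟩
      · rw [hp]
        simp [hγ]
      · rw [hm]
        simp [hγ]
      · rw [map_sub, hp, hm]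
        have hγ' : (γ : ℂ) ≠ 0 := Complex.ofReal_ne_zero.2 hγ
        push_cast
        field_simp
        ring
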